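/- Let $(M,\omega)$ be a symplectic manifold of dimension $2m$ (real, smooth, Hausdorff, second countable, not necessarily compact or connected). A Lagrangian field on $M$ is a smooth vector bundle $\pi:E\to M$ of rank $m$ together with a surjective submersion $\lambda:E\to M$ such that $\lambda=\pi$ on the zero section and, for each $x\in M$, the restriction of $\lambda$ to the fiber $E_x$ is an embedding onto a Lagrangian submanifold $\Lambda_x$ of $M$ (so that $x\in\Lambda_x$). Let $(E,\lambda)$ and $(\tilde E,\tilde\lambda)$ be two Lagrangian fields on $M$ which are transversal, that is, $T_x\Lambda_x+T_x\tilde\Lambda_x=T_xM$ for every $x\in M$. Put $\Gamma=\{(z,\tilde z)\in E\times\tilde E:\lambda(z)=\tilde\lambda(\tilde z)\}$. (a) There are a neighborhood $W_\Gamma$ of $\{(0_x,\tilde 0_x):x\in M\}$ in $\Gamma$ and a neighborhood $V_\Gamma$ of the diagonal of $M^2$ such that $\pi\times\tilde\pi$ restricts to a diffeomorphism of $W_\Gamma$ onto $V_\Gamma$. For any such $W_\Gamma,V_\Gamma$, let $\gamma:V_\Gamma\to M$ be the map with $\gamma(\pi(z),\tilde\pi(\tilde z))=\lambda(z)=\tilde\lambda(\tilde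 z)$ for $(z,\tilde z)\in W_\Gamma$, and let $\Omega=\gamma^*\omega$. A potential of $\Omega$ on $U^2\subset V_\Gamma$ ($U\subset M$ open) is a smooth function $\Phi$ on $U^2$ with $\Omega=d_xd_y\Phi$, i.e. $\Omega=\frac{\partial^2\Phi}{\partial x^i\partial y^j}\,dx^i\wedge dy^j$. A 3-point Calabi function of $\Omega$ is a smooth function $T$ on a neighborhood $W_T$ of the diagonal of $M^3$ such that every $x_0\in M$ has a contractible open neighborhood $U$ with $U^2\subset V_\Gamma$ and $U^3\subset W_T$, for which $\Omega$ has a potential on $U^2$ and $$T(x,u,y)=\Phi(x,u)-\Phi(u,u)+\Phi(u,y)-\Phi(x,y)\qquad\text{on }U^3$$ for every potential $\Phi$ of $\Omega$ on $U^2$. (b) A 3-point Calabi function of $\Omega$ exists. (c) For every 3-point Calabi function $T:W_T\to\mathbb R$ of $\Omega$ there is a neighborhood $V_T\subset V_\Gamma$ of the diagonal of $M^2$ such that for all $(x,y)\in V_T$ one has $(x,\gamma(x,y),y)\in W_T$, and $\gamma(x,y)$ is a nondegenerate critical point of $u\mapsto T(x,u,y)$ with critical value $T(x,\gamma(x,y),y)=0$.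 (d) For every $x\in M$, let $A$ and $B$ be the derivatives at $(x,x)$ of $\gamma$ with respect to its first and its second argument; they are endomorphisms of $T_xM$, since $\gamma(x,x)=x$. Then $A$ and $B$ are complementary projectors ($A+B=1$, $A^2=A$, $B^2=B$), and the Hessian of $u\mapsto T(x,u,x)$ at its critical point $u=x$ is the bilinear form $(v,w)\mapsto\omega(v,(A-B)w)$ on $T_xM$, i.e. it has the matrix $C(A-B)$ with $C=(\omega_{kl}(x))$. -/

import Mathlib

open Set Topology Bundle
open scoped Manifold ContDiff

noncomputable section

namespace LagrangianFields

/-- The model space `ℝ^{2m}` of the symplectic manifold. -/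
abbrev Model (m : ℕ) : Type := EuclideanSpace ℝ (Fin (2 * m))

/-- The model fiber `ℝ^m` of the vector bundles. -/
abbrev Fib (m : ℕ) : Type := EuclideanSpace ℝ (Fin m)

section Forms

variable {m : ℕ} {M : Type*} [TopologicalSpace M] [ChartedSpace (Model m) M]

/-- The coordinate expression of a 2-form `symp` in the preferred chart at `x₀`, that is, the
pullback of `symp` by the inverse of this chart. -/
def inChart (symp : ∀ x : M, TangentSpace (𝓡 (2 * m)) x [⋀^Fin 2]→L[ℝ] ℝ) (x₀ : M)
    (e : Model m) : Model m [⋀^Fin 2]→L[ℝ] ℝ :=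
  (symp ((extChartAt (𝓡 (2 * m)) x₀).symm e)).compContinuousLinearMap
    (mfderiv 𝓘(ℝ, Model m) (𝓡 (2 * m)) (extChartAt (𝓡 (2 * m)) x₀).symm e)

/-- A symplectic form: a smooth closed nondegenerate 2-form. -/
structure IsSymplecticForm
    (symp : ∀ x : M, TangentSpace (𝓡 (2 * m)) x [⋀^Fin 2]→L[ℝ] ℝ) : Prop where
  smooth : ∀ x₀ : M, ContDiffOn ℝ ∞ (inChart symp x₀) (extChartAt (𝓡 (2 * m)) x₀).target
  closed : ∀ x₀ : M, ∀ e ∈ (extChartAt (𝓡 (2 * m)) x₀).target,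
    extDeriv (inChart symp x₀) e = 0
  nondegenerate : ∀ (x : M) (v : TangentSpace (𝓡 (2 * m)) x),
    (∀ w : TangentSpace (𝓡 (2 * m)) x, symp x ![v, w] = 0) → v = 0

/-- The pullback of a 2-form on `M` by a map `g : M × M → M`. -/
def pullbackForm (symp : ∀ x : M, TangentSpace (𝓡 (2 * m)) x [⋀^Fin 2]→L[ℝ] ℝ)
    (g : M × M → M) (p : M × M) :
    TangentSpace ((𝓡 (2 * m)).prod (𝓡 (2 * m))) p [⋀^Fin 2]→L[ℝ] ℝ :=
  (symp (g p)).compContinuousLinearMap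
    (mfderiv ((𝓡 (2 * m)).prod (𝓡 (2 * m))) (𝓡 (2 * m)) g p)

/-- The mixed second derivative of `Φ(x, y)`, in the direction `b` in the variable `y` and then
in the direction `a` in the variable `x`; in coordinates
`(∂²Φ / ∂xⁱ ∂yʲ) aⁱ bʲ`. -/
def mixedDeriv (Φ : M × M → ℝ) (p : M × M)
    (a : TangentSpace (𝓡 (2 * m)) p.1) (b : TangentSpace (𝓡 (2 * m)) p.2) : ℝ :=
  mfderiv (𝓡 (2 * m)) 𝓘(ℝ, ℝ)
    (fun x : M => (mfderiv (𝓡 (2 * m)) 𝓘(ℝ, ℝ) (fun y : M => Φ (x, y)) p.2 b : ℝ)) p.1 a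

/-- `Φ` is a potential on the open set `S ⊆ M × M` of the 2-form `Ω`:
it is smooth on `S` and `Ω = d_x d_y Φ = (∂²Φ / ∂xⁱ ∂yʲ) dxⁱ ∧ dyʲ` on `S`. -/
structure IsPotential
    (Ω : ∀ p : M × M, TangentSpace ((𝓡 (2 * m)).prod (𝓡 (2 * m))) p [⋀^Fin 2]→L[ℝ] ℝ)
    (S : Set (M × M)) (Φ : M × M → ℝ) : Prop where
  smooth : ContMDiffOn ((𝓡 (2 * m)).prod (𝓡 (2 * m))) 𝓘(ℝ, ℝ) ∞ Φ S
  eq_dd : ∀ p ∈ S, ∀ (a a' : TangentSpace (𝓡 (2 * m)) p.1)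
    (b b' : TangentSpace (𝓡 (2 * m)) p.2),
    Ω p ![((a, b) : TangentSpace ((𝓡 (2 * m)).prod (𝓡 (2 * m))) p), (a', b')] =
      mixedDeriv Φ p a b' - mixedDeriv Φ p a' b

/-- `T`, defined on the neighborhood `WT` of the diagonal of `M³`, is the 3-point Calabi function
`T(x, u, y) = Φ(x, u) - Φ(u, u) + Φ(u, y) - Φ(x, y)` of the 2-form `Ω`, which is given on
`V ⊆ M²`: every point of `M` has a contractible neighborhood `U` such that `Ω` has a potential on
`U²` and the formula holds on `U³` for every potential `Φ` of `Ω` on `U²`. -/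
structure IsCalabiFunction
    (Ω : ∀ p : M × M, TangentSpace ((𝓡 (2 * m)).prod (𝓡 (2 * m))) p [⋀^Fin 2]→L[ℝ] ℝ)
    (V : Set (M × M)) (WT : Set (M × M × M)) (T : M × M × M → ℝ) : Prop where
  isOpen : IsOpen WT
  diag_mem : ∀ x : M, (x, x, x) ∈ WT
  smooth : ContMDiffOn ((𝓡 (2 * m)).prod ((𝓡 (2 * m)).prod (𝓡 (2 * m)))) 𝓘(ℝ, ℝ) ∞ T WT
  eq_local : ∀ x₀ : M, ∃ U : Set M, IsOpen U ∧ x₀ ∈ U ∧ ContractibleSpace U ∧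
    U ×ˢ U ⊆ V ∧ U ×ˢ U ×ˢ U ⊆ WT ∧
    (∃ Φ : M × M → ℝ, IsPotential Ω (U ×ˢ U) Φ) ∧
    ∀ Φ : M × M → ℝ, IsPotential Ω (U ×ˢ U) Φ →
      ∀ x ∈ U, ∀ u ∈ U, ∀ y ∈ U,
        T (x, u, y) = Φ (x, u) - Φ (u, u) + Φ (u, y) - Φ (x, y)

/-- The second derivative of `f` at `p` in the preferred chart at `p`. The tangent space `T_p M`
is identified with `ℝ^{2m}` by this very chart, so that this is a bilinear form on `T_p M`; at a
critical point of `f` it is the Hessian. -/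
def hessianAt (f : M → ℝ) (p : M) (v w : TangentSpace (𝓡 (2 * m)) p) : ℝ :=
  fderiv ℝ (fderiv ℝ (f ∘ (extChartAt (𝓡 (2 * m)) p).symm)) (extChartAt (𝓡 (2 * m)) p p)
    (v : Model m) (w : Model m)

/-- `p` is a nondegenerate critical point of `f`, which is smooth around `p`. -/
structure IsNondegenerateCriticalPoint (f : M → ℝ) (p : M) : Prop where
  smooth : ContMDiffAt (𝓡 (2 * m)) 𝓘(ℝ, ℝ) ∞ f p
  critical : mfderiv (𝓡 (2 * m)) 𝓘(ℝ, ℝ) f p = 0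
  nondegenerate : ∀ v : TangentSpace (𝓡 (2 * m)) p,
    (∀ w : TangentSpace (𝓡 (2 * m)) p, hessianAt f p v w = 0) → v = 0

end Forms

section Fields

variable {m : ℕ} {M : Type*} [TopologicalSpace M] [ChartedSpace (Model m) M]
  (E : M → Type*) [TopologicalSpace (TotalSpace (Fib m) E)] [∀ x, AddCommGroup (E x)]
  [∀ x, Module ℝ (E x)] [∀ x, TopologicalSpace (E x)] [FiberBundle (Fib m) E]

/-- The restriction of `lam : E → M` to the fiber `E_x`, where `E_x` is identified with `ℝ^m` by
the preferred local trivialization at `x`. -/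
def fiberMap {E : M → Type*} [TopologicalSpace (TotalSpace (Fib m) E)]
    [∀ x, AddCommGroup (E x)] [∀ x, TopologicalSpace (E x)] [FiberBundle (Fib m) E]
    (lam : TotalSpace (Fib m) E → M) (x : M) (v : Fib m) : M :=
  lam ⟨x, (trivializationAt (Fib m) E x).symm x v⟩

/-- The map `lam` makes the rank `m` vector bundle `E` a Lagrangian field on `(M, symp)`: it is a
surjective submersion which embeds each fiber as a Lagrangian submanifold and which agrees with
the bundle projection on the zero section. As each fiber has dimension `m` and `M` has dimension
`2m`, Lagrangian means that `symp` vanishes on the tangent spaces of the submanifold. -/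
structure IsLagrangianField (symp : ∀ x : M, TangentSpace (𝓡 (2 * m)) x [⋀^Fin 2]→L[ℝ] ℝ)
    (lam : TotalSpace (Fib m) E → M) : Prop where
  submersion : Manifold.IsSubmersion ((𝓡 (2 * m)).prod 𝓘(ℝ, Fib m)) (𝓡 (2 * m)) ∞ lam
  surjective : Function.Surjective lam
  embedding : ∀ x : M,
    Manifold.IsSmoothEmbedding 𝓘(ℝ, Fib m) (𝓡 (2 * m)) ∞ (fiberMap lam x)
  lagrangian : ∀ (x : M) (v : Fib m) (a b : TangentSpace 𝓘(ℝ, Fib m) v),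
    symp (fiberMap lam x v) ![mfderiv 𝓘(ℝ, Fib m) (𝓡 (2 * m)) (fiberMap lam x) v a,
      mfderiv 𝓘(ℝ, Fib m) (𝓡 (2 * m)) (fiberMap lam x) v b] = 0
  zero_section : ∀ x : M, lam ⟨x, 0⟩ = x

variable {E}
  {E' : M → Type*} [TopologicalSpace (TotalSpace (Fib m) E')] [∀ x, AddCommGroup (E' x)]
  [∀ x, Module ℝ (E' x)] [∀ x, TopologicalSpace (E' x)] [FiberBundle (Fib m) E']

/-- The derivative at the origin of the restriction of `lam` to the fiber `E_x`, as a map to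
`T_x M` (note that `lam (0_x) = x`). Its range is the tangent space `T_x Λ_x` of
`Λ_x = lam (E_x)` at the point `x`. -/
def vertDeriv (lam : TotalSpace (Fib m) E → M) (x : M) : Fib m →L[ℝ] Model m :=
  mfderiv 𝓘(ℝ, Fib m) (𝓡 (2 * m)) (fiberMap lam x) 0

/-- The submanifolds `Λ_x` and `Λ'_x`, the images of the fibers over `x`, intersect transversally
at `x` for every `x`: their tangent spaces at `x` together span `T_x M`. -/
def Transversal (lam : TotalSpace (Fib m) E → M) (lam' : TotalSpace (Fib m) E' → M) : Prop :=
  ∀ x : M, (vertDeriv lam x).range ⊔ (vertDeriv lam' x).range = ⊤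

/-- A choice of a neighborhood `W` (that is, `W_Γ`) of the zero section of `E ⊕ E'` in
`Γ = {(z, z') ∈ E × E' | lam z = lam' z'}` and of a neighborhood `V` (that is, `V_Γ`) of the
diagonal of `M²` such that `(z, z') ↦ (π z, π' z')` is a diffeomorphism of `W` onto `V`,
with the inverse `inv` (whose values off `V` are irrelevant). Since `Γ` is an embedded
submanifold of `E × E'`, smoothness of the inverse is smoothness as a map to `E × E'`. -/
structure IntersectionData (lam : TotalSpace (Fib m) E → M)
    (lam' : TotalSpace (Fib m) E' → M) where
  /-- The neighborhood of the zero section in `Γ`. -/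
  W : Set (TotalSpace (Fib m) E × TotalSpace (Fib m) E')
  /-- The neighborhood of the diagonal in `M²`. -/
  V : Set (M × M)
  /-- The inverse diffeomorphism. -/
  inv : M × M → TotalSpace (Fib m) E × TotalSpace (Fib m) E'
  isOpen_W : ∃ O : Set (TotalSpace (Fib m) E × TotalSpace (Fib m) E'),
    IsOpen O ∧ W = O ∩ {q | lam q.1 = lam' q.2}
  zero_mem : ∀ x : M, ((⟨x, 0⟩, ⟨x, 0⟩) : TotalSpace (Fib m) E × TotalSpace (Fib m) E') ∈ W
  isOpen_V : IsOpen V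
  diag_mem : ∀ x : M, (x, x) ∈ V
  proj_mem : ∀ q ∈ W, (q.1.proj, q.2.proj) ∈ V
  inv_mem : ∀ p ∈ V, inv p ∈ W
  inv_proj : ∀ q ∈ W, inv (q.1.proj, q.2.proj) = q
  proj_inv : ∀ p ∈ V, ((inv p).1.proj, (inv p).2.proj) = p
  smooth_inv : ContMDiffOn ((𝓡 (2 * m)).prod (𝓡 (2 * m)))
    (((𝓡 (2 * m)).prod 𝓘(ℝ, Fib m)).prod ((𝓡 (2 * m)).prod 𝓘(ℝ, Fib m))) ∞ inv V

/-- The intersection mapping `γ`, determined on `V` by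
`γ (π z, π' z') = lam z = lam' z'` for `(z, z') ∈ W`. -/
def IntersectionData.gamma {lam : TotalSpace (Fib m) E → M} {lam' : TotalSpace (Fib m) E' → M}
    (D : IntersectionData lam lam') (p : M × M) : M :=
  lam (D.inv p).1

/-- The derivative at `x` of `t ↦ γ(t, x)`, as an endomorphism of `T_x M` (note `γ(x, x) = x`). -/
def IntersectionData.projA {lam : TotalSpace (Fib m) E → M} {lam' : TotalSpace (Fib m) E' → M}
    (D : IntersectionData lam lam') (x : M) : Model m →L[ℝ] Model m :=
  mfderiv (𝓡 (2 * m)) (𝓡 (2 * m)) (fun t : M => D.gamma (t, x)) x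

/-- The derivative at `x` of `t ↦ γ(x, t)`, as an endomorphism of `T_x M`. -/
def IntersectionData.projB {lam : TotalSpace (Fib m) E → M} {lam' : TotalSpace (Fib m) E' → M}
    (D : IntersectionData lam lam') (x : M) : Model m →L[ℝ] Model m :=
  mfderiv (𝓡 (2 * m)) (𝓡 (2 * m)) (fun t : M => D.gamma (x, t)) x

end Fields

end LagrangianFields

end

/-! (a) In coordinates around `(0_x, 0_x)`, `Γ` is the zero set of `lam - lam'`. Transversality and
the count `m + m = 2m` make the derivative of this difference in the two fiber variables bijective,
so the implicit function theorem gives a local section of `π × π'` with values in `Γ`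
(`exists_local_section`). Local uniqueness makes these sections agree near the diagonal, and
paracompactness glues them (`exists_glue`, `nonempty_intersectionData`).

(b) For fixed `x` the point `γ(x, y)` moves in `Λ_x`, for fixed `y` in `Λ'_y`. Hence the closed form
`Ω = γ^*ω` vanishes on two vectors tangent to the same factor, and its mixed coefficients are closed
in each variable separately. Integrating first in `x` and then in `y` gives a potential
(`exists_potential_of_extDeriv_eq_zero`). Two potentials on a convex product differ by a function
with vanishing mixed derivative, which contributes nothing to `T`. So the local functions `T` agree
near the diagonal and glue (`exists_isCalabiFunction`).

(c) Let `u = γ(x, y) = lam z = lam' z'`. Joining `z` and `z'` to `0_u` inside the level sets of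
`lam` and `lam'` and projecting to `M` gives curves `s` from `u` to `x` and `r` from `u` to `y` with
`γ(s t, r τ) = u` for all `t`, `τ` (`eventually_exists_paths`). The derivative of `γ` kills `(s',
0)` and `(0, r')`, so the mixed derivative of `Φ` vanishes as soon as one of these velocities is
inserted. Integration over the rectangle gives `T = 0`, and integration along its sides gives `∂T/∂u
= 0` (`calabi_critical`). Nondegeneracy holds on the diagonal by (d) and is an open condition.

(d) Differentiating `γ(t, t) = t` gives `A + B = 1`, and `γ(γ(t, x), x) = γ(t, x)` gives `A² = A`.
In the Hessian the pure second derivatives of `Φ` cancel; what remains is `-ω(Av, Bw) - ω(Aw, Bv)`,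
which equals `ω(v, (A - B)w)` because the images of `A` and `B` are isotropic. Nondegeneracy follows
since `A - B` is an involution. -/

noncomputable section

namespace LagrangianFields

set_option linter.unusedSectionVars false

/-! ### Smooth dependence of integrals over `[0, 1]` on a parameter. -/

section ParametricIntegral

variable {X F : Type} [NormedAddCommGroup X] [NormedSpace ℝ X] [FiniteDimensional ℝ X]
  [NormedAddCommGroup F] [NormedSpace ℝ F]

/-- The tube lemma puts a compact product of a closed ball and `[0, 1]` inside `O`; the parameter
derivative is bounded there by a constant, which dominates it. -/
theorem hasFDerivAt_intervalIntegral_of_contDiffOn {f : X × ℝ → F} {O : Set (X × ℝ)}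
    (hO : IsOpen O) (hf : ContDiffOn ℝ 1 f O) {x₀ : X} (hx₀ : ∀ t ∈ Icc (0 : ℝ) 1, (x₀, t) ∈ O) :
    HasFDerivAt (fun x => ∫ t in (0 : ℝ)..1, f (x, t))
      (∫ t in (0 : ℝ)..1, (fderiv ℝ f (x₀, t)).comp (.inl ℝ X ℝ)) x₀ := by
  have : ProperSpace X := FiniteDimensional.proper ℝ X
  obtain ⟨u, v, hu, hv, hxu, hIv, huv⟩ := generalized_tube_lemma (s := {x₀}) isCompact_singleton
    (isCompact_Icc (a := (0 : ℝ)) (b := 1)) (n := O) hO (by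
      rintro ⟨a, t⟩ ⟨ha, ht⟩
      obtain rfl : a = x₀ := ha
      exact hx₀ t ht)
  obtain ⟨ε, hε, hball⟩ := Metric.nhds_basis_closedBall.mem_iff.1
    (hu.mem_nhds (hxu (mem_singleton x₀)))
  have hsub : Metric.closedBall x₀ ε ×ˢ Icc (0 : ℝ) 1 ⊆ O :=
    (prod_mono hball hIv).trans huv
  have hcf : ContinuousOn f O := hf.continuousOn
  have hcd : ContinuousOn (fun p => (fderiv ℝ f p).comp (.inl ℝ X ℝ)) O :=
    (hf.continuousOn_fderiv_of_isOpen hO le_rfl).clm_comp continuousOn_const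
  obtain ⟨C, hC⟩ := ((isCompact_closedBall x₀ ε).prod
    (isCompact_Icc (a := (0 : ℝ)) (b := 1))).exists_bound_of_continuousOn (hcd.mono hsub)
  have hslice : ∀ x ∈ Metric.closedBall x₀ ε, ∀ {G : Type} [NormedAddCommGroup G]
      {g : X × ℝ → G}, ContinuousOn g O → ContinuousOn (fun t => g (x, t)) (Icc (0 : ℝ) 1) := by
    intro x hx G _ g hg
    exact hg.comp (by fun_prop) fun t ht => hsub ⟨hx, ht⟩
  have hI : uIcc (0 : ℝ) 1 = Icc 0 1 := uIcc_of_le zero_le_one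
  have hIoc : Set.uIoc (0 : ℝ) 1 = Ioc 0 1 := uIoc_of_le zero_le_one
  refine intervalIntegral.hasFDerivAt_integral_of_dominated_of_fderiv_le
    (F := fun x t => f (x, t)) (F' := fun x t => (fderiv ℝ f (x, t)).comp (.inl ℝ X ℝ))
    (bound := fun _ => C) (s := Metric.closedBall x₀ ε) (Metric.closedBall_mem_nhds x₀ hε)
    ?_ ?_ ?_ ?_ ?_ ?_
  · filter_upwards [Metric.closedBall_mem_nhds x₀ hε] with x hx
    rw [hIoc]
    exact ((hslice x hx hcf).mono Ioc_subset_Icc_self).aestronglyMeasurable measurableSet_Ioc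
  · exact (hI ▸ hslice x₀ (Metric.mem_closedBall_self hε.le) hcf).intervalIntegrable
  · rw [hIoc]
    exact ((hslice x₀ (Metric.mem_closedBall_self hε.le) hcd).mono
      Ioc_subset_Icc_self).aestronglyMeasurable measurableSet_Ioc
  · refine Filter.Eventually.of_forall fun t ht x hx => ?_
    exact hC (x, t) ⟨hx, Ioc_subset_Icc_self (hIoc ▸ ht)⟩
  · exact intervalIntegrable_const
  · refine Filter.Eventually.of_forall fun t ht x hx => ?_
    have hm : (x, t) ∈ O := hsub ⟨hx, Ioc_subset_Icc_self (hIoc ▸ ht)⟩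
    exact ((hf.differentiableOn one_ne_zero).differentiableAt (hO.mem_nhds hm)).hasFDerivAt.comp x
      (hasFDerivAt_prodMk_left x t)

/-- Induction on the order of differentiability: the derivative is again such an integral, with
values in a space of linear maps, so `F` has to vary in the induction. -/
theorem contDiffOn_intervalIntegral {f : X × ℝ → F} {O : Set (X × ℝ)} {U : Set X}
    (hO : IsOpen O) (hU : IsOpen U) (hf : ContDiffOn ℝ ∞ f O)
    (hUO : ∀ x ∈ U, ∀ t ∈ Icc (0 : ℝ) 1, (x, t) ∈ O) :
    ContDiffOn ℝ ∞ (fun x => ∫ t in (0 : ℝ)..1, f (x, t)) U := by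
  refine contDiffOn_infty.2 fun n => ?_
  induction n generalizing F with
  | zero =>
    refine contDiffOn_zero.2 fun x hx => ?_
    exact (hasFDerivAt_intervalIntegral_of_contDiffOn hO (hf.of_le (by simp))
      (hUO x hx)).continuousAt.continuousWithinAt
  | succ n ih =>
    have hd : ∀ x ∈ U, HasFDerivAt (fun x => ∫ t in (0 : ℝ)..1, f (x, t))
      (∫ t in (0 : ℝ)..1, (fderiv ℝ f (x, t)).comp (.inl ℝ X ℝ)) x := fun x hx =>
        hasFDerivAt_intervalIntegral_of_contDiffOn hO (hf.of_le (by simp)) (hUO x hx)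
    push_cast
    refine (contDiffOn_succ_iff_fderiv_of_isOpen hU).2
      ⟨fun x hx => (hd x hx).differentiableAt.differentiableWithinAt, by simp, ?_⟩
    refine (ih (f := fun p => (fderiv ℝ f p).comp (.inl ℝ X ℝ)) ?_).congr
      fun x hx => (hd x hx).fderiv
    exact (hf.fderiv_of_isOpen hO (by simp)).clm_comp contDiffOn_const

end ParametricIntegral

/-! ### Poincaré lemmas and mixed potentials on convex sets. -/

section Poincare

variable {X Y F : Type} [NormedAddCommGroup X] [NormedSpace ℝ X] [FiniteDimensional ℝ X]
  [NormedAddCommGroup Y] [NormedSpace ℝ Y] [FiniteDimensional ℝ Y]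
  [NormedAddCommGroup F] [NormedSpace ℝ F] [CompleteSpace F]

/-- The Poincaré lemma for 1-forms on a convex set, depending smoothly on a parameter. The last
clause says that linear relations of the parameter derivative of the form are inherited by its
primitive. -/
theorem exists_primitive_with_parameter {B : Set X} {C : Set Y} (hBo : IsOpen B) (hB : Convex ℝ B)
    (hC : IsOpen C) {K : X × Y → X →L[ℝ] F} (hK : ContDiffOn ℝ ∞ K (B ×ˢ C))
    (hsymm : ∀ p ∈ B ×ˢ C, ∀ a a', fderiv ℝ K p (a, 0) a' = fderiv ℝ K p (a', 0) a) :
    ∃ f : X × Y → F, ContDiffOn ℝ ∞ f (B ×ˢ C) ∧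
      (∀ x ∈ B, ∀ y ∈ C, HasFDerivAt (fun x => f (x, y)) (K (x, y)) x) ∧
      ∀ S S' : (Y →L[ℝ] F) →L[ℝ] ℝ,
        (∀ p ∈ B ×ˢ C, ∀ a, S (((fderiv ℝ K p).comp (.inr ℝ X Y)).flip a) =
          S' (((fderiv ℝ K p).comp (.inr ℝ X Y)).flip a)) →
        ∀ p ∈ B ×ˢ C, S ((fderiv ℝ f p).comp (.inr ℝ X Y)) =
          S' ((fderiv ℝ f p).comp (.inr ℝ X Y)) := by
  rcases B.eq_empty_or_nonempty with rfl | ⟨x₀, hx₀⟩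
  · exact ⟨0, by simp, by simp, by simp⟩
  have hBC : IsOpen (B ×ˢ C) := hBo.prod hC
  let c : (X × Y) × ℝ → X × Y := fun q => (AffineMap.lineMap x₀ q.1.1 q.2, q.1.2)
  have hc : ContDiff ℝ ∞ c := by
    simp only [c, AffineMap.lineMap_apply_module']
    fun_prop
  -- The primitive is the integral of `K` along the segment from `x₀` to `x`, with `y` fixed; `h` is
  -- its integrand.
  let h : (X × Y) × ℝ → F := fun q => K (c q) (q.1.1 - x₀)
  have hh : ContDiffOn ℝ ∞ h (c ⁻¹' (B ×ˢ C)) :=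
    (hK.comp hc.contDiffOn fun q hq => hq).clm_apply (by fun_prop)
  have hO : IsOpen (c ⁻¹' (B ×ˢ C)) := hBC.preimage hc.continuous
  have hmem : ∀ p ∈ B ×ˢ C, ∀ t ∈ Icc (0 : ℝ) 1, (p, t) ∈ c ⁻¹' (B ×ˢ C) :=
    fun p hp t ht => ⟨hB.lineMap_mem hx₀ hp.1 ht, hp.2⟩
  have hKd : ∀ p ∈ B ×ˢ C, HasFDerivAt K (fderiv ℝ K p) p := fun p hp =>
    ((hK.differentiableOn (by simp)).differentiableAt (hBC.mem_nhds hp)).hasFDerivAt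
  refine ⟨fun p => ∫ t in (0 : ℝ)..1, h (p, t),
    contDiffOn_intervalIntegral hO hBC hh hmem, ?_, ?_⟩
  · intro x hx y hy
    have hd : ∀ x ∈ B, HasFDerivAt (fun x => K (x, y))
        ((fderiv ℝ K (x, y)).comp (.inl ℝ X Y)) x := fun x hx =>
      (hKd (x, y) ⟨hx, hy⟩).comp x (hasFDerivAt_prodMk_left x y)
    have := hB.hasFDerivWithinAt_curveIntegral_segment_of_hasFDerivWithinAt_symmetric
      (fun x hx => (hd x hx).hasFDerivWithinAt)
      (fun a ha v _ w _ => by simpa using hsymm (a, y) ⟨ha, hy⟩ v w) hx₀ hx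
    simpa only [curveIntegral_segment] using this.hasFDerivAt (hBo.mem_nhds hx)
  · intro S S' hS p hp
    -- The `y`-derivative of the integrand is that of `K` at a point of the segment, evaluated at `x
    -- - x₀`. So a linear relation valid for every vector `a` holds for the integrand, and it
    -- survives integration because `S` and `S'` commute with the integral.
    have hder : ∀ t ∈ Icc (0 : ℝ) 1,
        ((fderiv ℝ h (p, t)).comp (.inl ℝ (X × Y) ℝ)).comp (.inr ℝ X Y) =
          ((fderiv ℝ K (c (p, t))).comp (.inr ℝ X Y)).flip (p.1 - x₀) := by
      intro t ht
      have h1 : HasFDerivAt (fun y : Y => ((p.1, y), t)) ((ContinuousLinearMap.inl ℝ (X × Y) ℝ).comp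
          (.inr ℝ X Y)) p.2 :=
        (hasFDerivAt_prodMk_left (𝕜 := ℝ) ((p.1, p.2) : X × Y) t).comp p.2
          (hasFDerivAt_prodMk_right p.1 p.2)
      have h2 := ((hh.differentiableOn (by simp)).differentiableAt
        (hO.mem_nhds (hmem p hp t ht))).hasFDerivAt.comp p.2 h1
      have h3 : HasFDerivAt (fun y : Y => K (c ((p.1, y), t)) (p.1 - x₀))
          (((fderiv ℝ K (c (p, t))).comp (.inr ℝ X Y)).flip (p.1 - x₀)) p.2 := by
        have h4 : HasFDerivAt (fun y : Y => K (c ((p.1, y), t)))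
            ((fderiv ℝ K (c (p, t))).comp (.inr ℝ X Y)) p.2 :=
          (hKd _ (hmem p hp t ht)).comp p.2 (hasFDerivAt_prodMk_right (𝕜 := ℝ) _ p.2)
        exact (h4.clm_apply (hasFDerivAt_const (p.1 - x₀) p.2)).congr_fderiv (by ext; simp)
      exact h2.unique h3
    have hcont : ContinuousOn (fun t : ℝ => (fderiv ℝ h (p, t)).comp (.inl ℝ (X × Y) ℝ))
        (Icc 0 1) :=
      ((hh.continuousOn_fderiv_of_isOpen hO (by simp)).comp (by fun_prop)
        fun t ht => hmem p hp t ht).clm_comp continuousOn_const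
    rw [(hasFDerivAt_intervalIntegral_of_contDiffOn hO (hh.of_le (by simp)) (hmem p hp)).fderiv]
    let R : ((X × Y) →L[ℝ] F) →L[ℝ] (Y →L[ℝ] F) :=
      (ContinuousLinearMap.compL ℝ Y (X × Y) F).flip (.inr ℝ X Y)
    have hint : IntervalIntegrable
        (fun t : ℝ => (fderiv ℝ h (p, t)).comp (.inl ℝ (X × Y) ℝ)) MeasureTheory.volume 0 1 :=
      (uIcc_of_le (zero_le_one (α := ℝ)) ▸ hcont).intervalIntegrable
    change (S.comp R) _ = (S'.comp R) _
    rw [← ContinuousLinearMap.intervalIntegral_comp_comm _ hint,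
      ← ContinuousLinearMap.intervalIntegral_comp_comm _ hint]
    refine intervalIntegral.integral_congr fun t ht => ?_
    rw [uIcc_of_le zero_le_one] at ht
    have := hS (c (p, t)) (hmem p hp t ht) (p.1 - x₀)
    rw [← hder t ht] at this
    exact this

/-- A family of bilinear forms `K (x, y)` on `X × Y` which is closed in each of the variables `x`
and `y` is the mixed second derivative of a function. -/
theorem exists_mixed_potential {B : Set X} {C : Set Y} (hBo : IsOpen B) (hB : Convex ℝ B)
    (hCo : IsOpen C) (hC : Convex ℝ C) {K : X × Y → X →L[ℝ] Y →L[ℝ] ℝ}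
    (hK : ContDiffOn ℝ ∞ K (B ×ˢ C))
    (hx : ∀ p ∈ B ×ˢ C, ∀ a a' b, fderiv ℝ K p (a, 0) a' b = fderiv ℝ K p (a', 0) a b)
    (hy : ∀ p ∈ B ×ˢ C, ∀ a b b', fderiv ℝ K p (0, b) a b' = fderiv ℝ K p (0, b') a b) :
    ∃ Φ : X × Y → ℝ, ContDiffOn ℝ ∞ Φ (B ×ˢ C) ∧
      ∀ p ∈ B ×ˢ C, ∀ a b, fderiv ℝ (fderiv ℝ Φ) p (a, 0) (0, b) = K p a b := by
  -- First integration, in `x`: `f` takes values in the covectors on `Y`.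
  obtain ⟨f, hf, hfK, hfS⟩ := exists_primitive_with_parameter hBo hB hCo hK
    fun p hp a a' => by ext b; exact hx p hp a a' b
  have hCB : IsOpen (C ×ˢ B) := hCo.prod hBo
  have hBC : IsOpen (B ×ˢ C) := hBo.prod hCo
  have hfd : ∀ p ∈ B ×ˢ C, HasFDerivAt f (fderiv ℝ f p) p := fun p hp =>
    ((hf.differentiableOn (by simp)).differentiableAt (hBC.mem_nhds hp)).hasFDerivAt
  have hswap : ∀ q : Y × X, q ∈ C ×ˢ B → q.swap ∈ B ×ˢ C := fun q hq => ⟨hq.2, hq.1⟩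
  -- Second integration, in `y`, with the factors swapped so that `y` becomes the integration
  -- variable. That `f` is closed in `y` is inherited from `K` through `hfS`, with evaluation at
  -- `(b, b')` and at `(b', b)` as the two functionals.
  obtain ⟨g, hg, hgf, -⟩ := exists_primitive_with_parameter hCo hC hBo
    (K := fun q : Y × X => f q.swap) (hf.comp (contDiff_snd.prodMk contDiff_fst).contDiffOn hswap) (by
      intro q hq b b'
      have h1 : HasFDerivAt (fun q : Y × X => f q.swap) ((fderiv ℝ f q.swap).comp
          ((ContinuousLinearMap.snd ℝ Y X).prod (.fst ℝ Y X))) q :=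
        (hfd q.swap (hswap q hq)).comp q
          ((ContinuousLinearMap.snd ℝ Y X).prod (.fst ℝ Y X)).hasFDerivAt
      let ev : Y → Y → (Y →L[ℝ] Y →L[ℝ] ℝ) →L[ℝ] ℝ := fun b b' =>
        (ContinuousLinearMap.apply ℝ ℝ b').comp (ContinuousLinearMap.apply ℝ (Y →L[ℝ] ℝ) b)
      have h2 := hfS (ev b b') (ev b' b) (fun p hp a => by
        simpa [ev] using hy p hp a b b') q.swap (hswap q hq)
      rw [h1.fderiv]
      simpa [ev] using h2)
  have hΦ : ContDiffOn ℝ ∞ (fun p : X × Y => g p.swap) (B ×ˢ C) :=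
    hg.comp (contDiff_snd.prodMk contDiff_fst).contDiffOn fun p hp => ⟨hp.2, hp.1⟩
  refine ⟨fun p => g p.swap, hΦ, ?_⟩
  have h1 : ∀ p ∈ B ×ˢ C, (fderiv ℝ (fun p : X × Y => g p.swap) p).comp (.inr ℝ X Y) = f p := by
    rintro ⟨x, y⟩ hp
    have h2 := ((hΦ.differentiableOn (by simp)).differentiableAt
        (hBC.mem_nhds hp)).hasFDerivAt.comp y (hasFDerivAt_prodMk_right x y)
    exact h2.unique (hgf y hp.2 x hp.1)
  rintro ⟨x, y⟩ hp a b
  have h3 : HasFDerivAt (fderiv ℝ (fun p : X × Y => g p.swap))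
      (fderiv ℝ (fderiv ℝ (fun p : X × Y => g p.swap)) (x, y)) (x, y) :=
    (((hΦ.fderiv_of_isOpen (m := ∞) hBC (by simp)).differentiableOn (by simp)).differentiableAt
      (hBC.mem_nhds hp)).hasFDerivAt
  have h3' : HasFDerivAt (fun x => fderiv ℝ (fun p : X × Y => g p.swap) (x, y))
      ((fderiv ℝ (fderiv ℝ (fun p : X × Y => g p.swap)) (x, y)).comp (.inl ℝ X Y)) x :=
    HasFDerivAt.comp (g := fderiv ℝ (fun p : X × Y => g p.swap)) (f := fun x => (x, y)) x h3
      (hasFDerivAt_prodMk_left x y)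
  have h4 := h3'.clm_comp
    (hasFDerivAt_const (ContinuousLinearMap.inr ℝ X Y) x)
  have h5 := (hfK x hp.1 y hp.2).congr_of_eventuallyEq (f₁ := fun x =>
      (fderiv ℝ (fun p : X × Y => g p.swap) (x, y)).comp (.inr ℝ X Y)) (by
    filter_upwards [hBo.mem_nhds hp.1] with x' hx'
    exact h1 (x', y) ⟨hx', hp.2⟩)
  have h6 := congrArg (fun L => L a b) (h4.unique h5)
  simpa using h6

/-- The bilinear form of an alternating 2-form. -/
def toBilin {V : Type*} [NormedAddCommGroup V] [NormedSpace ℝ V] (f : V [⋀^Fin 2]→L[ℝ] ℝ) :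
    V →L[ℝ] V →L[ℝ] ℝ :=
  (continuousMultilinearCurryFin1 ℝ V ℝ : (V [×1]→L[ℝ] ℝ) →L[ℝ] (V →L[ℝ] ℝ)).comp
    f.toContinuousMultilinearMap.curryLeft

theorem toBilin_apply {V : Type*} [NormedAddCommGroup V] [NormedSpace ℝ V]
    (f : V [⋀^Fin 2]→L[ℝ] ℝ) (v w : V) : toBilin f v w = f ![v, w] := by
  change f (Fin.cons v (Fin.snoc 0 w)) = _
  congr 1
  ext i
  fin_cases i <;> rfl

theorem toBilin_swap {V : Type*} [NormedAddCommGroup V] [NormedSpace ℝ V]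
    (f : V [⋀^Fin 2]→L[ℝ] ℝ) (v w : V) : toBilin f v w = - toBilin f w v := by
  rw [toBilin_apply, toBilin_apply]
  refine Eq.trans ?_ (f.toAlternatingMap.map_swap ![w, v] (zero_ne_one (α := Fin 2)))
  change f _ = f _
  congr 1
  ext i
  fin_cases i <;> rfl

theorem contDiffOn_toBilin {W V : Type} [NormedAddCommGroup W] [NormedSpace ℝ W]
    [NormedAddCommGroup V] [NormedSpace ℝ V] [FiniteDimensional ℝ V]
    {f : W → V [⋀^Fin 2]→L[ℝ] ℝ} {s : Set W} (hf : ContDiffOn ℝ ∞ f s) :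
    ContDiffOn ℝ ∞ (fun p => toBilin (f p)) s := by
  refine contDiffOn_clm_apply.2 fun a => contDiffOn_clm_apply.2 fun b => ?_
  simp only [toBilin_apply]
  exact (ContinuousAlternatingMap.apply ℝ V ℝ ![a, b]).contDiff.comp_contDiffOn hf

/-- A closed 2-form on `B × B`, `B` convex, for which both factors are isotropic has a potential. -/
theorem exists_potential_of_extDeriv_eq_zero {B : Set X} (hBo : IsOpen B) (hB : Convex ℝ B)
    {η : X × X → (X × X) [⋀^Fin 2]→L[ℝ] ℝ}
    (hη : ∀ v w, ContDiffOn ℝ ∞ (fun p => η p ![v, w]) (B ×ˢ B))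
    (hηd : ∀ p ∈ B ×ˢ B, DifferentiableAt ℝ η p)
    (hcl : ∀ p ∈ B ×ˢ B, extDeriv η p = 0)
    (h₁ : ∀ p ∈ B ×ˢ B, ∀ a a', η p ![(a, 0), (a', 0)] = 0)
    (h₂ : ∀ p ∈ B ×ˢ B, ∀ b b', η p ![(0, b), (0, b')] = 0) :
    ∃ Φ : X × X → ℝ, ContDiffOn ℝ ∞ Φ (B ×ˢ B) ∧ ∀ p ∈ B ×ˢ B, ∀ a a' b b',
      η p ![(a, b), (a', b')] = fderiv ℝ (fderiv ℝ Φ) p (a, 0) (0, b') -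
        fderiv ℝ (fderiv ℝ Φ) p (a', 0) (0, b) := by
  have hBB : IsOpen (B ×ˢ B) := hBo.prod hBo
  -- The off-diagonal block of `η`; the two diagonal blocks vanish by hypothesis.
  let K : X × X → X →L[ℝ] X →L[ℝ] ℝ := fun p =>
    ((toBilin (η p)).comp (.inl ℝ X X)).flip.comp (.inr ℝ X X) |>.flip
  have hK_apply : ∀ p a b, K p a b = η p ![(a, 0), (0, b)] := fun p a b => by
    rw [← toBilin_apply]; rfl
  have hK : ContDiffOn ℝ ∞ K (B ×ˢ B) := by
    refine contDiffOn_clm_apply.2 fun a => contDiffOn_clm_apply.2 fun b => ?_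
    simp only [hK_apply]
    exact hη _ _
  have happ : ∀ p ∈ B ×ˢ B, ∀ (v : X × X) (w : Fin 2 → X × X),
      fderiv ℝ (fun q => η q w) p v = fderiv ℝ η p v w := by
    intro p hp v w
    have := ((ContinuousAlternatingMap.apply ℝ (X × X) ℝ w).hasFDerivAt.comp p
      (hηd p hp).hasFDerivAt).fderiv
    exact congrArg (fun L => L v) this
  have hKd : ∀ p ∈ B ×ˢ B, ∀ v a b, fderiv ℝ K p v a b = fderiv ℝ η p v ![(a, 0), (0, b)] := by
    intro p hp v a b
    have h1 := ((hK.differentiableOn (by simp)).differentiableAt (hBB.mem_nhds hp)).hasFDerivAt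
    have h2 := ((h1.clm_apply (hasFDerivAt_const a p)).clm_apply (hasFDerivAt_const b p)).fderiv
    rw [← happ p hp]
    simp only [← hK_apply]
    rw [h2]
    simp
  have hzero : ∀ w : Fin 2 → X × X, (∀ p ∈ B ×ˢ B, η p w = 0) →
      ∀ p ∈ B ×ˢ B, ∀ v, fderiv ℝ η p v w = 0 := by
    intro w hw p hp v
    rw [← happ p hp, Filter.EventuallyEq.fderiv_eq (f₁ := fun q => η q w) (f := fun _ => 0)
      (by filter_upwards [hBB.mem_nhds hp] with q hq using hw q hq)]
    simp
  have hcyc : ∀ p ∈ B ×ˢ B, ∀ u v w, fderiv ℝ η p u ![v, w] - fderiv ℝ η p v ![u, w] +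
      fderiv ℝ η p w ![u, v] = 0 := by
    intro p hp u v w
    have h0 := congrArg (fun f => f ![u, v, w]) (hcl p hp)
    simp only [extDeriv_apply (hηd p hp), happ p hp] at h0
    have h1 := (Fin.sum_univ_three _).symm.trans h0
    have r0 : Fin.removeNth 0 ![u, v, w] = ![v, w] := by
      funext i; fin_cases i <;> rfl
    have r1 : Fin.removeNth 1 ![u, v, w] = ![u, w] := by
      funext i; fin_cases i <;> rfl
    have r2 : Fin.removeNth 2 ![u, v, w] = ![u, v] := by
      funext i; fin_cases i <;> rfl
    rw [r0, r1, r2] at h1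
    simpa [sub_eq_add_neg] using h1
  -- Of the three terms of `dη` on `(a, 0)`, `(a', 0)`, `(0, b)`, the one differentiating the
  -- isotropic block drops out; the other two express closedness of `K` in `x`. The next step is the
  -- same in `y`.
  have hx : ∀ p ∈ B ×ˢ B, ∀ a a' b, fderiv ℝ K p (a, 0) a' b = fderiv ℝ K p (a', 0) a b := by
    intro p hp a a' b
    rw [hKd p hp, hKd p hp]
    have := hcyc p hp (a, 0) (a', 0) (0, b)
    have := hzero ![(a, 0), (a', 0)] (fun p hp => h₁ p hp a a') p hp (0, b)
    linarith
  have hy : ∀ p ∈ B ×ˢ B, ∀ a b b', fderiv ℝ K p (0, b) a b' = fderiv ℝ K p (0, b') a b := by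
    intro p hp a b b'
    rw [hKd p hp, hKd p hp]
    have h3 := hcyc p hp (a, 0) (0, b) (0, b')
    have := hzero ![(0, b), (0, b')] (fun p hp => h₂ p hp b b') p hp (a, 0)
    linarith
  obtain ⟨Φ, hΦ, hΦK⟩ := exists_mixed_potential hBo hB hBo hB hK hx hy
  refine ⟨Φ, hΦ, fun p hp a a' b b' => ?_⟩
  rw [hΦK p hp, hΦK p hp, hK_apply, hK_apply]
  have e1 : ((a, b) : X × X) = (a, 0) + (0, b) := by simp
  have e2 : ((a', b') : X × X) = (a', 0) + (0, b') := by simp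
  have e4 := h₁ p hp a a'
  have e5 := h₂ p hp b b'
  have e3 := toBilin_swap (η p) (0, b) (a', 0)
  rw [← toBilin_apply] at e4 e5
  simp only [← toBilin_apply]
  rw [e1, e2]
  simp only [map_add, add_apply]
  linarith

end Poincare

/-! ### Implicit functions, integration along curves, and derivatives of the Calabi function in a
vector space. -/

section Calculus

/-- The implicit function theorem, with smoothness on a neighborhood. -/
theorem exists_implicitFunction {P N Z : Type} [NormedAddCommGroup P] [NormedSpace ℝ P]
    [CompleteSpace P] [NormedAddCommGroup N] [NormedSpace ℝ N] [CompleteSpace N]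
    [NormedAddCommGroup Z] [NormedSpace ℝ Z] [CompleteSpace Z] {G : P × N → Z} {O : Set (P × N)}
    (hO : IsOpen O) (hG : ContDiffOn ℝ ∞ G O) {p₀ : P} {n₀ : N} (h₀ : (p₀, n₀) ∈ O)
    (hG₀ : G (p₀, n₀) = 0) (hinv : ((fderiv ℝ G (p₀, n₀)).comp (.inr ℝ P N)).IsInvertible) :
    ∃ (Q : Set P) (R : Set N) (h : P → N), IsOpen Q ∧ p₀ ∈ Q ∧ IsOpen R ∧ n₀ ∈ R ∧
      ContDiffOn ℝ ∞ h Q ∧ Q ×ˢ R ⊆ O ∧ MapsTo h Q R ∧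
      ∀ p ∈ Q, ∀ n ∈ R, G (p, n) = 0 ↔ n = h p := by
  have hat : ∀ v ∈ O, ContDiffAt ℝ ∞ G v := fun v hv => hG.contDiffAt (hO.mem_nhds hv)
  have hne : (∞ : ℕ∞ω) ≠ 0 := by simp
  let ψ := (hat _ h₀).implicitFunction hne hinv
  have hψ₀ : ψ p₀ = n₀ := (hat _ h₀).implicitFunction_apply_self hne hinv
  have hψs : ContDiffAt ℝ ∞ ψ p₀ := (hat _ h₀).contDiffAt_implicitFunction hne hinv
  have hψG : ∀ᶠ p in 𝓝 p₀, G (p, ψ p) = 0 := by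
    simpa [hG₀] using (hat _ h₀).eventually_apply_implicitFunction hne hinv
  have hψi : ∀ᶠ v in 𝓝 (p₀, n₀), G v = 0 ↔ ψ v.1 = v.2 := by
    simpa [hG₀] using (hat _ h₀).eventually_apply_eq_iff_implicitFunction hne hinv
  have hψc : ∀ᶠ p in 𝓝 p₀, ContinuousAt ψ p := by
    filter_upwards [(hψs.of_le (m := 1) (by simp)).eventually (by simp)] with p hp
    exact hp.continuousAt
  have hopen : IsOpen {L : N →L[ℝ] Z | L.IsInvertible} := ContinuousLinearEquiv.isOpen
  have hinv' : ∀ᶠ v in 𝓝 (p₀, n₀), ((fderiv ℝ G v).comp (.inr ℝ P N)).IsInvertible := by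
    have hc : ContinuousAt (fun v => (fderiv ℝ G v).comp (.inr ℝ P N)) (p₀, n₀) :=
      (((hG.continuousOn_fderiv_of_isOpen hO (by simp)).clm_comp
        continuousOn_const).continuousAt (hO.mem_nhds h₀))
    exact hc.eventually (hopen.mem_nhds hinv)
  have hmap : Filter.Tendsto (fun p => (p, ψ p)) (𝓝 p₀) (𝓝 (p₀, n₀)) := by
    have : ContinuousAt (fun p => (p, ψ p)) p₀ := continuousAt_id.prodMk hψs.continuousAt
    simpa [ContinuousAt, hψ₀] using this
  -- At a nearby `p` the partial derivative is still invertible, so the implicit function based at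
  -- `(p, ψ p)` is smooth at `p`. By local uniqueness and continuity of `ψ` it coincides with `ψ`
  -- near `p`.
  have hsm : ∀ᶠ p in 𝓝 p₀, ContDiffAt ℝ ∞ ψ p := by
    filter_upwards [hψG.eventually_nhds, hψc, hmap.eventually hinv',
      hmap.eventually (hO.mem_nhds h₀)] with p hp hpc hpi hpO
    have e := (hat _ hpO).contDiffAt_implicitFunction hne hpi
    refine e.congr_of_eventuallyEq ?_
    have e1 := (hat _ hpO).eventually_apply_eq_iff_implicitFunction hne hpi
    have e2 : ContinuousAt (fun p => (p, ψ p)) p := continuousAt_id.prodMk hpc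
    filter_upwards [hp, e2.eventually e1] with p' h1 h2
    exact (h2.1 (h1.trans hp.self_of_nhds.symm)).symm
  obtain ⟨U, R, hU, hU₀, hR, hR₀, hUR⟩ := mem_nhds_prod_iff'.1
    (Filter.inter_mem hψi (hO.mem_nhds h₀))
  have hR' : ∀ᶠ p in 𝓝 p₀, ψ p ∈ R := by
    have := hψs.continuousAt.eventually (f := ψ) (p := fun n => n ∈ R)
      (by rw [hψ₀]; exact hR.mem_nhds hR₀)
    exact this
  obtain ⟨Q, hQ, hQo, hQ₀⟩ := eventually_nhds_iff.1
    (hsm.and (hR'.and (hU.mem_nhds hU₀)))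
  refine ⟨Q, R, ψ, hQo, hQ₀, hR, hR₀, fun p hp => (hQ p hp).1.contDiffWithinAt,
    fun v hv => (hUR ⟨(hQ _ hv.1).2.2, hv.2⟩).2, fun p hp => (hQ p hp).2.1, fun p hp n hn => ?_⟩
  have := (hUR (show (p, n) ∈ U ×ˢ R from ⟨(hQ p hp).2.2, hn⟩)).1
  exact (this : G (p, n) = 0 ↔ ψ p = n).trans eq_comm

theorem eq_of_hasDerivAt_zero_Icc {f : ℝ → ℝ} (hf : ∀ t ∈ Icc (0 : ℝ) 1, HasDerivAt f 0 t) :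
    f 1 = f 0 :=
  constant_of_has_deriv_right_zero (fun t ht => (hf t ht).continuousAt.continuousWithinAt)
    (fun t ht => (hf t (Ico_subset_Icc_self ht)).hasDerivWithinAt) 1 (by simp)

variable {X : Type} [NormedAddCommGroup X] [NormedSpace ℝ X]

theorem fderiv_fderiv_symm {E : Type} [NormedAddCommGroup E] [NormedSpace ℝ E] {F : E → ℝ}
    {O : Set E} (hO : IsOpen O) (hF : ContDiffOn ℝ ∞ F O) {p : E} (hp : p ∈ O) (v w : E) :
    fderiv ℝ (fderiv ℝ F) p v w = fderiv ℝ (fderiv ℝ F) p w v :=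
  (hF.contDiffAt (hO.mem_nhds hp)).isSymmSndFDerivAt (by
    rw [minSmoothness_of_isRCLikeNormedField]; exact WithTop.coe_le_coe.2 le_top) v w

theorem hasFDerivAt_fderiv {E : Type} [NormedAddCommGroup E] [NormedSpace ℝ E] {F : E → ℝ}
    {O : Set E} (hO : IsOpen O) (hF : ContDiffOn ℝ ∞ F O) {p : E} (hp : p ∈ O) :
    HasFDerivAt (fderiv ℝ F) (fderiv ℝ (fderiv ℝ F) p) p :=
  (((hF.fderiv_of_isOpen (m := ∞) hO (by simp)).differentiableOn (by simp)).differentiableAt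
    (hO.mem_nhds hp)).hasFDerivAt

theorem hasFDerivAt_of_contDiffOn {E F : Type} [NormedAddCommGroup E] [NormedSpace ℝ E]
    [NormedAddCommGroup F] [NormedSpace ℝ F] {f : E → F}
    {O : Set E} (hO : IsOpen O) (hf : ContDiffOn ℝ ∞ f O) {p : E} (hp : p ∈ O) :
    HasFDerivAt f (fderiv ℝ f p) p :=
  ((hf.differentiableOn (by simp)).differentiableAt (hO.mem_nhds hp)).hasFDerivAt

variable {Φ : X × X → ℝ} {O : Set (X × X)}

/-- The derivative in `t` of `∂_yΦ(s t, y) w` is the mixed derivative on `s'` and `w`. Curves rather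
than segments are needed, since the lemma is later applied to projections of paths in level sets of
a Lagrangian field. -/
theorem fderiv_snd_eq_of_mixed_eq_zero (hO : IsOpen O) (hΦ : ContDiffOn ℝ ∞ Φ O)
    {s s' : ℝ → X} (hs : ∀ t ∈ Icc (0 : ℝ) 1, HasDerivAt s (s' t) t) {y w : X}
    (hsO : ∀ t ∈ Icc (0 : ℝ) 1, (s t, y) ∈ O)
    (h : ∀ t ∈ Icc (0 : ℝ) 1, fderiv ℝ (fderiv ℝ Φ) (s t, y) (s' t, 0) (0, w) = 0) :
    fderiv ℝ Φ (s 1, y) (0, w) = fderiv ℝ Φ (s 0, y) (0, w) := by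
  refine eq_of_hasDerivAt_zero_Icc (f := fun t => fderiv ℝ Φ (s t, y) (0, w)) fun t ht => ?_
  have h1 : HasDerivAt (fun t => (s t, y)) (s' t, 0) t := (hs t ht).prodMk (hasDerivAt_const t y)
  have h2 := (hasFDerivAt_fderiv hO hΦ (hsO t ht)).comp_hasDerivAt t h1
  have h3 := h2.clm_apply (hasDerivAt_const t ((0, w) : X × X))
  simpa [h t ht] using h3

theorem fderiv_fst_eq_of_mixed_eq_zero (hO : IsOpen O) (hΦ : ContDiffOn ℝ ∞ Φ O)
    {r r' : ℝ → X} (hr : ∀ t ∈ Icc (0 : ℝ) 1, HasDerivAt r (r' t) t) {x w : X}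
    (hrO : ∀ t ∈ Icc (0 : ℝ) 1, (x, r t) ∈ O)
    (h : ∀ t ∈ Icc (0 : ℝ) 1, fderiv ℝ (fderiv ℝ Φ) (x, r t) (w, 0) (0, r' t) = 0) :
    fderiv ℝ Φ (x, r 1) (w, 0) = fderiv ℝ Φ (x, r 0) (w, 0) := by
  refine eq_of_hasDerivAt_zero_Icc (f := fun t => fderiv ℝ Φ (x, r t) (w, 0)) fun t ht => ?_
  have h1 : HasDerivAt (fun t => (x, r t)) (0, r' t) t := (hasDerivAt_const t x).prodMk (hr t ht)
  have h2 := (hasFDerivAt_fderiv hO hΦ (hrO t ht)).comp_hasDerivAt t h1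
  have h3 := h2.clm_apply (hasDerivAt_const t ((w, 0) : X × X))
  rw [fderiv_fderiv_symm hO hΦ (hrO t ht), h t ht] at h3
  simpa using h3

/-- The `τ`-derivative of `Φ(s 1, r τ) - Φ(s 0, r τ)` vanishes by `fderiv_snd_eq_of_mixed_eq_zero`
with `w = r' τ`. -/
theorem rectangle_eq_zero_of_mixed_eq_zero (hO : IsOpen O) (hΦ : ContDiffOn ℝ ∞ Φ O)
    {s s' r r' : ℝ → X} (hs : ∀ t ∈ Icc (0 : ℝ) 1, HasDerivAt s (s' t) t)
    (hr : ∀ t ∈ Icc (0 : ℝ) 1, HasDerivAt r (r' t) t)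
    (hO' : ∀ t ∈ Icc (0 : ℝ) 1, ∀ τ ∈ Icc (0 : ℝ) 1, (s t, r τ) ∈ O)
    (h : ∀ t ∈ Icc (0 : ℝ) 1, ∀ τ ∈ Icc (0 : ℝ) 1,
      fderiv ℝ (fderiv ℝ Φ) (s t, r τ) (s' t, 0) (0, r' τ) = 0) :
    Φ (s 1, r 1) - Φ (s 0, r 1) = Φ (s 1, r 0) - Φ (s 0, r 0) := by
  refine eq_of_hasDerivAt_zero_Icc (f := fun τ => Φ (s 1, r τ) - Φ (s 0, r τ)) fun τ hτ => ?_
  have h1 : ∀ x, (x, r τ) ∈ O → HasDerivAt (fun τ => Φ (x, r τ)) (fderiv ℝ Φ (x, r τ) (0, r' τ)) τ :=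
    fun x hx => (hasFDerivAt_of_contDiffOn hO hΦ hx).comp_hasDerivAt τ
      ((hasDerivAt_const τ x).prodMk (hr τ hτ))
  have h2 := (h1 (s 1) (hO' 1 (by simp) τ hτ)).sub (h1 (s 0) (hO' 0 (by simp) τ hτ))
  rwa [fderiv_snd_eq_of_mixed_eq_zero hO hΦ hs (fun t ht => hO' t ht τ hτ)
    (fun t ht => h t ht τ hτ), sub_self] at h2

/-- A function with vanishing mixed second derivative on a product of convex sets. -/
theorem rectangle_eq_zero_of_convex {B : Set X} (hBo : IsOpen B) (hB : Convex ℝ B)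
    (hΦ : ContDiffOn ℝ ∞ Φ (B ×ˢ B))
    (h : ∀ p ∈ B ×ˢ B, ∀ a b, fderiv ℝ (fderiv ℝ Φ) p (a, 0) (0, b) = 0)
    {x x' y y' : X} (hx : x ∈ B) (hx' : x' ∈ B) (hy : y ∈ B) (hy' : y' ∈ B) :
    Φ (x', y') - Φ (x, y') = Φ (x', y) - Φ (x, y) := by
  have hd : ∀ a b : X, ∀ t ∈ Icc (0 : ℝ) 1, HasDerivAt (AffineMap.lineMap a b) (b - a) t :=
    fun a b t _ => AffineMap.hasDerivAt_lineMap
  have hm : ∀ t ∈ Icc (0 : ℝ) 1, ∀ τ ∈ Icc (0 : ℝ) 1,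
      (AffineMap.lineMap x x' t, AffineMap.lineMap y y' τ) ∈ B ×ˢ B := fun t ht τ hτ =>
    ⟨hB.lineMap_mem hx hx' ht, hB.lineMap_mem hy hy' hτ⟩
  simpa using rectangle_eq_zero_of_mixed_eq_zero (hBo.prod hBo) hΦ (hd x x') (hd y y') hm
    fun t ht τ hτ => h _ (hm t ht τ hτ) _ _

/-- As `g` has the constant derivative `L`, the chain rule has no term with a second derivative of
`g`; the two flips serve to insert `L` in both slots. -/
theorem fderiv_fderiv_comp_affine {E E' : Type} [NormedAddCommGroup E] [NormedSpace ℝ E]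
    [NormedAddCommGroup E'] [NormedSpace ℝ E'] {F : E → ℝ} {O : Set E} (hO : IsOpen O)
    (hF : ContDiffOn ℝ ∞ F O) {g : E' → E} {L : E' →L[ℝ] E} (hg : ∀ u, HasFDerivAt g L u)
    {u : E'} (hu : g u ∈ O) :
    HasFDerivAt (fderiv ℝ (F ∘ g)) ((((fderiv ℝ (fderiv ℝ F) (g u)).comp L).flip.comp L).flip) u := by
  have hev : fderiv ℝ (F ∘ g) =ᶠ[𝓝 u] fun u => (fderiv ℝ F (g u)).comp L := by
    filter_upwards [(hg u).continuousAt.eventually (hO.mem_nhds hu)] with u' hu'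
    exact ((hasFDerivAt_of_contDiffOn hO hF hu').comp u' (hg u')).fderiv
  refine HasFDerivAt.congr_of_eventuallyEq ?_ hev
  refine (((hasFDerivAt_fderiv hO hF hu).comp u (hg u)).clm_comp
    (hasFDerivAt_const L u)).congr_fderiv ?_
  ext v w
  simp

/-- The function `T` of a potential `Φ`. -/
def calabi {M : Type*} (Φ : M × M → ℝ) (q : M × M × M) : ℝ :=
  Φ (q.1, q.2.1) - Φ (q.2.1, q.2.1) + Φ (q.2.1, q.2.2) - Φ (q.1, q.2.2)

theorem hasFDerivAt_calabi (hO : IsOpen O) (hΦ : ContDiffOn ℝ ∞ Φ O) {x u y : X}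
    (hxu : (x, u) ∈ O) (huu : (u, u) ∈ O) (huy : (u, y) ∈ O) :
    HasFDerivAt (fun u => calabi Φ (x, u, y)) ((fderiv ℝ Φ (x, u)).comp (.inr ℝ X X) -
      (fderiv ℝ Φ (u, u)).comp ((ContinuousLinearMap.id ℝ X).prod (.id ℝ X)) +
      (fderiv ℝ Φ (u, y)).comp (.inl ℝ X X)) u := by
  have h1 := (hasFDerivAt_of_contDiffOn hO hΦ hxu).comp u (hasFDerivAt_prodMk_right x u)
  have h2 := (hasFDerivAt_of_contDiffOn hO hΦ huu).comp (f := fun u => (u, u)) u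
    ((hasFDerivAt_id u).prodMk (hasFDerivAt_id u))
  have h3 := (hasFDerivAt_of_contDiffOn hO hΦ huy).comp (f := fun u => (u, y)) u (hasFDerivAt_prodMk_left u y)
  exact ((h1.sub h2).add h3).sub_const (Φ (x, y))

/-- The three summands that depend on `u` are compositions of `Φ` with affine maps of `u`. -/
theorem fderiv_fderiv_calabi (hO : IsOpen O) (hΦ : ContDiffOn ℝ ∞ Φ O) {x u y : X}
    (hxu : (x, u) ∈ O) (huu : (u, u) ∈ O) (huy : (u, y) ∈ O)
    (v w : X) :
    fderiv ℝ (fderiv ℝ (fun u => calabi Φ (x, u, y))) u v w =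
      fderiv ℝ (fderiv ℝ Φ) (x, u) (0, v) (0, w) - fderiv ℝ (fderiv ℝ Φ) (u, u) (v, v) (w, w) +
        fderiv ℝ (fderiv ℝ Φ) (u, y) (v, 0) (w, 0) := by
  have c1 : Continuous fun u : X => (x, u) := by fun_prop
  have c2 : Continuous fun u : X => (u, u) := by fun_prop
  have c3 : Continuous fun u : X => (u, y) := by fun_prop
  have d1 : ∀ u, HasFDerivAt (fun u : X => (x, u)) (ContinuousLinearMap.inr ℝ X X) u :=
    fun u => hasFDerivAt_prodMk_right x u
  have d2 : ∀ u, HasFDerivAt (fun u : X => (u, u))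
      ((ContinuousLinearMap.id ℝ X).prod (.id ℝ X)) u :=
    fun u => (hasFDerivAt_id u).prodMk (hasFDerivAt_id u)
  have d3 : ∀ u, HasFDerivAt (fun u : X => (u, y)) (ContinuousLinearMap.inl ℝ X X) u :=
    fun u => hasFDerivAt_prodMk_left u y
  have h := ((fderiv_fderiv_comp_affine hO hΦ d1 hxu).sub
    (fderiv_fderiv_comp_affine hO hΦ d2 huu)).add (fderiv_fderiv_comp_affine hO hΦ d3 huy)
  have hev : fderiv ℝ (fun u => calabi Φ (x, u, y)) =ᶠ[𝓝 u]
      fderiv ℝ (Φ ∘ fun u => (x, u)) - fderiv ℝ (Φ ∘ fun u => (u, u)) +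
        fderiv ℝ (Φ ∘ fun u => (u, y)) := by
    filter_upwards [c1.continuousAt.eventually (hO.mem_nhds hxu),
      c2.continuousAt.eventually (hO.mem_nhds huu),
      c3.continuousAt.eventually (hO.mem_nhds huy)] with u' h1 h2 h3
    rw [(hasFDerivAt_calabi hO hΦ h1 h2 h3).fderiv, Pi.add_apply, Pi.sub_apply,
      ((hasFDerivAt_of_contDiffOn hO hΦ h1).comp u' (d1 u')).fderiv,
      ((hasFDerivAt_of_contDiffOn hO hΦ h2).comp (f := fun u => (u, u)) u'
        (d2 u')).fderiv,
      ((hasFDerivAt_of_contDiffOn hO hΦ h3).comp u' (d3 u')).fderiv]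
  rw [(h.congr_of_eventuallyEq hev).fderiv]
  simp

set_option synthInstance.maxHeartbeats 200000 in
/-- The second derivative at a critical point transforms as a bilinear form. -/
theorem fderiv_fderiv_comp_of_critical {f : X → ℝ} {τ : X → X} {U : Set X} (hU : IsOpen U)
    (hf : ContDiffOn ℝ ∞ f U) {W : Set X} (hW : IsOpen W) (hτ : ContDiffOn ℝ ∞ τ W) {e : X}
    (he : e ∈ W) (heU : τ e ∈ U) (hcrit : fderiv ℝ f (τ e) = 0) (v w : X) :
    fderiv ℝ (fderiv ℝ (f ∘ τ)) e v w =
      fderiv ℝ (fderiv ℝ f) (τ e) (fderiv ℝ τ e v) (fderiv ℝ τ e w) := by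
  have hev : fderiv ℝ (f ∘ τ) =ᶠ[𝓝 e] fun u => (fderiv ℝ f (τ u)).comp (fderiv ℝ τ u) := by
    filter_upwards [hW.mem_nhds he, (hτ.continuousOn.continuousAt (hW.mem_nhds he)).eventually
      (hU.mem_nhds heU)] with u hu hu'
    exact ((hasFDerivAt_of_contDiffOn hU hf hu').comp u
      (hasFDerivAt_of_contDiffOn hW hτ hu)).fderiv
  have hτ' : HasFDerivAt (fderiv ℝ τ) (fderiv ℝ (fderiv ℝ τ) e) e :=
    (((hτ.fderiv_of_isOpen (m := ∞) hW (by simp)).differentiableOn (by simp)).differentiableAt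
      (hW.mem_nhds he)).hasFDerivAt
  have h := ((hasFDerivAt_fderiv hU hf heU).comp e
    (hasFDerivAt_of_contDiffOn hW hτ he)).clm_comp hτ'
  rw [hev.fderiv_eq]
  erw [h.fderiv]
  -- The term containing the second derivative of `τ` is multiplied by the first derivative of `f`,
  -- which is zero here.
  simp [hcrit]

end Calculus

/-! ### Gluing of local functions along a closed set. -/

section Gluing

/-- Functions defined around the points of a closed set, which agree near this set, can be glued
to a function defined around it. -/
theorem exists_glue {X Y : Type*} [TopologicalSpace X] [T2Space X] [ParacompactSpace X] [Nonempty Y]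
    {ι : Type*} {A : Set X} (hA : IsClosed A) {O : ι → Set X} (hO : ∀ i, IsOpen (O i))
    (hAO : A ⊆ ⋃ i, O i) {f : ι → X → Y}
    (hf : ∀ i j, ∀ c ∈ A, c ∈ O i → c ∈ O j → f i =ᶠ[𝓝 c] f j) :
    ∃ (g : X → Y) (W : Set X), IsOpen W ∧ A ⊆ W ∧ ∀ x ∈ W, ∃ i, x ∈ O i ∧ g =ᶠ[𝓝 x] f i := by
  classical
  obtain ⟨u, huo, hAu, hfin, huO⟩ := precise_refinement_set hA O hO hAO
  obtain ⟨v, hAv, hvo, hvu⟩ := exists_subset_iUnion_closure_subset hA huo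
    (fun x _ => hfin.point_finite x) hAu
  let C : ι → Set X := fun i => closure (v i)
  have hC : LocallyFinite C := hfin.subset hvu
  -- The points where all functions whose closed piece `C i` contains the point have the same germ.
  -- Local finiteness makes `W₀` a neighborhood of `A`: near `c` only the finitely many pieces
  -- through `c` occur.
  let W₀ : Set X := {x | ∀ i j, x ∈ C i → x ∈ C j → f i =ᶠ[𝓝 x] f j}
  have hW₀ : A ⊆ interior W₀ := by
    intro c hc
    rw [mem_interior_iff_mem_nhds]
    have hI := hC.point_finite c
    have h1 : ∀ᶠ x in 𝓝 c, ∀ i ∈ {i | c ∈ C i}, ∀ j ∈ {i | c ∈ C i}, f i =ᶠ[𝓝 x] f j :=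
      (Filter.eventually_all_finite hI).2 fun i hi => (Filter.eventually_all_finite hI).2
        fun j hj => (hf i j c hc (huO i (hvu i hi)) (huO j (hvu j hj))).eventuallyEq_nhds
    filter_upwards [h1, hC.iInter_compl_mem_nhds (fun i => isClosed_closure) c] with x hx hx' i j hi hj
    simp only [mem_iInter] at hx'
    exact hx i (by_contra fun h => hx' i h hi) j (by_contra fun h => hx' j h hj)
  -- On `W₀` the choice of the index does not matter; the arbitrary value is taken only outside all
  -- `v i`.
  refine ⟨fun x => if h : ∃ i, x ∈ v i then f h.choose x else Classical.arbitrary Y,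
    interior W₀ ∩ ⋃ i, v i, isOpen_interior.inter (isOpen_iUnion hvo),
    fun c hc => ⟨hW₀ hc, hAv hc⟩, ?_⟩
  rintro x ⟨hx, hxv⟩
  obtain ⟨i, hi⟩ := mem_iUnion.1 hxv
  refine ⟨i, huO i (hvu i (subset_closure hi)), ?_⟩
  filter_upwards [isOpen_interior.mem_nhds hx, (hvo i).mem_nhds hi] with z hz hzi
  have hex : ∃ i, z ∈ v i := ⟨i, hzi⟩
  rw [dif_pos hex]
  exact (interior_subset hz _ _ (subset_closure hex.choose_spec) (subset_closure hzi)).self_of_nhds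

end Gluing

/-! ### Coordinate expressions of forms, pullbacks and mixed derivatives. -/

section Charts

variable {m : ℕ} {M : Type*} [TopologicalSpace M] [ChartedSpace (Model m) M]

/-- The inverse of the preferred chart at `x₀`, applied to pairs. -/
def pairSymm (x₀ : M) (p : Model m × Model m) : M × M :=
  ((extChartAt (𝓡 (2 * m)) x₀).symm p.1, (extChartAt (𝓡 (2 * m)) x₀).symm p.2)

/-- The coordinate expression of a map `g : M × M → M` in the preferred chart at `x₀`. -/
def chartMap (x₀ : M) (g : M × M → M) (p : Model m × Model m) : Model m :=
  extChartAt (𝓡 (2 * m)) x₀ (g (pairSymm x₀ p))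

/-- The coordinate expression of the pullback of a 2-form. -/
def chartForm (symp : ∀ x : M, TangentSpace (𝓡 (2 * m)) x [⋀^Fin 2]→L[ℝ] ℝ) (x₀ : M)
    (g : M × M → M) (p : Model m × Model m) : (Model m × Model m) [⋀^Fin 2]→L[ℝ] ℝ :=
  (inChart symp x₀ (chartMap x₀ g p)).compContinuousLinearMap (fderiv ℝ (chartMap x₀ g) p)

/-- The derivative of the inverse of the preferred chart at `x₀`. -/
def chartDeriv (x₀ : M) (e : Model m) : Model m →L[ℝ] Model m :=
  mfderiv 𝓘(ℝ, Model m) (𝓡 (2 * m)) (extChartAt (𝓡 (2 * m)) x₀).symm e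

theorem isOpen_target (x₀ : M) : IsOpen (extChartAt (𝓡 (2 * m)) x₀).target :=
  isOpen_extChartAt_target x₀

/-- A 2-form as a function with values in a fixed space. -/
def formAt (symp : ∀ x : M, TangentSpace (𝓡 (2 * m)) x [⋀^Fin 2]→L[ℝ] ℝ) (x : M) :
    Model m [⋀^Fin 2]→L[ℝ] ℝ := symp x

theorem inChart_apply (symp : ∀ x : M, TangentSpace (𝓡 (2 * m)) x [⋀^Fin 2]→L[ℝ] ℝ) (x₀ : M)
    (e v w : Model m) : inChart symp x₀ e ![v, w] =
      formAt symp ((extChartAt (𝓡 (2 * m)) x₀).symm e) ![chartDeriv x₀ e v, chartDeriv x₀ e w] := by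
  refine congrArg (formAt symp ((extChartAt (𝓡 (2 * m)) x₀).symm e)) ?_
  funext i
  fin_cases i <;> rfl

theorem chartForm_apply (symp : ∀ x : M, TangentSpace (𝓡 (2 * m)) x [⋀^Fin 2]→L[ℝ] ℝ) (x₀ : M)
    (g : M × M → M) (p v w : Model m × Model m) : chartForm symp x₀ g p ![v, w] =
      inChart symp x₀ (chartMap x₀ g p)
        ![fderiv ℝ (chartMap x₀ g) p v, fderiv ℝ (chartMap x₀ g) p w] := by
  refine congrArg (inChart symp x₀ (chartMap x₀ g p)) ?_
  funext i
  fin_cases i <;> rfl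

theorem pullbackForm_apply (symp : ∀ x : M, TangentSpace (𝓡 (2 * m)) x [⋀^Fin 2]→L[ℝ] ℝ)
    (g : M × M → M) (p : M × M) (v w : Model m × Model m) :
    pullbackForm symp g p ![v, w] = formAt symp (g p)
      ![mfderiv ((𝓡 (2 * m)).prod (𝓡 (2 * m))) (𝓡 (2 * m)) g p v,
        mfderiv ((𝓡 (2 * m)).prod (𝓡 (2 * m))) (𝓡 (2 * m)) g p w] := by
  refine congrArg (formAt symp (g p)) ?_
  funext i
  fin_cases i <;> rfl

variable [IsManifold (𝓡 (2 * m)) ∞ M]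

theorem contMDiffAt_chart_symm (x₀ : M) {e : Model m} (he : e ∈ (extChartAt (𝓡 (2 * m)) x₀).target) :
    ContMDiffAt 𝓘(ℝ, Model m) (𝓡 (2 * m)) ∞ (extChartAt (𝓡 (2 * m)) x₀).symm e :=
  (contMDiffOn_extChartAt_symm x₀).contMDiffAt ((isOpen_target x₀).mem_nhds he)

theorem contMDiffAt_chart (x₀ : M) {x : M} (hx : x ∈ (extChartAt (𝓡 (2 * m)) x₀).source) :
    ContMDiffAt (𝓡 (2 * m)) 𝓘(ℝ, Model m) ∞ (extChartAt (𝓡 (2 * m)) x₀) x :=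
  contMDiffAt_extChartAt' (by simpa using hx)

theorem hasMFDerivAt_chart_symm (x₀ : M) {e : Model m}
    (he : e ∈ (extChartAt (𝓡 (2 * m)) x₀).target) :
    HasMFDerivAt 𝓘(ℝ, Model m) (𝓡 (2 * m)) (extChartAt (𝓡 (2 * m)) x₀).symm e
      (chartDeriv x₀ e) :=
  ((contMDiffAt_chart_symm x₀ he).mdifferentiableAt (by simp)).hasMFDerivAt

theorem contMDiffAt_pairSymm (x₀ : M) {p : Model m × Model m}
    (h₁ : p.1 ∈ (extChartAt (𝓡 (2 * m)) x₀).target)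
    (h₂ : p.2 ∈ (extChartAt (𝓡 (2 * m)) x₀).target) :
    ContMDiffAt 𝓘(ℝ, Model m × Model m) ((𝓡 (2 * m)).prod (𝓡 (2 * m))) ∞ (pairSymm x₀) p :=
  ((contMDiffAt_chart_symm x₀ h₁).comp p contDiff_fst.contMDiff.contMDiffAt).prodMk
    ((contMDiffAt_chart_symm x₀ h₂).comp p contDiff_snd.contMDiff.contMDiffAt)

theorem hasMFDerivAt_pairSymm (x₀ : M) {p : Model m × Model m}
    (h₁ : p.1 ∈ (extChartAt (𝓡 (2 * m)) x₀).target)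
    (h₂ : p.2 ∈ (extChartAt (𝓡 (2 * m)) x₀).target) :
    HasMFDerivAt 𝓘(ℝ, Model m × Model m) ((𝓡 (2 * m)).prod (𝓡 (2 * m))) (pairSymm x₀) p
      (((chartDeriv x₀ p.1).comp (.fst ℝ (Model m) (Model m))).prod
        ((chartDeriv x₀ p.2).comp (.snd ℝ (Model m) (Model m)))) :=
  ((hasMFDerivAt_chart_symm x₀ h₁).comp p hasFDerivAt_fst.hasMFDerivAt).prodMk
    ((hasMFDerivAt_chart_symm x₀ h₂).comp p hasFDerivAt_snd.hasMFDerivAt)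

theorem chart_comp_chartDeriv (x₀ : M) {e : Model m}
    (he : e ∈ (extChartAt (𝓡 (2 * m)) x₀).target) (v : Model m) :
    mfderiv (𝓡 (2 * m)) 𝓘(ℝ, Model m) (extChartAt (𝓡 (2 * m)) x₀)
      ((extChartAt (𝓡 (2 * m)) x₀).symm e) (chartDeriv x₀ e v) = v := by
  have h1 := ((contMDiffAt_chart x₀ ((extChartAt (𝓡 (2 * m)) x₀).map_target he)).mdifferentiableAt
    (by simp)).hasMFDerivAt
  have h2 := h1.comp e (hasMFDerivAt_chart_symm x₀ he)
  have h3 : HasMFDerivAt 𝓘(ℝ, Model m) 𝓘(ℝ, Model m)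
      (extChartAt (𝓡 (2 * m)) x₀ ∘ (extChartAt (𝓡 (2 * m)) x₀).symm) e
      (ContinuousLinearMap.id ℝ (Model m)) := by
    refine (hasMFDerivAt_id e).congr_of_eventuallyEq ?_
    filter_upwards [(isOpen_target x₀).mem_nhds he] with e' he'
    exact (extChartAt (𝓡 (2 * m)) x₀).right_inv he'
  exact congrArg (fun L : Model m →L[ℝ] Model m => L v) (hasMFDerivAt_unique h2 h3)

theorem chartDeriv_comp_chart (x₀ : M) {e : Model m}
    (he : e ∈ (extChartAt (𝓡 (2 * m)) x₀).target) (v : Model m) :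
    chartDeriv x₀ e (mfderiv (𝓡 (2 * m)) 𝓘(ℝ, Model m) (extChartAt (𝓡 (2 * m)) x₀)
      ((extChartAt (𝓡 (2 * m)) x₀).symm e) v) = v := by
  let A : Model m →L[ℝ] Model m := mfderiv (𝓡 (2 * m)) 𝓘(ℝ, Model m) (extChartAt (𝓡 (2 * m)) x₀)
      ((extChartAt (𝓡 (2 * m)) x₀).symm e)
  have h : A.toLinearMap * (chartDeriv x₀ e).toLinearMap = 1 := by
    ext1 v
    exact chart_comp_chartDeriv x₀ he v
  -- In finite dimension a one-sided inverse is two-sided.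
  have h' := mul_eq_one_comm.1 h
  exact congrArg (fun L : Model m →ₗ[ℝ] Model m => L v) h'

theorem chartDeriv_surjective (x₀ : M) {e : Model m}
    (he : e ∈ (extChartAt (𝓡 (2 * m)) x₀).target) : Function.Surjective (chartDeriv x₀ e) :=
  fun v => ⟨_, chartDeriv_comp_chart x₀ he v⟩

/-- The tangent space at `x₀` is identified with the model space by the preferred chart at `x₀`
itself; hence no Jacobians appear at the center of a chart. -/
theorem chartDeriv_self (x₀ : M) (v : Model m) :
    chartDeriv x₀ (extChartAt (𝓡 (2 * m)) x₀ x₀) v = v := by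
  have := congrArg (fun L : Model m →L[ℝ] Model m => L v)
    (mfderivWithin_range_extChartAt_symm (I := 𝓡 (2 * m)) (x := x₀))
  rw [ModelWithCorners.range_eq_univ, mfderivWithin_univ] at this
  exact this

/-- The derivative of a function on `M` read in the preferred chart at `x₀`. -/
theorem mfderiv_chartDeriv {F : Type*} [NormedAddCommGroup F] [NormedSpace ℝ F] (x₀ : M) {f : M → F}
    {k : Model m → F} {e : Model m} (he : e ∈ (extChartAt (𝓡 (2 * m)) x₀).target)
    (hf : f =ᶠ[𝓝 ((extChartAt (𝓡 (2 * m)) x₀).symm e)] k ∘ extChartAt (𝓡 (2 * m)) x₀)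
    (hk : DifferentiableAt ℝ k e) (v : Model m) :
    (mfderiv (𝓡 (2 * m)) 𝓘(ℝ, F) f ((extChartAt (𝓡 (2 * m)) x₀).symm e) (chartDeriv x₀ e v) : F) =
      fderiv ℝ k e v := by
  have h1 := ((contMDiffAt_chart x₀ ((extChartAt (𝓡 (2 * m)) x₀).map_target he)).mdifferentiableAt
    (by simp)).hasMFDerivAt
  have hk' : HasMFDerivAt 𝓘(ℝ, Model m) 𝓘(ℝ, F) k
      (extChartAt (𝓡 (2 * m)) x₀ ((extChartAt (𝓡 (2 * m)) x₀).symm e)) (fderiv ℝ k e) := by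
    rw [(extChartAt (𝓡 (2 * m)) x₀).right_inv he]
    exact hk.hasFDerivAt.hasMFDerivAt
  have h2 := (hk'.comp _ h1).congr_of_eventuallyEq hf
  rw [h2.mfderiv]
  exact congrArg (fderiv ℝ k e) (chart_comp_chartDeriv x₀ he v)

theorem eventually_chart_mem (x₀ : M) {B : Set (Model m)} (hB : IsOpen B) {e : Model m}
    (he : e ∈ B) (heT : e ∈ (extChartAt (𝓡 (2 * m)) x₀).target) :
    ∀ᶠ x in 𝓝 ((extChartAt (𝓡 (2 * m)) x₀).symm e),
      x ∈ (extChartAt (𝓡 (2 * m)) x₀).source ∧ extChartAt (𝓡 (2 * m)) x₀ x ∈ B := by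
  have hs := (extChartAt (𝓡 (2 * m)) x₀).map_target heT
  refine Filter.Eventually.and ((isOpen_extChartAt_source x₀).mem_nhds hs) ?_
  refine (contMDiffAt_chart x₀ hs).continuousAt.eventually (hB.mem_nhds ?_)
  rwa [(extChartAt (𝓡 (2 * m)) x₀).right_inv heT]

/-- The mixed second derivative read in the preferred chart at `x₀`. -/
theorem mixedDeriv_pairSymm (x₀ : M) {B : Set (Model m)} (hB : IsOpen B)
    (hBT : B ⊆ (extChartAt (𝓡 (2 * m)) x₀).target) {Φ : M × M → ℝ}
    (hΦ : ContDiffOn ℝ ∞ (Φ ∘ pairSymm x₀) (B ×ˢ B)) {p : Model m × Model m} (hp : p ∈ B ×ˢ B)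
    (a b : Model m) :
    mixedDeriv Φ (pairSymm x₀ p) (chartDeriv x₀ p.1 a) (chartDeriv x₀ p.2 b) =
      fderiv ℝ (fderiv ℝ (Φ ∘ pairSymm x₀)) p (a, 0) (0, b) := by
  obtain ⟨e, e'⟩ := p
  have hBB : IsOpen (B ×ˢ B) := hB.prod hB
  let φ := extChartAt (𝓡 (2 * m)) x₀
  have hinner : ∀ x, x ∈ φ.source ∧ φ x ∈ B →
      (mfderiv (𝓡 (2 * m)) 𝓘(ℝ, ℝ) (fun y : M => Φ (x, y)) (φ.symm e') (chartDeriv x₀ e' b) : ℝ) =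
        fderiv ℝ (Φ ∘ pairSymm x₀) (φ x, e') (0, b) := by
    intro x hx
    have hd := (hasFDerivAt_of_contDiffOn hBB hΦ (p := (φ x, e')) ⟨hx.2, hp.2⟩).comp e'
      (hasFDerivAt_prodMk_right (φ x) e')
    rw [mfderiv_chartDeriv (k := fun e' => (Φ ∘ pairSymm x₀) (φ x, e')) x₀ (hBT hp.2) ?_
      hd.differentiableAt]
    · exact congrArg (fun L : Model m →L[ℝ] ℝ => L b) hd.fderiv
    · filter_upwards [eventually_chart_mem x₀ hB hp.2 (hBT hp.2)] with y hy
      simp only [Function.comp_apply, pairSymm]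
      rw [φ.left_inv hx.1, (extChartAt (𝓡 (2 * m)) x₀).left_inv hy.1]
  have hd := ((hasFDerivAt_fderiv hBB hΦ hp).comp (f := fun e => (e, e')) e
    (hasFDerivAt_prodMk_left e e')).clm_apply (hasFDerivAt_const ((0, b) : Model m × Model m) e)
  refine (mfderiv_chartDeriv (k := fun e => fderiv ℝ (Φ ∘ pairSymm x₀) (e, e') (0, b)) x₀
    (hBT hp.1) ?_ hd.differentiableAt a).trans ?_
  · filter_upwards [eventually_chart_mem x₀ hB hp.1 (hBT hp.1)] with x hx
    exact hinner x hx
  · refine (congrArg (fun L : Model m →L[ℝ] ℝ => L a) hd.fderiv).trans ?_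
    simp

/-- The pullback of a 2-form read in the preferred chart at `x₀`. -/
theorem pullbackForm_pairSymm (symp : ∀ x : M, TangentSpace (𝓡 (2 * m)) x [⋀^Fin 2]→L[ℝ] ℝ)
    (x₀ : M) {g : M × M → M} {p : Model m × Model m}
    (h₁ : p.1 ∈ (extChartAt (𝓡 (2 * m)) x₀).target)
    (h₂ : p.2 ∈ (extChartAt (𝓡 (2 * m)) x₀).target)
    (hg : ContMDiffAt ((𝓡 (2 * m)).prod (𝓡 (2 * m))) (𝓡 (2 * m)) ∞ g (pairSymm x₀ p))
    (hgs : g (pairSymm x₀ p) ∈ (extChartAt (𝓡 (2 * m)) x₀).source) (v w : Model m × Model m) :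
    pullbackForm symp g (pairSymm x₀ p)
      ![((chartDeriv x₀ p.1 v.1, chartDeriv x₀ p.2 v.2) : Model m × Model m),
        (chartDeriv x₀ p.1 w.1, chartDeriv x₀ p.2 w.2)] = chartForm symp x₀ g p ![v, w] := by
  let φ := extChartAt (𝓡 (2 * m)) x₀
  have hgp := (hg.mdifferentiableAt (by simp)).hasMFDerivAt.comp p (hasMFDerivAt_pairSymm x₀ h₁ h₂)
  have hsm : ContMDiffAt 𝓘(ℝ, Model m × Model m) 𝓘(ℝ, Model m) ∞ (chartMap x₀ g) p :=
    (contMDiffAt_chart x₀ hgs).comp p (hg.comp p (contMDiffAt_pairSymm x₀ h₁ h₂))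
  have hT : chartMap x₀ g p ∈ φ.target := φ.map_source hgs
  have hcm := ((contMDiffAt_iff_contDiffAt.1 hsm).differentiableAt (by simp)).hasFDerivAt
  have hc := (hasMFDerivAt_chart_symm x₀ hT).comp p hcm.hasMFDerivAt
  have hcont : ContinuousAt (g ∘ pairSymm x₀) p :=
    (hg.comp p (contMDiffAt_pairSymm x₀ h₁ h₂)).continuousAt
  have hev : g ∘ pairSymm x₀ =ᶠ[𝓝 p] φ.symm ∘ chartMap x₀ g := by
    filter_upwards [hcont.eventually ((isOpen_extChartAt_source x₀).mem_nhds hgs)] with q hq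
    exact (φ.left_inv hq).symm
  -- Two computations of the derivative of `g ∘ pairSymm x₀`: directly, and through the coordinate
  -- expression of `g` followed by the inverse chart.
  have huniq := hasMFDerivAt_unique hgp (hc.congr_of_eventuallyEq hev)
  have key : ∀ v : Model m × Model m,
      (mfderiv ((𝓡 (2 * m)).prod (𝓡 (2 * m))) (𝓡 (2 * m)) g (pairSymm x₀ p)
        ((chartDeriv x₀ p.1 v.1, chartDeriv x₀ p.2 v.2) : Model m × Model m) : Model m) =
      chartDeriv x₀ (chartMap x₀ g p) (fderiv ℝ (chartMap x₀ g) p v) := fun v =>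
    congrArg (fun L : Model m × Model m →L[ℝ] Model m => L v) huniq
  rw [pullbackForm_apply, chartForm_apply, inChart_apply, key, key]
  congr 1
  exact congrArg (formAt symp) (φ.left_inv hgs).symm

end Charts

/-! ### Chart balls; local existence and uniqueness of potentials. -/

section ChartSets

variable {m : ℕ} {M : Type*} [TopologicalSpace M] [ChartedSpace (Model m) M]

/-- The part of `M` which the preferred chart at `x₀` maps to `B`. -/
def chartSet (x₀ : M) (B : Set (Model m)) : Set M :=
  (extChartAt (𝓡 (2 * m)) x₀).source ∩ extChartAt (𝓡 (2 * m)) x₀ ⁻¹' B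

theorem isOpen_chartSet (x₀ : M) {B : Set (Model m)} (hB : IsOpen B) : IsOpen (chartSet x₀ B) :=
  (continuousOn_extChartAt x₀).isOpen_inter_preimage (isOpen_extChartAt_source x₀) hB

theorem chart_symm_mem_chartSet (x₀ : M) {B : Set (Model m)}
    (hBT : B ⊆ (extChartAt (𝓡 (2 * m)) x₀).target) {e : Model m} (he : e ∈ B) :
    (extChartAt (𝓡 (2 * m)) x₀).symm e ∈ chartSet x₀ B :=
  ⟨(extChartAt (𝓡 (2 * m)) x₀).map_target (hBT he), by
    rwa [mem_preimage, (extChartAt (𝓡 (2 * m)) x₀).right_inv (hBT he)]⟩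

theorem pairSymm_mem (x₀ : M) {B : Set (Model m)}
    (hBT : B ⊆ (extChartAt (𝓡 (2 * m)) x₀).target) {p : Model m × Model m} (hp : p ∈ B ×ˢ B) :
    pairSymm x₀ p ∈ chartSet x₀ B ×ˢ chartSet x₀ B :=
  ⟨chart_symm_mem_chartSet x₀ hBT hp.1, chart_symm_mem_chartSet x₀ hBT hp.2⟩

theorem pairSymm_chart (x₀ : M) {B : Set (Model m)} {q : M × M}
    (hq : q ∈ chartSet x₀ B ×ˢ chartSet x₀ B) :
    pairSymm x₀ (extChartAt (𝓡 (2 * m)) x₀ q.1, extChartAt (𝓡 (2 * m)) x₀ q.2) = q :=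
  Prod.ext ((extChartAt (𝓡 (2 * m)) x₀).left_inv hq.1.1)
    ((extChartAt (𝓡 (2 * m)) x₀).left_inv hq.2.1)

theorem contractibleSpace_chartSet (x₀ : M) {B : Set (Model m)} (hB : Convex ℝ B)
    (hne : B.Nonempty) (hBT : B ⊆ (extChartAt (𝓡 (2 * m)) x₀).target) :
    ContractibleSpace (chartSet x₀ B) := by
  have := hB.contractibleSpace hne
  let e : chartSet x₀ B ≃ₜ B :=
    { toFun := fun x => ⟨extChartAt (𝓡 (2 * m)) x₀ x, x.2.2⟩
      invFun := fun y => ⟨(extChartAt (𝓡 (2 * m)) x₀).symm y, chart_symm_mem_chartSet x₀ hBT y.2⟩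
      left_inv := fun x => Subtype.ext ((extChartAt (𝓡 (2 * m)) x₀).left_inv x.2.1)
      right_inv := fun y => Subtype.ext ((extChartAt (𝓡 (2 * m)) x₀).right_inv (hBT y.2))
      continuous_toFun := Continuous.subtype_mk
        (continuousOn_iff_continuous_domRestrict.1
          ((continuousOn_extChartAt x₀).mono inter_subset_left)) _
      continuous_invFun := Continuous.subtype_mk
        (continuousOn_iff_continuous_domRestrict.1
          ((continuousOn_extChartAt_symm x₀).mono hBT)) _ }
  exact e.contractibleSpace

/-- Neighborhoods of `x₀` contain chart balls. -/
theorem exists_chart_ball (x₀ : M) {S : Set M} (hS : S ∈ 𝓝 x₀) :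
    ∃ B : Set (Model m), IsOpen B ∧ Convex ℝ B ∧ extChartAt (𝓡 (2 * m)) x₀ x₀ ∈ B ∧
      B ⊆ (extChartAt (𝓡 (2 * m)) x₀).target ∧ x₀ ∈ chartSet x₀ B ∧ chartSet x₀ B ⊆ S := by
  let φ := extChartAt (𝓡 (2 * m)) x₀
  have h1 : φ.target ∩ φ.symm ⁻¹' S ∈ 𝓝 (φ x₀) := by
    refine Filter.inter_mem ((isOpen_target x₀).mem_nhds (mem_extChartAt_target x₀)) ?_
    refine (continuousAt_extChartAt_symm x₀) ?_
    rwa [extChartAt_to_inv]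
  obtain ⟨r, hr, hrS⟩ := Metric.mem_nhds_iff.1 h1
  refine ⟨Metric.ball (φ x₀) r, Metric.isOpen_ball, convex_ball _ _, Metric.mem_ball_self hr,
    fun e he => (hrS he).1, ⟨mem_extChartAt_source x₀, Metric.mem_ball_self hr⟩, ?_⟩
  rintro x ⟨hx, hxB⟩
  have := (hrS hxB).2
  rwa [mem_preimage, φ.left_inv hx] at this

/-- `g` is smooth around `U × U` and maps it to the domain of the preferred chart at `x₀`, where
`U` is the part of `M` which this chart maps to `B`. -/
def ChartAdapted (x₀ : M) (B : Set (Model m)) (g : M × M → M) : Prop :=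
  ∀ q ∈ chartSet x₀ B ×ˢ chartSet x₀ B,
    ContMDiffAt ((𝓡 (2 * m)).prod (𝓡 (2 * m))) (𝓡 (2 * m)) ∞ g q ∧
      g q ∈ (extChartAt (𝓡 (2 * m)) x₀).source

theorem ChartAdapted.mem_target {x₀ : M} {B : Set (Model m)} {g : M × M → M}
    (h : ChartAdapted x₀ B g) (hBT : B ⊆ (extChartAt (𝓡 (2 * m)) x₀).target)
    {p : Model m × Model m} (hp : p ∈ B ×ˢ B) :
    chartMap x₀ g p ∈ (extChartAt (𝓡 (2 * m)) x₀).target :=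
  (extChartAt (𝓡 (2 * m)) x₀).map_source (h _ (pairSymm_mem x₀ hBT hp)).2

variable [IsManifold (𝓡 (2 * m)) ∞ M]

theorem contDiffOn_comp_pairSymm_iff (x₀ : M) {B : Set (Model m)} (hB : IsOpen B)
    (hBT : B ⊆ (extChartAt (𝓡 (2 * m)) x₀).target) {Φ : M × M → ℝ} :
    ContDiffOn ℝ ∞ (Φ ∘ pairSymm x₀) (B ×ˢ B) ↔
      ContMDiffOn ((𝓡 (2 * m)).prod (𝓡 (2 * m))) 𝓘(ℝ, ℝ) ∞ Φ
        (chartSet x₀ B ×ˢ chartSet x₀ B) := by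
  constructor
  · intro h q hq
    have h1 : ContMDiffAt ((𝓡 (2 * m)).prod (𝓡 (2 * m))) 𝓘(ℝ, Model m × Model m) ∞
        (fun q : M × M => (extChartAt (𝓡 (2 * m)) x₀ q.1, extChartAt (𝓡 (2 * m)) x₀ q.2)) q :=
      ((contMDiffAt_chart x₀ hq.1.1).comp q contMDiffAt_fst).prodMk_space
        ((contMDiffAt_chart x₀ hq.2.1).comp q contMDiffAt_snd)
    have h2 := (h.contDiffAt ((hB.prod hB).mem_nhds (x := (extChartAt (𝓡 (2 * m)) x₀ q.1,
      extChartAt (𝓡 (2 * m)) x₀ q.2)) ⟨hq.1.2, hq.2.2⟩)).contMDiffAt.comp q h1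
    refine (h2.congr_of_eventuallyEq ?_).contMDiffWithinAt
    filter_upwards [((isOpen_chartSet x₀ hB).prod (isOpen_chartSet x₀ hB)).mem_nhds hq] with q' hq'
    exact congrArg Φ (pairSymm_chart x₀ hq').symm
  · intro h p hp
    have h1 := (h.contMDiffAt (((isOpen_chartSet x₀ hB).prod (isOpen_chartSet x₀ hB)).mem_nhds
      (pairSymm_mem x₀ hBT hp))).comp p (contMDiffAt_pairSymm x₀ (hBT hp.1) (hBT hp.2))
    exact (contMDiffAt_iff_contDiffAt.1 h1).contDiffWithinAt

theorem ChartAdapted.contDiffOn {x₀ : M} {B : Set (Model m)} {g : M × M → M}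
    (h : ChartAdapted x₀ B g) (hBT : B ⊆ (extChartAt (𝓡 (2 * m)) x₀).target) :
    ContDiffOn ℝ ∞ (chartMap x₀ g) (B ×ˢ B) := by
  intro p hp
  have h1 := h _ (pairSymm_mem x₀ hBT hp)
  have h2 := (contMDiffAt_chart x₀ h1.2).comp p
    (h1.1.comp p (contMDiffAt_pairSymm x₀ (hBT hp.1) (hBT hp.2)))
  exact (contMDiffAt_iff_contDiffAt.1 h2).contDiffWithinAt

/-- Both sides of the equation transform by `chartDeriv`, which is onto, so it suffices to test it
on images of coordinate vectors. -/
theorem isPotential_iff {symp : ∀ x : M, TangentSpace (𝓡 (2 * m)) x [⋀^Fin 2]→L[ℝ] ℝ} {x₀ : M}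
    {B : Set (Model m)} (hB : IsOpen B) (hBT : B ⊆ (extChartAt (𝓡 (2 * m)) x₀).target)
    {g : M × M → M} (hg : ChartAdapted x₀ B g) {Φ : M × M → ℝ} :
    IsPotential (pullbackForm symp g) (chartSet x₀ B ×ˢ chartSet x₀ B) Φ ↔
      ContDiffOn ℝ ∞ (Φ ∘ pairSymm x₀) (B ×ˢ B) ∧ ∀ p ∈ B ×ˢ B, ∀ a a' b b',
        chartForm symp x₀ g p ![(a, b), (a', b')] =
          fderiv ℝ (fderiv ℝ (Φ ∘ pairSymm x₀)) p (a, 0) (0, b') -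
            fderiv ℝ (fderiv ℝ (Φ ∘ pairSymm x₀)) p (a', 0) (0, b) := by
  constructor
  · rintro ⟨hs, he⟩
    have hs' := (contDiffOn_comp_pairSymm_iff x₀ hB hBT).2 hs
    refine ⟨hs', fun p hp a a' b b' => ?_⟩
    have hq := pairSymm_mem x₀ hBT hp
    rw [← mixedDeriv_pairSymm x₀ hB hBT hs' hp, ← mixedDeriv_pairSymm x₀ hB hBT hs' hp,
      ← pullbackForm_pairSymm symp x₀ (hBT hp.1) (hBT hp.2) (hg _ hq).1 (hg _ hq).2]
    exact he _ hq _ _ _ _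
  · rintro ⟨hs, he⟩
    refine ⟨(contDiffOn_comp_pairSymm_iff x₀ hB hBT).1 hs, fun q hq a a' b b' => ?_⟩
    obtain ⟨p, hp, rfl⟩ : ∃ p ∈ B ×ˢ B, pairSymm x₀ p = q :=
      ⟨(extChartAt (𝓡 (2 * m)) x₀ q.1, extChartAt (𝓡 (2 * m)) x₀ q.2), ⟨hq.1.2, hq.2.2⟩,
        pairSymm_chart x₀ hq⟩
    obtain ⟨a, rfl⟩ := chartDeriv_surjective x₀ (hBT hp.1) a
    obtain ⟨a', rfl⟩ := chartDeriv_surjective x₀ (hBT hp.1) a'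
    obtain ⟨b, rfl⟩ := chartDeriv_surjective x₀ (hBT hp.2) b
    obtain ⟨b', rfl⟩ := chartDeriv_surjective x₀ (hBT hp.2) b'
    rw [mixedDeriv_pairSymm x₀ hB hBT hs hp, mixedDeriv_pairSymm x₀ hB hBT hs hp, ← he p hp]
    exact pullbackForm_pairSymm symp x₀ (hBT hp.1) (hBT hp.2) (hg _ hq).1 (hg _ hq).2 (a, b) (a', b')

/-- Two potentials on `U × U`, `U` a chart ball, have the same function `T`. -/
theorem calabi_eq_of_isPotential {symp : ∀ x : M, TangentSpace (𝓡 (2 * m)) x [⋀^Fin 2]→L[ℝ] ℝ}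
    {x₀ : M} {B : Set (Model m)} (hB : IsOpen B) (hBc : Convex ℝ B)
    (hBT : B ⊆ (extChartAt (𝓡 (2 * m)) x₀).target)
    {g : M × M → M} (hg : ChartAdapted x₀ B g) {Φ Ψ : M × M → ℝ}
    (hΦ : IsPotential (pullbackForm symp g) (chartSet x₀ B ×ˢ chartSet x₀ B) Φ)
    (hΨ : IsPotential (pullbackForm symp g) (chartSet x₀ B ×ˢ chartSet x₀ B) Ψ) {x u y : M}
    (hx : x ∈ chartSet x₀ B) (hu : u ∈ chartSet x₀ B) (hy : y ∈ chartSet x₀ B) :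
    calabi Φ (x, u, y) = calabi Ψ (x, u, y) := by
  obtain ⟨h1, h2⟩ := (isPotential_iff hB hBT hg).1 hΦ
  obtain ⟨h3, h4⟩ := (isPotential_iff hB hBT hg).1 hΨ
  have hBB := hB.prod hB
  have hd : ∀ p ∈ B ×ˢ B, ∀ a b, fderiv ℝ (fderiv ℝ (Φ ∘ pairSymm x₀ - Ψ ∘ pairSymm x₀)) p
      (a, 0) (0, b) = 0 := by
    intro p hp a b
    have hev : fderiv ℝ (Φ ∘ pairSymm x₀ - Ψ ∘ pairSymm x₀) =ᶠ[𝓝 p]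
        fderiv ℝ (Φ ∘ pairSymm x₀) - fderiv ℝ (Ψ ∘ pairSymm x₀) := by
      filter_upwards [hBB.mem_nhds hp] with q hq
      exact ((hasFDerivAt_of_contDiffOn hBB h1 hq).sub (hasFDerivAt_of_contDiffOn hBB h3 hq)).fderiv
    rw [hev.fderiv_eq, ((hasFDerivAt_fderiv hBB h1 hp).sub (hasFDerivAt_fderiv hBB h3 hp)).fderiv]
    -- With `a' = 0` and `b = 0` the second mixed term disappears, so `Ω` determines the mixed
    -- derivative of its potential.
    have e1 := h2 p hp a 0 0 b
    have e2 := h4 p hp a 0 0 b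
    simp only [Prod.mk_zero_zero, map_zero, sub_zero] at e1 e2
    rw [sub_apply, sub_apply, ← e1, ← e2, sub_self]
  -- The rectangle with sides from `u` to `x` and from `y` to `u`: its four corners carry the four
  -- terms of `T`.
  have h5 := rectangle_eq_zero_of_convex hB hBc (h1.sub h3) hd hu.2 hx.2 hy.2 hu.2
  have e : ∀ a ∈ chartSet x₀ B, ∀ b ∈ chartSet x₀ B,
      pairSymm x₀ (extChartAt (𝓡 (2 * m)) x₀ a, extChartAt (𝓡 (2 * m)) x₀ b) = (a, b) :=
    fun a ha b hb => pairSymm_chart x₀ (q := (a, b)) ⟨ha, hb⟩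
  simp only [Function.comp_apply, e x hx u hu, e u hu u hu, e x hx y hy,
    e u hu y hy] at h5
  simp only [calabi]
  linarith

/-- Local existence of potentials. -/
theorem exists_isPotential {symp : ∀ x : M, TangentSpace (𝓡 (2 * m)) x [⋀^Fin 2]→L[ℝ] ℝ}
    (hsymp : IsSymplecticForm symp)
    {x₀ : M} {B : Set (Model m)} (hB : IsOpen B) (hBc : Convex ℝ B)
    (hBT : B ⊆ (extChartAt (𝓡 (2 * m)) x₀).target)
    {g : M × M → M} (hg : ChartAdapted x₀ B g)
    (h₁ : ∀ q ∈ chartSet x₀ B ×ˢ chartSet x₀ B, ∀ a a' : Model m,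
      pullbackForm symp g q ![((a, 0) : Model m × Model m), (a', 0)] = 0)
    (h₂ : ∀ q ∈ chartSet x₀ B ×ˢ chartSet x₀ B, ∀ b b' : Model m,
      pullbackForm symp g q ![((0, b) : Model m × Model m), (0, b')] = 0) :
    ∃ Φ : M × M → ℝ, IsPotential (pullbackForm symp g) (chartSet x₀ B ×ˢ chartSet x₀ B) Φ := by
  have hBB := hB.prod hB
  have hgc := hg.contDiffOn hBT
  have hgd := hgc.fderiv_of_isOpen (m := ∞) hBB (by simp)
  have hin := contDiffOn_toBilin (hsymp.smooth x₀)
  have hpull := fun (p) (hp : p ∈ B ×ˢ B) => pullbackForm_pairSymm symp x₀ (hBT hp.1) (hBT hp.2)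
    (hg _ (pairSymm_mem x₀ hBT hp)).1 (hg _ (pairSymm_mem x₀ hBT hp)).2
  have hind : ∀ p ∈ B ×ˢ B, DifferentiableAt ℝ (inChart symp x₀) (chartMap x₀ g p) := fun p hp =>
    ((hsymp.smooth x₀).differentiableOn (by simp)).differentiableAt
      ((isOpen_target x₀).mem_nhds (hg.mem_target hBT hp))
  obtain ⟨Φ, hΦ, hΦe⟩ := exists_potential_of_extDeriv_eq_zero hB hBc (η := chartForm symp x₀ g)
    (fun v w => by
      refine (((hin.comp hgc fun p hp => hg.mem_target hBT hp).clm_apply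
        (hgd.clm_apply (contDiffOn_const (c := v)))).clm_apply
          (hgd.clm_apply (contDiffOn_const (c := w)))).congr fun p hp => ?_
      rw [chartForm_apply, ← toBilin_apply]
      rfl)
    (fun p hp => by
      have e1 := (hind p hp).comp p (hasFDerivAt_of_contDiffOn hBB hgc hp).differentiableAt
      have e2 := (hgd.differentiableOn (by simp)).differentiableAt (hBB.mem_nhds hp)
      exact e1.continuousAlternatingMapCompContinuousLinearMap e2)
    (fun p hp => by
      -- Exterior differentiation commutes with pullback, so closedness of `symp` is enough.
      refine (extDeriv_pullback (r := ∞) (hind p hp) (hgc.contDiffAt (hBB.mem_nhds hp)) (by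
        rw [minSmoothness_of_isRCLikeNormedField]; exact WithTop.coe_le_coe.2 le_top)).trans ?_
      rw [hsymp.closed x₀ _ (hg.mem_target hBT hp)]
      rfl)
    (fun p hp a a' => by
      rw [← hpull p hp]
      simpa using h₁ _ (pairSymm_mem x₀ hBT hp) (chartDeriv x₀ p.1 a) (chartDeriv x₀ p.1 a'))
    (fun p hp b b' => by
      rw [← hpull p hp]
      simpa using h₂ _ (pairSymm_mem x₀ hBT hp) (chartDeriv x₀ p.2 b) (chartDeriv x₀ p.2 b'))
  let φ := extChartAt (𝓡 (2 * m)) x₀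
  let Ψ : M × M → ℝ := fun q => Φ (φ q.1, φ q.2)
  have hEq : EqOn (Ψ ∘ pairSymm x₀) Φ (B ×ˢ B) := fun p hp =>
    congrArg Φ (Prod.ext (φ.right_inv (hBT hp.1)) (φ.right_inv (hBT hp.2)))
  refine ⟨Ψ, (isPotential_iff hB hBT hg).2 ⟨hΦ.congr hEq, fun p hp a a' b b' => ?_⟩⟩
  have hev : Ψ ∘ pairSymm x₀ =ᶠ[𝓝 p] Φ := hEq.eventuallyEq_of_mem (hBB.mem_nhds hp)
  rw [hev.fderiv.fderiv_eq]
  exact hΦe p hp a a' b b'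

end ChartSets

/-! ### Isotropy of the leaves and paths in the level sets of a Lagrangian field. -/

section Bundles

variable {m : ℕ} {M : Type*} [TopologicalSpace M] [ChartedSpace (Model m) M]
  [IsManifold (𝓡 (2 * m)) ∞ M]
  {E : M → Type*} [TopologicalSpace (TotalSpace (Fib m) E)] [∀ x, AddCommGroup (E x)]
  [∀ x, Module ℝ (E x)] [∀ x, TopologicalSpace (E x)] [FiberBundle (Fib m) E]
  [VectorBundle ℝ (Fib m) E] [ContMDiffVectorBundle ∞ (Fib m) E (𝓡 (2 * m))]
  {symp : ∀ x : M, TangentSpace (𝓡 (2 * m)) x [⋀^Fin 2]→L[ℝ] ℝ}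
  {lam : TotalSpace (Fib m) E → M}

theorem IsLagrangianField.contMDiff (h : IsLagrangianField E symp lam) :
    ContMDiff ((𝓡 (2 * m)).prod 𝓘(ℝ, Fib m)) (𝓡 (2 * m)) ∞ lam :=
  h.submersion.contMDiff

/-- Near `y` the map `f` stays in the single fiber `E_x`, so `lam ∘ f` factors through `fiberMap lam
x` and its derivative is tangent to `Λ_x`. The point `z` is a separate variable so that the base
point of the form can be rewritten. -/
theorem IsLagrangianField.isotropic (h : IsLagrangianField E symp lam) {x y : M}
    {f : M → TotalSpace (Fib m) E}
    (hf : ContMDiffAt (𝓡 (2 * m)) ((𝓡 (2 * m)).prod 𝓘(ℝ, Fib m)) ∞ f y)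
    (hfx : ∀ᶠ t in 𝓝 y, (f t).proj = x) {z : M} (hz : lam (f y) = z) (a b : Model m) :
    formAt symp z ![(mfderiv (𝓡 (2 * m)) (𝓡 (2 * m)) (lam ∘ f) y a : Model m),
      (mfderiv (𝓡 (2 * m)) (𝓡 (2 * m)) (lam ∘ f) y b : Model m)] = 0 := by
  let e := trivializationAt (Fib m) E x
  have hxe : x ∈ e.baseSet := mem_baseSet_trivializationAt (Fib m) E x
  have hfy : f y ∈ e.source := by
    rw [e.mem_source, hfx.self_of_nhds]
    exact hxe
  have hw : ContMDiffAt (𝓡 (2 * m)) 𝓘(ℝ, Fib m) ∞ (fun t => (e (f t)).2) y :=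
    ((e.contMDiffAt_iff hfy).1 hf).2
  have hev : lam ∘ f =ᶠ[𝓝 y] fiberMap lam x ∘ fun t => (e (f t)).2 := by
    filter_upwards [hfx] with t ht
    have h1 : f t ∈ e.source := by
      rw [e.mem_source, ht]
      exact hxe
    have h2 : (⟨x, e.symm x (e (f t)).2⟩ : TotalSpace (Fib m) E) = f t := by
      rw [e.mk_symm hxe]
      have h3 : (x, (e (f t)).2) = e (f t) := Prod.ext ((e.coe_fst h1).trans ht).symm rfl
      rw [h3]
      exact e.toOpenPartialHomeomorph.left_inv h1
    exact congrArg lam h2.symm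
  have hfib := ((h.embedding x).contMDiff.mdifferentiable (by simp)) ((e (f y)).2)
  have hd := (hfib.hasMFDerivAt.comp y
    (hw.mdifferentiableAt (by simp)).hasMFDerivAt).congr_of_eventuallyEq hev
  rw [hd.mfderiv]
  have hl := h.lagrangian x (e (f y)).2
    (mfderiv (𝓡 (2 * m)) 𝓘(ℝ, Fib m) (fun t => (e (f t)).2) y a)
    (mfderiv (𝓡 (2 * m)) 𝓘(ℝ, Fib m) (fun t => (e (f t)).2) y b)
  have hz' : z = fiberMap lam x (e (f y)).2 := hz.symm.trans hev.self_of_nhds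
  subst hz'
  exact hl

/-- Points near `0_{x₀}` are joined to the zero section within the level sets of a Lagrangian
field. -/
theorem IsLagrangianField.exists_path (h : IsLagrangianField E symp lam) (x₀ : M)
    {O : Set (TotalSpace (Fib m) E)} (hO : O ∈ 𝓝 (⟨x₀, 0⟩ : TotalSpace (Fib m) E)) :
    ∃ Z ∈ 𝓝 (⟨x₀, 0⟩ : TotalSpace (Fib m) E), ∀ z ∈ Z, ∃ c : ℝ → TotalSpace (Fib m) E,
      c 0 = ⟨lam z, 0⟩ ∧ c 1 = z ∧ ∀ t ∈ Icc (0 : ℝ) 1, c t ∈ O ∧ lam (c t) = lam z ∧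
        MDifferentiableAt 𝓘(ℝ, ℝ) ((𝓡 (2 * m)).prod 𝓘(ℝ, Fib m)) c t := by
  let z₀ : TotalSpace (Fib m) E := ⟨x₀, 0⟩
  let J := (𝓡 (2 * m)).prod 𝓘(ℝ, Fib m)
  have hs := h.submersion.isSubmersionAt z₀
  let d := hs.domChart.extend J
  have hdo : IsOpen d.target := hs.domChart.isOpen_extend_target
  have hdz : z₀ ∈ d.source := by
    rw [OpenPartialHomeomorph.extend_source]
    exact hs.mem_domChart_source
  have hdsm : ContMDiffOn 𝓘(ℝ, Model m × Fib m) J ∞ d.symm d.target := by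
    have := contMDiffOn_extend_symm hs.domChart_mem_maximalAtlas
    refine this.mono ?_
    rw [OpenPartialHomeomorph.extend_target']
  have h1 : d.target ∩ d.symm ⁻¹' O ∈ 𝓝 (d z₀) := by
    refine Filter.inter_mem (hdo.mem_nhds (d.map_source hdz)) ?_
    refine (hdsm.contMDiffAt (hdo.mem_nhds (d.map_source hdz))).continuousAt ?_
    rwa [d.left_inv hdz]
  obtain ⟨r, hr, hrO⟩ := Metric.mem_nhds_iff.1 h1
  let Y : Set (TotalSpace (Fib m) E) := d.source ∩ d ⁻¹' Metric.ball (d z₀) r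
  have hY : Y ∈ 𝓝 z₀ := by
    refine Filter.inter_mem ?_ ?_
    · rw [OpenPartialHomeomorph.extend_source]
      exact hs.domChart.open_source.mem_nhds hs.mem_domChart_source
    · exact (hs.domChart.continuousAt_extend hs.mem_domChart_source)
        (Metric.ball_mem_nhds _ hr)
  -- The zero vector in the same level set as `z`. Since `ζ` is continuous and fixes `z₀`, both ends
  -- of the segment lie in the chart ball when `z` is close to `z₀`.
  let ζ : TotalSpace (Fib m) E → TotalSpace (Fib m) E := fun z => ⟨lam z, 0⟩
  have hζ : Continuous ζ :=
    (contMDiff_zeroSection (n := ∞) (IB := 𝓡 (2 * m)) ℝ E).continuous.comp h.contMDiff.continuous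
  have hζ₀ : ζ z₀ = z₀ :=
    congrArg (fun x => (⟨x, 0⟩ : TotalSpace (Fib m) E)) (h.zero_section x₀)
  refine ⟨Y ∩ ζ ⁻¹' Y, Filter.inter_mem hY (hζ.continuousAt (by rwa [hζ₀])), ?_⟩
  rintro z ⟨hz, hzζ⟩
  let l : ℝ → Model m × Fib m := AffineMap.lineMap (d (ζ z)) (d z)
  have hl : ∀ t ∈ Icc (0 : ℝ) 1, l t ∈ Metric.ball (d z₀) r := fun t ht =>
    (convex_ball (d z₀) r).lineMap_mem hzζ.2 hz.2 ht
  refine ⟨fun t => d.symm (l t), ?_, ?_, fun t ht => ⟨(hrO (hl t ht)).2, ?_, ?_⟩⟩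
  · simp only [l, AffineMap.lineMap_apply_zero]
    exact d.left_inv hzζ.1
  · simp only [l, AffineMap.lineMap_apply_one]
    exact d.left_inv hz.1
  · have hw := hs.writtenInCharts
    have hmem : ∀ w ∈ d.source, lam w ∈ (hs.codChart.extend (𝓡 (2 * m))).source := by
      intro w hw
      rw [OpenPartialHomeomorph.extend_source] at hw ⊢
      exact hs.source_subset_preimage_source hw
    have hval : ∀ w ∈ d.source,
        hs.codChart.extend (𝓡 (2 * m)) (lam w) = (hs.equiv (d w)).1 := by
      intro w hw'
      have := hw (d.map_source hw')
      simp only [Function.comp_apply] at this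
      erw [d.left_inv hw'] at this
      exact this
    have hls := (hrO (hl t ht)).1
    have hcs := d.map_target hls
    refine (hs.codChart.extend (𝓡 (2 * m))).injOn (hmem _ hcs) (hmem _ hz.1) ?_
    rw [hval _ hcs, d.right_inv hls, hval _ hz.1]
    have e0 := hval _ hzζ.1
    rw [show lam (ζ z) = lam z from h.zero_section _, hval _ hz.1] at e0
    simp only [l, AffineMap.lineMap_apply_module', map_add, map_smul, map_sub, Prod.fst_add,
      Prod.smul_fst, Prod.fst_sub, ← e0, sub_self, smul_zero, zero_add]
  · have e1 := ((hdsm.contMDiffAt (hdo.mem_nhds (hrO (hl t ht)).1)).mdifferentiableAt (by simp))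
    have e2 : MDifferentiableAt 𝓘(ℝ, ℝ) 𝓘(ℝ, Model m × Fib m) l t :=
      (AffineMap.hasDerivAt_lineMap.differentiableAt).mdifferentiableAt
    exact e1.comp t e2

end Bundles

/-! ### The intersection mapping `γ` and the isotropy of the two factors for its pullback form. -/

section Intersection

variable {m : ℕ} {M : Type*} [TopologicalSpace M] [ChartedSpace (Model m) M]
  [IsManifold (𝓡 (2 * m)) ∞ M]
  {E : M → Type*} [TopologicalSpace (TotalSpace (Fib m) E)] [∀ x, AddCommGroup (E x)]
  [∀ x, Module ℝ (E x)] [∀ x, TopologicalSpace (E x)] [FiberBundle (Fib m) E]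
  [VectorBundle ℝ (Fib m) E] [ContMDiffVectorBundle ∞ (Fib m) E (𝓡 (2 * m))]
  {E' : M → Type*} [TopologicalSpace (TotalSpace (Fib m) E')] [∀ x, AddCommGroup (E' x)]
  [∀ x, Module ℝ (E' x)] [∀ x, TopologicalSpace (E' x)] [FiberBundle (Fib m) E']
  [VectorBundle ℝ (Fib m) E'] [ContMDiffVectorBundle ∞ (Fib m) E' (𝓡 (2 * m))]
  {symp : ∀ x : M, TangentSpace (𝓡 (2 * m)) x [⋀^Fin 2]→L[ℝ] ℝ}
  {lam : TotalSpace (Fib m) E → M} {lam' : TotalSpace (Fib m) E' → M}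

namespace IntersectionData

theorem inv_diag (D : IntersectionData lam lam') (x : M) : D.inv (x, x) = (⟨x, 0⟩, ⟨x, 0⟩) :=
  D.inv_proj _ (D.zero_mem x)

theorem gamma_eq (D : IntersectionData lam lam') {p : M × M} (hp : p ∈ D.V) :
    lam' (D.inv p).2 = D.gamma p := by
  obtain ⟨O, -, hW⟩ := D.isOpen_W
  have := D.inv_mem p hp
  rw [hW] at this
  exact this.2.symm

theorem gamma_of_mem (D : IntersectionData lam lam')
    {q : TotalSpace (Fib m) E × TotalSpace (Fib m) E'} (hq : q ∈ D.W) :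
    D.gamma (q.1.proj, q.2.proj) = lam q.1 := by
  rw [gamma, D.inv_proj q hq]

theorem mem_W (D : IntersectionData lam lam') (x : M) :
    ∀ᶠ q in 𝓝 ((⟨x, 0⟩, ⟨x, 0⟩) : TotalSpace (Fib m) E × TotalSpace (Fib m) E'),
      lam q.1 = lam' q.2 → q ∈ D.W := by
  obtain ⟨O, hO, hW⟩ := D.isOpen_W
  have := D.zero_mem x
  rw [hW] at this
  filter_upwards [hO.mem_nhds this.1] with q hq h
  rw [hW]
  exact ⟨hq, h⟩

theorem gamma_diag (D : IntersectionData lam lam') (hlam : IsLagrangianField E symp lam) (x : M) :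
    D.gamma (x, x) = x := by
  rw [gamma, inv_diag]
  exact hlam.zero_section x

theorem contMDiffAt_inv (D : IntersectionData lam lam') {p : M × M} (hp : p ∈ D.V) :
    ContMDiffAt ((𝓡 (2 * m)).prod (𝓡 (2 * m)))
      (((𝓡 (2 * m)).prod 𝓘(ℝ, Fib m)).prod ((𝓡 (2 * m)).prod 𝓘(ℝ, Fib m))) ∞ D.inv p :=
  D.smooth_inv.contMDiffAt (D.isOpen_V.mem_nhds hp)

theorem contMDiffAt_gamma (D : IntersectionData lam lam') (hlam : IsLagrangianField E symp lam)
    {p : M × M} (hp : p ∈ D.V) :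
    ContMDiffAt ((𝓡 (2 * m)).prod (𝓡 (2 * m))) (𝓡 (2 * m)) ∞ D.gamma p :=
  hlam.contMDiff.contMDiffAt.comp p (contMDiffAt_fst.comp p (D.contMDiffAt_inv hp))

theorem mfderiv_gamma_snd (D : IntersectionData lam lam') (hlam : IsLagrangianField E symp lam)
    {p : M × M} (hp : p ∈ D.V) (b : Model m) :
    (mfderiv ((𝓡 (2 * m)).prod (𝓡 (2 * m))) (𝓡 (2 * m)) D.gamma p
      ((0, b) : Model m × Model m) : Model m) =
    mfderiv (𝓡 (2 * m)) (𝓡 (2 * m)) (fun t => D.gamma (p.1, t)) p.2 b := by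
  have h1 := ((D.contMDiffAt_gamma hlam hp).mdifferentiableAt (by simp)).hasMFDerivAt
  have h2 : HasMFDerivAt (𝓡 (2 * m)) ((𝓡 (2 * m)).prod (𝓡 (2 * m))) (fun t => (p.1, t)) p.2
      ((0 : Model m →L[ℝ] Model m).prod (ContinuousLinearMap.id ℝ (Model m))) :=
    (hasMFDerivAt_const p.1 p.2).prodMk (hasMFDerivAt_id p.2)
  have h3 := (HasMFDerivAt.comp (f := fun t => (p.1, t)) p.2 h1 h2).mfderiv
  exact (congrArg (fun L : Model m →L[ℝ] Model m => L b) h3).symm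

theorem mfderiv_gamma_fst (D : IntersectionData lam lam') (hlam : IsLagrangianField E symp lam)
    {p : M × M} (hp : p ∈ D.V) (a : Model m) :
    (mfderiv ((𝓡 (2 * m)).prod (𝓡 (2 * m))) (𝓡 (2 * m)) D.gamma p
      ((a, 0) : Model m × Model m) : Model m) =
    mfderiv (𝓡 (2 * m)) (𝓡 (2 * m)) (fun t => D.gamma (t, p.2)) p.1 a := by
  have h1 := ((D.contMDiffAt_gamma hlam hp).mdifferentiableAt (by simp)).hasMFDerivAt
  have h2 : HasMFDerivAt (𝓡 (2 * m)) ((𝓡 (2 * m)).prod (𝓡 (2 * m))) (fun t => (t, p.2)) p.1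
      ((ContinuousLinearMap.id ℝ (Model m)).prod (0 : Model m →L[ℝ] Model m)) :=
    (hasMFDerivAt_id p.1).prodMk (hasMFDerivAt_const p.2 p.1)
  have h3 := (HasMFDerivAt.comp (f := fun t => (t, p.2)) p.1 h1 h2).mfderiv
  exact (congrArg (fun L : Model m →L[ℝ] Model m => L a) h3).symm

/-- With `p.1` fixed, `γ` is `lam` of a point moving in the fiber of `E` over `p.1`, hence stays in
one Lagrangian leaf. -/
theorem pullback_snd_eq_zero (D : IntersectionData lam lam') (hlam : IsLagrangianField E symp lam)
    {p : M × M} (hp : p ∈ D.V) (b b' : Model m) :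
    pullbackForm symp D.gamma p ![((0, b) : Model m × Model m), (0, b')] = 0 := by
  rw [pullbackForm_apply, D.mfderiv_gamma_snd hlam hp, D.mfderiv_gamma_snd hlam hp]
  have hc : ContMDiffAt (𝓡 (2 * m)) ((𝓡 (2 * m)).prod (𝓡 (2 * m))) ∞
      (fun t => (p.1, t)) p.2 := contMDiffAt_const.prodMk contMDiffAt_id
  refine hlam.isotropic (x := p.1) (f := fun t => (D.inv (p.1, t)).1)
    (contMDiffAt_fst.comp p.2 (ContMDiffAt.comp (f := fun t => (p.1, t)) p.2
      (D.contMDiffAt_inv hp) hc)) ?_ rfl b b'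
  filter_upwards [hc.continuousAt.eventually (D.isOpen_V.mem_nhds hp)] with t ht
  exact congrArg Prod.fst (D.proj_inv (p.1, t) ht)

/-- With `p.2` fixed, the expression of `γ` through `lam'` shows that it stays in the leaf of the
second field through `p.2`. -/
theorem pullback_fst_eq_zero (D : IntersectionData lam lam') (hlam : IsLagrangianField E symp lam)
    (hlam' : IsLagrangianField E' symp lam') {p : M × M} (hp : p ∈ D.V) (a a' : Model m) :
    pullbackForm symp D.gamma p ![((a, 0) : Model m × Model m), (a', 0)] = 0 := by
  rw [pullbackForm_apply, D.mfderiv_gamma_fst hlam hp, D.mfderiv_gamma_fst hlam hp]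
  have hc : ContMDiffAt (𝓡 (2 * m)) ((𝓡 (2 * m)).prod (𝓡 (2 * m))) ∞
      (fun t => (t, p.2)) p.1 := contMDiffAt_id.prodMk contMDiffAt_const
  have hV := hc.continuousAt.eventually (D.isOpen_V.mem_nhds hp)
  have hev : (fun t => D.gamma (t, p.2)) =ᶠ[𝓝 p.1] lam' ∘ fun t => (D.inv (t, p.2)).2 := by
    filter_upwards [hV] with t ht
    exact (D.gamma_eq ht).symm
  rw [hev.mfderiv_eq]
  refine hlam'.isotropic (x := p.2) (f := fun t => (D.inv (t, p.2)).2)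
    (contMDiffAt_snd.comp p.1 (ContMDiffAt.comp (f := fun t => (t, p.2)) p.1
      (D.contMDiffAt_inv hp) hc)) ?_ (D.gamma_eq hp) a a'
  filter_upwards [hV] with t ht
  exact congrArg Prod.snd (D.proj_inv (t, p.2) ht)

end IntersectionData

end Intersection

/-! ### Existence of the 3-point Calabi function. -/

section CalabiExistence

theorem eventually_triple {M : Type*} [TopologicalSpace M] (z : M) {S : Set (M × M × M)}
    (hS : S ∈ 𝓝 (z, z, z)) : ∃ N ∈ 𝓝 z, N ×ˢ N ×ˢ N ⊆ S := by
  rw [nhds_prod_eq, nhds_prod_eq] at hS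
  obtain ⟨N₁, h₁, R, hR, hN⟩ := Filter.mem_prod_iff.1 hS
  obtain ⟨N₂, h₂, N₃, h₃, hR'⟩ := Filter.mem_prod_iff.1 hR
  refine ⟨N₁ ∩ (N₂ ∩ N₃), Filter.inter_mem h₁ (Filter.inter_mem h₂ h₃), ?_⟩
  rintro ⟨x, u, y⟩ ⟨hx, hu, hy⟩
  exact hN ⟨hx.1, hR' ⟨hu.2.1, hy.2.2⟩⟩

variable {m : ℕ} {M : Type*} [TopologicalSpace M] [ChartedSpace (Model m) M]

theorem IsPotential.mono
    {Ω : ∀ p : M × M, TangentSpace ((𝓡 (2 * m)).prod (𝓡 (2 * m))) p [⋀^Fin 2]→L[ℝ] ℝ}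
    {S S' : Set (M × M)} {Φ : M × M → ℝ} (h : IsPotential Ω S Φ) (hS : S' ⊆ S) :
    IsPotential Ω S' Φ :=
  ⟨h.smooth.mono hS, fun p hp => h.eq_dd p (hS hp)⟩

theorem IsPotential.contMDiffOn_calabi
    {Ω : ∀ p : M × M, TangentSpace ((𝓡 (2 * m)).prod (𝓡 (2 * m))) p [⋀^Fin 2]→L[ℝ] ℝ}
    {U : Set M} {Φ : M × M → ℝ} (h : IsPotential Ω (U ×ˢ U) Φ) :
    ContMDiffOn ((𝓡 (2 * m)).prod ((𝓡 (2 * m)).prod (𝓡 (2 * m)))) 𝓘(ℝ, ℝ) ∞ (calabi Φ)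
      (U ×ˢ U ×ˢ U) := by
  have h1 := contMDiff_fst (n := ∞) (I := 𝓡 (2 * m)) (J := (𝓡 (2 * m)).prod (𝓡 (2 * m)))
    (M := M) (N := M × M)
  have h23 := contMDiff_snd (n := ∞) (I := 𝓡 (2 * m)) (J := (𝓡 (2 * m)).prod (𝓡 (2 * m)))
    (M := M) (N := M × M)
  have h2 := (contMDiff_fst (n := ∞) (I := 𝓡 (2 * m)) (J := 𝓡 (2 * m)) (M := M) (N := M)).comp h23
  have h3 := (contMDiff_snd (n := ∞) (I := 𝓡 (2 * m)) (J := 𝓡 (2 * m)) (M := M) (N := M)).comp h23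
  have e12 := h.smooth.comp (h1.prodMk h2).contMDiffOn (t := U ×ˢ U) (s := U ×ˢ U ×ˢ U)
    fun q hq => ⟨hq.1, hq.2.1⟩
  have e22 := h.smooth.comp (h2.prodMk h2).contMDiffOn (t := U ×ˢ U) (s := U ×ˢ U ×ˢ U)
    fun q hq => ⟨hq.2.1, hq.2.1⟩
  have e23 := h.smooth.comp (h2.prodMk h3).contMDiffOn (t := U ×ˢ U) (s := U ×ˢ U ×ˢ U)
    fun q hq => ⟨hq.2.1, hq.2.2⟩
  have e13 := h.smooth.comp (h1.prodMk h3).contMDiffOn (t := U ×ˢ U) (s := U ×ˢ U ×ˢ U)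
    fun q hq => ⟨hq.1, hq.2.2⟩
  exact ((e12.sub e22).add e23).sub e13

variable [IsManifold (𝓡 (2 * m)) ∞ M]
  {symp : ∀ x : M, TangentSpace (𝓡 (2 * m)) x [⋀^Fin 2]→L[ℝ] ℝ}

/-- Small chart balls are adapted to a map which is the identity on the diagonal. -/
theorem exists_chartAdapted {V : Set (M × M)} {g : M × M → M} (hV : IsOpen V)
    (hg : ∀ p ∈ V, ContMDiffAt ((𝓡 (2 * m)).prod (𝓡 (2 * m))) (𝓡 (2 * m)) ∞ g p) {x₀ : M}
    (hx₀ : (x₀, x₀) ∈ V) (hgx : g (x₀, x₀) = x₀) {S : Set M} (hS : S ∈ 𝓝 x₀) :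
    ∃ B : Set (Model m), IsOpen B ∧ Convex ℝ B ∧ extChartAt (𝓡 (2 * m)) x₀ x₀ ∈ B ∧
      B ⊆ (extChartAt (𝓡 (2 * m)) x₀).target ∧ x₀ ∈ chartSet x₀ B ∧ chartSet x₀ B ⊆ S ∧
      chartSet x₀ B ×ˢ chartSet x₀ B ⊆ V ∧ ChartAdapted x₀ B g := by
  have h1 : {p | p ∈ V ∧ g p ∈ (extChartAt (𝓡 (2 * m)) x₀).source} ∈ 𝓝 (x₀, x₀) := by
    refine Filter.inter_mem (hV.mem_nhds hx₀) ((hg _ hx₀).continuousAt ?_)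
    rw [hgx]
    exact extChartAt_source_mem_nhds (I := 𝓡 (2 * m)) x₀
  rw [nhds_prod_eq] at h1
  obtain ⟨N, hN, hNV⟩ := Filter.mem_prod_same_iff.1 h1
  obtain ⟨B, hB, hBc, hxB, hBT, hx, hBS⟩ := exists_chart_ball (m := m) x₀ (Filter.inter_mem hS hN)
  have hN' : ∀ q ∈ chartSet x₀ B ×ˢ chartSet x₀ B,
      q ∈ V ∧ g q ∈ (extChartAt (𝓡 (2 * m)) x₀).source :=
    fun q hq => hNV ⟨(hBS hq.1).2, (hBS hq.2).2⟩
  exact ⟨B, hB, hBc, hxB, hBT, hx, fun x hx => (hBS hx).1, fun q hq => (hN' q hq).1,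
    fun q hq => ⟨hg q (hN' q hq).1, (hN' q hq).2⟩⟩

/-- Potentials on chart balls give local functions `T`. They are independent of the potential, hence
agree near the diagonal and glue along it. Of `γ` only smoothness, `γ(x, x) = x` and the isotropy of
both factors matter. -/
theorem exists_isCalabiFunction [T2Space M] [SecondCountableTopology M]
    (hsymp : IsSymplecticForm symp) {V : Set (M × M)} {g : M × M → M} (hV : IsOpen V)
    (hg : ∀ p ∈ V, ContMDiffAt ((𝓡 (2 * m)).prod (𝓡 (2 * m))) (𝓡 (2 * m)) ∞ g p)
    (hdV : ∀ x, (x, x) ∈ V) (hdg : ∀ x, g (x, x) = x)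
    (h₁ : ∀ q ∈ V, ∀ a a' : Model m,
      pullbackForm symp g q ![((a, 0) : Model m × Model m), (a', 0)] = 0)
    (h₂ : ∀ q ∈ V, ∀ b b' : Model m,
      pullbackForm symp g q ![((0, b) : Model m × Model m), (0, b')] = 0) :
    ∃ (WT : Set (M × M × M)) (T : M × M × M → ℝ),
      IsCalabiFunction (pullbackForm symp g) V WT T := by
  -- Local compactness and second countability provide the paracompactness of `M³` used in the
  -- gluing.
  have : LocallyCompactSpace M := ChartedSpace.locallyCompactSpace (Model m) M
  choose B hB hBc hxB hBT hxU _hU hUV hBg using fun x₀ : M =>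
    exists_chartAdapted hV hg (hdV x₀) (hdg x₀) Filter.univ_mem
  choose Φ hΦ using fun x₀ : M => exists_isPotential hsymp (hB x₀) (hBc x₀) (hBT x₀) (hBg x₀)
    (fun q hq => h₁ q (hUV x₀ hq)) (fun q hq => h₂ q (hUV x₀ hq))
  let U : M → Set M := fun x₀ => chartSet x₀ (B x₀)
  have hUo : ∀ x, IsOpen (U x) := fun x => isOpen_chartSet x (hB x)
  let A : Set (M × M × M) := {q | q.1 = q.2.1 ∧ q.2.1 = q.2.2}
  have hA : IsClosed A := (isClosed_eq continuous_fst (by fun_prop)).inter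
    (isClosed_eq (by fun_prop) (by fun_prop))
  have hOo : ∀ x, IsOpen (U x ×ˢ U x ×ˢ U x) := fun x => (hUo x).prod ((hUo x).prod (hUo x))
  have hAO : A ⊆ ⋃ x, U x ×ˢ U x ×ˢ U x := by
    rintro ⟨x, u, y⟩ ⟨h, h'⟩
    obtain rfl : x = u := h
    obtain rfl : x = y := h'
    exact mem_iUnion.2 ⟨x, hxU x, hxU x, hxU x⟩
  have hloc : ∀ (z : M) (S : Set M), S ∈ 𝓝 z → ∃ B : Set (Model m), IsOpen B ∧ Convex ℝ B ∧
      extChartAt (𝓡 (2 * m)) z z ∈ B ∧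
      B ⊆ (extChartAt (𝓡 (2 * m)) z).target ∧ z ∈ chartSet z B ∧ chartSet z B ⊆ S ∧
      chartSet z B ×ˢ chartSet z B ⊆ V ∧ ChartAdapted z B g :=
    fun z S hS => exists_chartAdapted hV hg (hdV z) (hdg z) hS
  obtain ⟨T, WT, hWT, hAW, hT⟩ := exists_glue (f := fun x => calabi (Φ x)) hA hOo hAO (by
    rintro i j ⟨z, u, y⟩ ⟨h, h'⟩ hi hj
    obtain rfl : z = u := h
    obtain rfl : z = y := h'
    -- Two potentials are compared on a smaller ball of the chart at `z`, where convexity is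
    -- available; the intersection of the two given chart balls need not be convex in any chart.
    obtain ⟨B', hB', hBc', -, hBT', hz, hBS, -, hBg'⟩ := hloc z (U i ∩ U j)
      (Filter.inter_mem ((hUo i).mem_nhds hi.1) ((hUo j).mem_nhds hj.1))
    have ho := isOpen_chartSet z hB'
    filter_upwards [(ho.prod (ho.prod ho)).mem_nhds
      (show (z, z, z) ∈ _ from ⟨hz, hz, hz⟩)] with q hq
    exact calabi_eq_of_isPotential hB' hBc' hBT' hBg'
      ((hΦ i).mono (prod_mono (fun x hx => (hBS hx).1) fun x hx => (hBS hx).1))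
      ((hΦ j).mono (prod_mono (fun x hx => (hBS hx).2) fun x hx => (hBS hx).2)) hq.1 hq.2.1 hq.2.2)
  refine ⟨WT, T, hWT, fun x => hAW ⟨rfl, rfl⟩, fun q hq => ?_, fun x₀ => ?_⟩
  · obtain ⟨i, hi, hTi⟩ := hT q hq
    exact (((hΦ i).contMDiffOn_calabi.contMDiffAt ((hOo i).mem_nhds hi)).congr_of_eventuallyEq
      hTi).contMDiffWithinAt
  · have hx₀ : (x₀, x₀, x₀) ∈ WT := hAW ⟨rfl, rfl⟩
    obtain ⟨i, hi, hTi⟩ := hT _ hx₀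
    obtain ⟨N, hN, hNS⟩ := eventually_triple x₀ (Filter.inter_mem hTi (hWT.mem_nhds hx₀))
    obtain ⟨B', hB', hBc', hxB', hBT', hz, hBS, hBV, hBg'⟩ := hloc x₀ (U i ∩ N)
      (Filter.inter_mem ((hUo i).mem_nhds hi.1) hN)
    have hpot := (hΦ i).mono (prod_mono (s₁ := chartSet x₀ B') (t₁ := chartSet x₀ B')
      (fun x hx => (hBS hx).1) fun x hx => (hBS hx).1)
    refine ⟨chartSet x₀ B', isOpen_chartSet x₀ hB', hz,
      contractibleSpace_chartSet x₀ hBc' ⟨_, hxB'⟩ hBT', hBV, fun q hq =>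
        (hNS ⟨(hBS hq.1).2, (hBS hq.2.1).2, (hBS hq.2.2).2⟩).2, ⟨Φ i, hpot⟩, ?_⟩
    -- The formula holds for `Φ i` by construction, and passes to any other potential by
    -- `calabi_eq_of_isPotential`.
    intro Ψ hΨ x hx u hu y hy
    have e1 : T (x, u, y) = calabi (Φ i) (x, u, y) :=
      (hNS (show (x, u, y) ∈ N ×ˢ N ×ˢ N from ⟨(hBS hx).2, (hBS hu).2, (hBS hy).2⟩)).1
    rw [e1, calabi_eq_of_isPotential hB' hBc' hBT' hBg' hpot hΨ hx hu hy]
    rfl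

end CalabiExistence

/-! ### Charts of the total space along the zero section. -/

section TotalChart

variable {m : ℕ} {M : Type*} [TopologicalSpace M] [ChartedSpace (Model m) M]
  [IsManifold (𝓡 (2 * m)) ∞ M]
  (E : M → Type*) [TopologicalSpace (TotalSpace (Fib m) E)] [∀ x, AddCommGroup (E x)]
  [∀ x, Module ℝ (E x)] [∀ x, TopologicalSpace (E x)] [FiberBundle (Fib m) E]
  [VectorBundle ℝ (Fib m) E] [ContMDiffVectorBundle ∞ (Fib m) E (𝓡 (2 * m))]

/-- The preferred chart of the total space at `0_{x₀}`. -/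
def totalChart (x₀ : M) : PartialEquiv (TotalSpace (Fib m) E) (Model m × Fib m) :=
  extChartAt ((𝓡 (2 * m)).prod 𝓘(ℝ, Fib m)) (⟨x₀, 0⟩ : TotalSpace (Fib m) E)

theorem totalChart_eq (x₀ : M) : totalChart (m := m) E x₀ =
    (trivializationAt (Fib m) E x₀).toPartialEquiv ≫
      (extChartAt (𝓡 (2 * m)) x₀).prod (PartialEquiv.refl (Fib m)) :=
  FiberBundle.extChartAt (IB := 𝓡 (2 * m)) (⟨x₀, 0⟩ : TotalSpace (Fib m) E)

theorem isOpen_totalChart_target (x₀ : M) : IsOpen (totalChart (m := m) E x₀).target :=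
  isOpen_extChartAt_target (I := (𝓡 (2 * m)).prod 𝓘(ℝ, Fib m)) (⟨x₀, 0⟩ : TotalSpace (Fib m) E)

theorem isOpen_totalChart_source (x₀ : M) : IsOpen (totalChart (m := m) E x₀).source :=
  isOpen_extChartAt_source (I := (𝓡 (2 * m)).prod 𝓘(ℝ, Fib m)) (⟨x₀, 0⟩ : TotalSpace (Fib m) E)

theorem continuousOn_totalChart (x₀ : M) :
    ContinuousOn (totalChart (m := m) E x₀) (totalChart (m := m) E x₀).source :=
  continuousOn_extChartAt (I := (𝓡 (2 * m)).prod 𝓘(ℝ, Fib m)) (⟨x₀, 0⟩ : TotalSpace (Fib m) E)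

theorem contMDiffOn_totalChart_symm (x₀ : M) :
    ContMDiffOn 𝓘(ℝ, Model m × Fib m) ((𝓡 (2 * m)).prod 𝓘(ℝ, Fib m)) ∞ (totalChart (m := m) E x₀).symm
      (totalChart (m := m) E x₀).target :=
  contMDiffOn_extChartAt_symm (I := (𝓡 (2 * m)).prod 𝓘(ℝ, Fib m))
    (⟨x₀, 0⟩ : TotalSpace (Fib m) E)

theorem totalChart_fst (x₀ : M) {z : TotalSpace (Fib m) E} (hz : z ∈ (totalChart (m := m) E x₀).source) :
    z.proj ∈ (extChartAt (𝓡 (2 * m)) x₀).source ∧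
      (totalChart (m := m) E x₀ z).1 = extChartAt (𝓡 (2 * m)) x₀ z.proj := by
  rw [totalChart_eq] at hz ⊢
  rw [PartialEquiv.trans_source] at hz
  have h1 : z ∈ (trivializationAt (Fib m) E x₀).source := hz.1
  have h2 : ((trivializationAt (Fib m) E x₀) z).1 = z.proj :=
    (trivializationAt (Fib m) E x₀).coe_fst h1
  have h3 : ((trivializationAt (Fib m) E x₀) z).1 ∈ (extChartAt (𝓡 (2 * m)) x₀).source := hz.2.1
  refine ⟨h2 ▸ h3, ?_⟩
  change extChartAt (𝓡 (2 * m)) x₀ ((trivializationAt (Fib m) E x₀) z).1 = _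
  rw [h2]

theorem totalChart_symm_proj (x₀ : M) {w : Model m × Fib m} (hw : w ∈ (totalChart (m := m) E x₀).target) :
    ((totalChart (m := m) E x₀).symm w).proj = (extChartAt (𝓡 (2 * m)) x₀).symm w.1 := by
  have h1 := totalChart_fst E x₀ ((totalChart (m := m) E x₀).map_target hw)
  rw [(totalChart (m := m) E x₀).right_inv hw] at h1
  rw [h1.2, (extChartAt (𝓡 (2 * m)) x₀).left_inv h1.1]

/-- The chart identifies the fiber over `x₀` with `ℝ^m` by the same trivialization as `fiberMap`, so
fiber derivatives can be read in this chart. -/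
theorem totalChart_fiber (x₀ : M) (v : Fib m) :
    (extChartAt (𝓡 (2 * m)) x₀ x₀, v) ∈ (totalChart (m := m) E x₀).target ∧
    (totalChart (m := m) E x₀).symm (extChartAt (𝓡 (2 * m)) x₀ x₀, v) =
      ⟨x₀, (trivializationAt (Fib m) E x₀).symm x₀ v⟩ := by
  have hx := mem_baseSet_trivializationAt (Fib m) E x₀
  constructor
  · have := FiberBundle.extChartAt_target (IB := 𝓡 (2 * m)) (⟨x₀, 0⟩ : TotalSpace (Fib m) E)
    change _ ∈ (extChartAt ((𝓡 (2 * m)).prod 𝓘(ℝ, Fib m)) (⟨x₀, 0⟩ : TotalSpace (Fib m) E)).target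
    rw [this]
    refine ⟨⟨mem_extChartAt_target x₀, ?_⟩, mem_univ _⟩
    rw [mem_preimage, extChartAt_to_inv]
    exact hx
  · rw [totalChart_eq, (trivializationAt (Fib m) E x₀).mk_symm hx]
    change (trivializationAt (Fib m) E x₀).toOpenPartialHomeomorph.symm
      ((extChartAt (𝓡 (2 * m)) x₀).symm (extChartAt (𝓡 (2 * m)) x₀ x₀), v) = _
    rw [extChartAt_to_inv]

theorem trivializationAt_symm_zero (x₀ : M) : (trivializationAt (Fib m) E x₀).symm x₀ 0 = 0 := by
  rw [← (trivializationAt (Fib m) E x₀).symmₗ_apply (R := ℝ)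
    (mem_baseSet_trivializationAt (Fib m) E x₀), map_zero]

theorem totalChart_zero (x₀ : M) :
    (⟨x₀, 0⟩ : TotalSpace (Fib m) E) ∈ (totalChart (m := m) E x₀).source ∧
      totalChart (m := m) E x₀ ⟨x₀, 0⟩ = (extChartAt (𝓡 (2 * m)) x₀ x₀, 0) := by
  have h0 : (trivializationAt (Fib m) E x₀).symm x₀ 0 = 0 := trivializationAt_symm_zero (m := m) E x₀
  obtain ⟨h1, h2⟩ := totalChart_fiber (m := m) E x₀ 0
  rw [h0] at h2
  refine ⟨h2 ▸ (totalChart (m := m) E x₀).map_target h1, ?_⟩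
  rw [← h2, (totalChart (m := m) E x₀).right_inv h1]

end TotalChart

/-! ### Existence of `W_Γ` and `V_Γ`. -/

section Existence

variable {m : ℕ} {M : Type*} [TopologicalSpace M] [ChartedSpace (Model m) M]
  [IsManifold (𝓡 (2 * m)) ∞ M]
  {E : M → Type*} [TopologicalSpace (TotalSpace (Fib m) E)] [∀ x, AddCommGroup (E x)]
  [∀ x, Module ℝ (E x)] [∀ x, TopologicalSpace (E x)] [FiberBundle (Fib m) E]
  [VectorBundle ℝ (Fib m) E] [ContMDiffVectorBundle ∞ (Fib m) E (𝓡 (2 * m))]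
  {E' : M → Type*} [TopologicalSpace (TotalSpace (Fib m) E')] [∀ x, AddCommGroup (E' x)]
  [∀ x, Module ℝ (E' x)] [∀ x, TopologicalSpace (E' x)] [FiberBundle (Fib m) E']
  [VectorBundle ℝ (Fib m) E'] [ContMDiffVectorBundle ∞ (Fib m) E' (𝓡 (2 * m))]
  {symp : ∀ x : M, TangentSpace (𝓡 (2 * m)) x [⋀^Fin 2]→L[ℝ] ℝ}
  {lam : TotalSpace (Fib m) E → M} {lam' : TotalSpace (Fib m) E' → M}

/-- The coordinate expression of a Lagrangian field around `0_{x₀}`. -/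
def localLam (lam : TotalSpace (Fib m) E → M) (x₀ : M) (w : Model m × Fib m) : Model m :=
  extChartAt (𝓡 (2 * m)) x₀ (lam ((totalChart (m := m) E x₀).symm w))

/-- The domain of `localLam`. -/
def localDom (lam : TotalSpace (Fib m) E → M) (x₀ : M) : Set (Model m × Fib m) :=
  (totalChart (m := m) E x₀).target ∩
    (fun w => lam ((totalChart (m := m) E x₀).symm w)) ⁻¹' (extChartAt (𝓡 (2 * m)) x₀).source

theorem IsLagrangianField.isOpen_localDom (h : IsLagrangianField E symp lam) (x₀ : M) :
    IsOpen (localDom lam x₀) :=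
  (h.contMDiff.continuous.comp_continuousOn
    (contMDiffOn_totalChart_symm (m := m) E x₀).continuousOn).isOpen_inter_preimage
      (isOpen_totalChart_target (m := m) E x₀) (isOpen_extChartAt_source x₀)

theorem IsLagrangianField.contDiffOn_localLam (h : IsLagrangianField E symp lam) (x₀ : M) :
    ContDiffOn ℝ ∞ (localLam lam x₀) (localDom lam x₀) := by
  intro w hw
  have h1 := (contMDiffOn_totalChart_symm (m := m) E x₀).contMDiffAt
    ((isOpen_totalChart_target (m := m) E x₀).mem_nhds hw.1)
  have h2 := (contMDiffAt_chart x₀ hw.2).comp w (h.contMDiff.contMDiffAt.comp w h1)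
  exact (contMDiffAt_iff_contDiffAt.1 h2).contDiffWithinAt

theorem IsLagrangianField.localLam_zero (h : IsLagrangianField E symp lam) (x₀ : M) :
    (extChartAt (𝓡 (2 * m)) x₀ x₀, 0) ∈ localDom lam x₀ ∧
      localLam lam x₀ (extChartAt (𝓡 (2 * m)) x₀ x₀, 0) = extChartAt (𝓡 (2 * m)) x₀ x₀ := by
  obtain ⟨h1, h2⟩ := totalChart_zero (m := m) E x₀
  have h3 : lam ((totalChart (m := m) E x₀).symm (extChartAt (𝓡 (2 * m)) x₀ x₀, 0)) = x₀ := by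
    rw [← h2, (totalChart (m := m) E x₀).left_inv h1, h.zero_section]
  refine ⟨⟨h2 ▸ (totalChart (m := m) E x₀).map_source h1, ?_⟩, by rw [localLam, h3]⟩
  rw [mem_preimage, h3]
  exact mem_extChartAt_source x₀

/-- The preferred chart has the identity as derivative at its center, so the fiber part of the
coordinate Jacobian is `vertDeriv`. This brings transversality into the implicit function theorem.
-/
theorem IsLagrangianField.fderiv_localLam (h : IsLagrangianField E symp lam) (x₀ : M) (v : Fib m) :
    fderiv ℝ (localLam lam x₀) (extChartAt (𝓡 (2 * m)) x₀ x₀, 0) (0, v) = vertDeriv lam x₀ v := by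
  have h1 := (hasFDerivAt_of_contDiffOn (h.isOpen_localDom x₀) (h.contDiffOn_localLam x₀)
    (h.localLam_zero x₀).1).comp (0 : Fib m)
      (hasFDerivAt_prodMk_right (extChartAt (𝓡 (2 * m)) x₀ x₀) (0 : Fib m))
  have hf0 : fiberMap lam x₀ 0 = x₀ := by
    rw [fiberMap, trivializationAt_symm_zero, h.zero_section]
  have h2 : HasMFDerivAt 𝓘(ℝ, Fib m) (𝓡 (2 * m)) (fiberMap lam x₀) 0 (vertDeriv lam x₀) :=
    ((h.embedding x₀).contMDiff.mdifferentiable (by simp) 0).hasMFDerivAt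
  have h3 : HasMFDerivAt (𝓡 (2 * m)) 𝓘(ℝ, Model m) (extChartAt (𝓡 (2 * m)) x₀)
      (fiberMap lam x₀ 0) (ContinuousLinearMap.id ℝ (Model m)) := by
    have h := ((contMDiffAt_chart (m := m) x₀ (mem_extChartAt_source (I := 𝓡 (2 * m)) x₀)).mdifferentiableAt
      (by simp)).hasMFDerivAt
    rw [mfderiv_extChartAt_self] at h
    rw [hf0]
    exact h
  have h4 := (h3.comp _ h2).hasFDerivAt
  have h5 : extChartAt (𝓡 (2 * m)) x₀ ∘ fiberMap lam x₀ =
      localLam lam x₀ ∘ Prod.mk (extChartAt (𝓡 (2 * m)) x₀ x₀) := by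
    funext v
    simp only [Function.comp_apply, localLam, (totalChart_fiber (m := m) E x₀ v).2, fiberMap]
  rw [h5] at h4
  exact congrArg (fun L : Fib m →L[ℝ] Model m => L v) (h1.unique h4)

/-- The implicit function theorem for `lam - lam'` in coordinates, solved for the two fiber
variables. `S` is the region where the solution is unique; the last clause, that `S` contains the
zero pairs over the diagonal of `P`, is what makes different local sections comparable. -/
theorem exists_local_section (hlam : IsLagrangianField E symp lam)
    (hlam' : IsLagrangianField E' symp lam') (htrans : Transversal lam lam') (x₀ : M) :
    ∃ (P : Set (M × M)) (S : Set (TotalSpace (Fib m) E × TotalSpace (Fib m) E'))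
      (σ : M × M → TotalSpace (Fib m) E × TotalSpace (Fib m) E'),
      IsOpen P ∧ (x₀, x₀) ∈ P ∧ IsOpen S ∧
      ContMDiffOn ((𝓡 (2 * m)).prod (𝓡 (2 * m)))
        (((𝓡 (2 * m)).prod 𝓘(ℝ, Fib m)).prod ((𝓡 (2 * m)).prod 𝓘(ℝ, Fib m))) ∞ σ P ∧
      (∀ p ∈ P, σ p ∈ S ∧ lam (σ p).1 = lam' (σ p).2 ∧ ((σ p).1.proj, (σ p).2.proj) = p) ∧
      (∀ q ∈ S, lam q.1 = lam' q.2 → σ (q.1.proj, q.2.proj) = q) ∧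
      ∀ x, (x, x) ∈ P → ((⟨x, 0⟩, ⟨x, 0⟩) : TotalSpace (Fib m) E × TotalSpace (Fib m) E') ∈ S := by
  let φ := extChartAt (𝓡 (2 * m)) x₀
  let κ := totalChart (m := m) E x₀
  let κ' := totalChart (m := m) E' x₀
  let G : (Model m × Model m) × (Fib m × Fib m) → Model m := fun q =>
    localLam lam x₀ (q.1.1, q.2.1) - localLam lam' x₀ (q.1.2, q.2.2)
  let c : (Model m × Model m) × (Fib m × Fib m) →L[ℝ] Model m × Fib m :=
    ((ContinuousLinearMap.fst ℝ _ _).comp (.fst ℝ _ _)).prod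
      ((ContinuousLinearMap.fst ℝ _ _).comp (.snd ℝ _ _))
  let c' : (Model m × Model m) × (Fib m × Fib m) →L[ℝ] Model m × Fib m :=
    ((ContinuousLinearMap.snd ℝ _ _).comp (.fst ℝ _ _)).prod
      ((ContinuousLinearMap.snd ℝ _ _).comp (.snd ℝ _ _))
  let O : Set ((Model m × Model m) × (Fib m × Fib m)) :=
    c ⁻¹' localDom lam x₀ ∩ c' ⁻¹' localDom lam' x₀
  have hO : IsOpen O := ((hlam.isOpen_localDom x₀).preimage c.continuous).inter
    ((hlam'.isOpen_localDom x₀).preimage c'.continuous)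
  have hG : ContDiffOn ℝ ∞ G O :=
    ((hlam.contDiffOn_localLam x₀).comp c.contDiff.contDiffOn fun q hq => hq.1).sub
      ((hlam'.contDiffOn_localLam x₀).comp c'.contDiff.contDiffOn fun q hq => hq.2)
  have h0 : ((φ x₀, φ x₀), ((0 : Fib m), (0 : Fib m))) ∈ O :=
    ⟨(hlam.localLam_zero x₀).1, (hlam'.localLam_zero x₀).1⟩
  have hG0 : G ((φ x₀, φ x₀), (0, 0)) = 0 := by
    simp only [G, φ, (hlam.localLam_zero x₀).2, (hlam'.localLam_zero x₀).2, sub_self]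
  have hGd : ∀ v v', fderiv ℝ G ((φ x₀, φ x₀), (0, 0)) (0, (v, v')) =
      vertDeriv lam x₀ v - vertDeriv lam' x₀ v' := by
    intro v v'
    have d1 := (hasFDerivAt_of_contDiffOn (hlam.isOpen_localDom x₀) (hlam.contDiffOn_localLam x₀)
      (hlam.localLam_zero x₀).1).comp (f := c) ((φ x₀, φ x₀), ((0 : Fib m), (0 : Fib m)))
        c.hasFDerivAt
    have d2 := (hasFDerivAt_of_contDiffOn (hlam'.isOpen_localDom x₀)
      (hlam'.contDiffOn_localLam x₀) (hlam'.localLam_zero x₀).1).comp (f := c')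
        ((φ x₀, φ x₀), ((0 : Fib m), (0 : Fib m))) c'.hasFDerivAt
    rw [← hlam.fderiv_localLam x₀, ← hlam'.fderiv_localLam x₀]
    exact congrArg (fun L => L ((0, (v, v')) : (Model m × Model m) × (Fib m × Fib m)))
      (d1.sub d2).fderiv
  -- The derivative is `(v, v') ↦ vertDeriv lam x₀ v - vertDeriv lam' x₀ v'`. It is onto by
  -- transversality, and injective because both sides have dimension `2m`.
  have hinv : ((fderiv ℝ G ((φ x₀, φ x₀), (0, 0))).comp
      (.inr ℝ (Model m × Model m) (Fib m × Fib m))).IsInvertible := by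
    let L := (fderiv ℝ G ((φ x₀, φ x₀), (0, 0))).comp
      (.inr ℝ (Model m × Model m) (Fib m × Fib m))
    have hsurj : Function.Surjective L := by
      intro y
      have hy : y ∈ (vertDeriv lam x₀).range ⊔ (vertDeriv lam' x₀).range := by
        rw [htrans x₀]; trivial
      obtain ⟨_, ⟨v, rfl⟩, _, ⟨v', rfl⟩, rfl⟩ := Submodule.mem_sup.1 hy
      refine ⟨(v, -v'), (hGd v (-v')).trans ?_⟩
      rw [map_neg, sub_neg_eq_add]
      rfl
    have hdim : Module.finrank ℝ (Fib m × Fib m) = Module.finrank ℝ (Model m) := by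
      simp [two_mul]
    have hinj : Function.Injective L :=
      (LinearMap.injective_iff_surjective_of_finrank_eq_finrank (f := L.toLinearMap) hdim).2 hsurj
    exact ⟨(LinearEquiv.ofBijective L.toLinearMap ⟨hinj, hsurj⟩).toContinuousLinearEquiv, 
      ContinuousLinearMap.ext fun v => rfl⟩
  obtain ⟨Q, R, h, hQ, hQ0, hR, hR0, hh, hQR, hmaps, hiff⟩ :=
    exists_implicitFunction hO hG h0 hG0 hinv
  let S : Set (TotalSpace (Fib m) E × TotalSpace (Fib m) E') :=
    (κ.source ×ˢ κ'.source) ∩ (fun q => (((κ q.1).1, (κ' q.2).1), ((κ q.1).2, (κ' q.2).2))) ⁻¹'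
      (Q ×ˢ R)
  have hS : IsOpen S := by
    have e1 : ContinuousOn (fun q : TotalSpace (Fib m) E × TotalSpace (Fib m) E' => κ q.1)
        (κ.source ×ˢ κ'.source) :=
      (continuousOn_totalChart (m := m) E x₀).comp continuousOn_fst fun q hq => hq.1
    have e2 : ContinuousOn (fun q : TotalSpace (Fib m) E × TotalSpace (Fib m) E' => κ' q.2)
        (κ.source ×ˢ κ'.source) :=
      (continuousOn_totalChart (m := m) E' x₀).comp continuousOn_snd fun q hq => hq.2
    exact ((e1.fst.prodMk e2.fst).prodMk (e1.snd.prodMk e2.snd)).isOpen_inter_preimage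
      ((isOpen_totalChart_source (m := m) E x₀).prod (isOpen_totalChart_source (m := m) E' x₀)) (hQ.prod hR)
  let Z : M → TotalSpace (Fib m) E × TotalSpace (Fib m) E' := fun x => (⟨x, 0⟩, ⟨x, 0⟩)
  have hZ : Continuous Z :=
    ((contMDiff_zeroSection (n := ∞) (IB := 𝓡 (2 * m)) ℝ E).continuous).prodMk
      ((contMDiff_zeroSection (n := ∞) (IB := 𝓡 (2 * m)) ℝ E').continuous)
  have hZ0 : Z x₀ ∈ S := by
    refine ⟨⟨(totalChart_zero (m := m) E x₀).1, (totalChart_zero (m := m) E' x₀).1⟩, ?_⟩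
    simp only [mem_preimage, Z, κ, κ', (totalChart_zero (m := m) E x₀).2, (totalChart_zero (m := m) E' x₀).2]
    exact ⟨hQ0, hR0⟩
  let ψ : M × M → Model m × Model m := fun p => (φ p.1, φ p.2)
  -- The last intersection shrinks the domain so that the zero pairs over its diagonal lie in `S`.
  let P : Set (M × M) := ((φ.source ×ˢ φ.source) ∩ ψ ⁻¹' Q) ∩ (Z ∘ Prod.fst) ⁻¹' S
  have hψ : ContinuousOn ψ (φ.source ×ˢ φ.source) :=
    ((continuousOn_extChartAt x₀).comp continuousOn_fst fun q hq => hq.1).prodMk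
      ((continuousOn_extChartAt x₀).comp continuousOn_snd fun q hq => hq.2)
  have hP : IsOpen P := (hψ.isOpen_inter_preimage
    ((isOpen_extChartAt_source x₀).prod (isOpen_extChartAt_source x₀)) hQ).inter
      (hS.preimage (hZ.comp continuous_fst))
  have hdom : ∀ p ∈ P, (φ p.1, (h (ψ p)).1) ∈ localDom lam x₀ ∧
      (φ p.2, (h (ψ p)).2) ∈ localDom lam' x₀ := by
    intro p hp
    have := hQR (show (ψ p, h (ψ p)) ∈ Q ×ˢ R from ⟨hp.1.2, hmaps hp.1.2⟩)
    exact ⟨this.1, this.2⟩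
  let σ : M × M → TotalSpace (Fib m) E × TotalSpace (Fib m) E' := fun p =>
    (κ.symm (φ p.1, (h (ψ p)).1), κ'.symm (φ p.2, (h (ψ p)).2))
  refine ⟨P, S, σ, hP, ⟨⟨⟨mem_extChartAt_source x₀, mem_extChartAt_source x₀⟩, hQ0⟩, hZ0⟩, hS,
    ?_, ?_, ?_, ?_⟩
  · intro p hp
    have e1 : ContMDiffAt ((𝓡 (2 * m)).prod (𝓡 (2 * m))) 𝓘(ℝ, Model m) ∞
        (fun p : M × M => φ p.1) p := (contMDiffAt_chart x₀ hp.1.1.1).comp p contMDiffAt_fst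
    have e2 : ContMDiffAt ((𝓡 (2 * m)).prod (𝓡 (2 * m))) 𝓘(ℝ, Model m) ∞
        (fun p : M × M => φ p.2) p := (contMDiffAt_chart x₀ hp.1.1.2).comp p contMDiffAt_snd
    have e3 : ContMDiffAt ((𝓡 (2 * m)).prod (𝓡 (2 * m))) 𝓘(ℝ, Fib m × Fib m) ∞
        (fun p : M × M => h (ψ p)) p :=
      (hh.contDiffAt (hQ.mem_nhds hp.1.2)).contMDiffAt.comp p (e1.prodMk_space e2)
    have e4 := ((contMDiffOn_totalChart_symm (m := m) E x₀).contMDiffAt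
      ((isOpen_totalChart_target (m := m) E x₀).mem_nhds (hdom p hp).1.1)).comp p
        (e1.prodMk_space (contDiff_fst.contMDiff.contMDiffAt.comp p e3))
    have e5 := ((contMDiffOn_totalChart_symm (m := m) E' x₀).contMDiffAt
      ((isOpen_totalChart_target (m := m) E' x₀).mem_nhds (hdom p hp).2.1)).comp p
        (e2.prodMk_space (contDiff_snd.contMDiff.contMDiffAt.comp p e3))
    exact (e4.prodMk e5).contMDiffWithinAt
  · intro p hp
    obtain ⟨d1, d2⟩ := hdom p hp
    have r1 := κ.right_inv d1.1
    have r2 := κ'.right_inv d2.1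
    refine ⟨⟨⟨κ.map_target d1.1, κ'.map_target d2.1⟩, ?_⟩, ?_, ?_⟩
    · simp only [mem_preimage, σ, r1, r2]
      exact ⟨hp.1.2, hmaps hp.1.2⟩
    · have := (hiff (ψ p) hp.1.2 (h (ψ p)) (hmaps hp.1.2)).2 rfl
      exact φ.injOn d1.2 d2.2 (sub_eq_zero.1 this)
    · refine Prod.ext ?_ ?_
      · exact (totalChart_symm_proj E x₀ d1.1).trans (φ.left_inv hp.1.1.1)
      · exact (totalChart_symm_proj E' x₀ d2.1).trans (φ.left_inv hp.1.1.2)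
  · rintro ⟨z, z'⟩ ⟨⟨hz, hz'⟩, hq⟩ hΓ
    have f1 := totalChart_fst E x₀ hz
    have f2 := totalChart_fst E' x₀ hz'
    have hG1 : G (((κ z).1, (κ' z').1), ((κ z).2, (κ' z').2)) = 0 := by
      simp only [G, localLam, Prod.mk.eta]
      erw [κ.left_inv hz, κ'.left_inv hz']
      rw [show lam z = lam' z' from hΓ, sub_self]
    have hh1 := (hiff _ hq.1 _ hq.2).1 hG1
    have hψ1 : ψ (z.proj, z'.proj) = ((κ z).1, (κ' z').1) := Prod.ext f1.2.symm f2.2.symm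
    simp only [σ]
    rw [hψ1, ← hh1]
    refine Prod.ext ?_ ?_
    · change κ.symm (φ z.proj, (κ z).2) = z
      rw [show (φ z.proj, (κ z).2) = κ z from Prod.ext f1.2.symm rfl, κ.left_inv hz]
    · change κ'.symm (φ z'.proj, (κ' z').2) = z'
      rw [show (φ z'.proj, (κ' z').2) = κ' z' from Prod.ext f2.2.symm rfl, κ'.left_inv hz']
  · intro x hx
    exact hx.2

theorem nonempty_intersectionData [T2Space M] [SecondCountableTopology M]
    (hlam : IsLagrangianField E symp lam)
    (hlam' : IsLagrangianField E' symp lam') (htrans : Transversal lam lam') :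
    Nonempty (IntersectionData lam lam') := by
  -- The gluing lemma needs a nonempty target.
  rcases isEmpty_or_nonempty M with hM | ⟨⟨x₁⟩⟩
  · exact ⟨{
      W := ∅
      V := ∅
      inv := fun p => isEmptyElim p.1
      isOpen_W := ⟨∅, isOpen_empty, by simp⟩
      zero_mem := fun x => isEmptyElim x
      isOpen_V := isOpen_empty
      diag_mem := fun x => isEmptyElim x
      proj_mem := fun q hq => hq.elim
      inv_mem := fun p hp => hp.elim
      inv_proj := fun q hq => hq.elim
      proj_inv := fun p hp => hp.elim
      smooth_inv := fun p hp => hp.elim }⟩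
  have : LocallyCompactSpace M := ChartedSpace.locallyCompactSpace (Model m) M
  have : Nonempty (TotalSpace (Fib m) E × TotalSpace (Fib m) E') := ⟨(⟨x₁, 0⟩, ⟨x₁, 0⟩)⟩
  choose P S σ hP hxP hS hσs hσ hσu hZS using exists_local_section hlam hlam' htrans
  have hσ0 : ∀ i x, (x, x) ∈ P i → σ i (x, x) = (⟨x, 0⟩, ⟨x, 0⟩) := by
    intro i x hx
    refine hσu i (⟨x, 0⟩, ⟨x, 0⟩) (hZS i x hx) ?_
    exact (hlam.zero_section x).trans (hlam'.zero_section x).symm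
  obtain ⟨g, V, hV, hAV, hg⟩ := exists_glue (f := σ) (isClosed_diagonal (X := M)) hP
    (by
      rintro ⟨x, y⟩ (rfl : x = y)
      exact mem_iUnion.2 ⟨x, hxP x⟩) (by
    rintro i j ⟨x, y⟩ (rfl : x = y) hi hj
    have hc : ContinuousAt (σ j) (x, x) :=
      ((hσs j).contMDiffAt ((hP j).mem_nhds hj)).continuousAt
    -- On the diagonal `σ j` is the zero pair, which lies in `S i`. So nearby values of `σ j` lie in
    -- the uniqueness region of `σ i`, and the two sections coincide.
    have hm : σ j (x, x) ∈ S i := by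
      rw [hσ0 j x hj]
      exact hZS i x hi
    filter_upwards [(hP j).mem_nhds hj, hc.eventually ((hS i).mem_nhds hm)] with p hpj hpS
    have h1 := hσu i (σ j p) hpS (hσ j p hpj).2.1
    rwa [(hσ j p hpj).2.2] at h1)
  have hgV : ∀ p ∈ V, lam (g p).1 = lam' (g p).2 ∧ ((g p).1.proj, (g p).2.proj) = p := by
    intro p hp
    obtain ⟨i, hi, hgi⟩ := hg p hp
    rw [hgi.self_of_nhds]
    exact (hσ i p hi).2
  let Γ : Set (TotalSpace (Fib m) E × TotalSpace (Fib m) E') := {q | lam q.1 = lam' q.2}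
  let π₂ : TotalSpace (Fib m) E × TotalSpace (Fib m) E' → M × M := fun q => (q.1.proj, q.2.proj)
  have hπ : Continuous π₂ :=
    ((FiberBundle.continuous_proj (Fib m) E).comp continuous_fst).prodMk
      ((FiberBundle.continuous_proj (Fib m) E').comp continuous_snd)
  -- `W` is the image of `V` under the glued section.
  let W : Set (TotalSpace (Fib m) E × TotalSpace (Fib m) E') :=
    {q | q ∈ Γ ∧ π₂ q ∈ V ∧ g (π₂ q) = q}
  refine ⟨{
    W := W
    V := V
    inv := g
    isOpen_W := ⟨interior {q | q ∈ Γ → q ∈ W}, isOpen_interior, ?_⟩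
    zero_mem := fun x => ?_
    isOpen_V := hV
    diag_mem := fun x => hAV rfl
    proj_mem := fun q hq => hq.2.1
    inv_mem := fun p hp => ?_
    inv_proj := fun q hq => hq.2.2
    proj_inv := fun p hp => (hgV p hp).2
    smooth_inv := fun p hp => ?_ }⟩
  · refine Subset.antisymm (fun q hq => ⟨?_, hq.1⟩) fun q hq => interior_subset hq.1 hq.2
    rw [mem_interior_iff_mem_nhds]
    obtain ⟨i, hi, hgi⟩ := hg (π₂ q) hq.2.1
    have hqS : q ∈ S i := by
      have := (hσ i _ hi).1
      rwa [← hgi.self_of_nhds, hq.2.2] at this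
    -- Openness of `W` in `Γ`: a point of `Γ` in `S i` is recovered from its projection by `σ i`,
    -- which is `g` near `π₂ q`.
    filter_upwards [(hS i).mem_nhds hqS, hπ.continuousAt.eventually (hV.mem_nhds hq.2.1),
      hπ.continuousAt.eventually hgi] with q' h1 h2 h3 h4
    exact ⟨h4, h2, h3.trans (hσu i q' h1 h4)⟩
  · have hx : (x, x) ∈ V := hAV rfl
    refine ⟨(hlam.zero_section x).trans (hlam'.zero_section x).symm, hx, ?_⟩
    obtain ⟨i, hi, hgi⟩ := hg (x, x) hx
    exact hgi.self_of_nhds.trans (hσ0 i x hi)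
  · obtain ⟨h1, h2⟩ := hgV p hp
    refine ⟨h1, ?_, ?_⟩
    · change ((g p).1.proj, (g p).2.proj) ∈ V
      rwa [h2]
    · change g ((g p).1.proj, (g p).2.proj) = g p
      rw [h2]
  · obtain ⟨i, hi, hgi⟩ := hg p hp
    exact (((hσs i).contMDiffAt ((hP i).mem_nhds hi)).congr_of_eventuallyEq
      hgi).contMDiffWithinAt

end Existence

/-! ### The critical point of the Calabi function in a vector space. -/

section Critical

variable {X : Type} [NormedAddCommGroup X] [NormedSpace ℝ X]

/-- The function is constant only for parameters in `[0, 1]`; uniqueness of one-sided derivatives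
there covers the endpoints as well. -/
theorem fderiv_fst_eq_zero_of_const {Y : Type} [NormedAddCommGroup Y] [NormedSpace ℝ Y]
    {G : X × X → Y} {s : ℝ → X} {s' y : X} {t : ℝ} {k : Y} (ht : t ∈ Icc (0 : ℝ) 1)
    (hG : DifferentiableAt ℝ G (s t, y)) (hs : HasDerivAt s s' t)
    (hk : ∀ t ∈ Icc (0 : ℝ) 1, G (s t, y) = k) : fderiv ℝ G (s t, y) (s', 0) = 0 :=
  (uniqueDiffOn_Icc zero_lt_one t ht).eq_deriv _
    ((hG.hasFDerivAt.comp_hasDerivAt (f := fun t => (s t, y)) t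
      (hs.prodMk (hasDerivAt_const t y))).hasDerivWithinAt)
    ((hasDerivWithinAt_const t _ k).congr (fun t ht => hk t ht) (hk t ht))

theorem fderiv_snd_eq_zero_of_const {Y : Type} [NormedAddCommGroup Y] [NormedSpace ℝ Y]
    {G : X × X → Y} {r : ℝ → X} {r' x : X} {t : ℝ} {k : Y} (ht : t ∈ Icc (0 : ℝ) 1)
    (hG : DifferentiableAt ℝ G (x, r t)) (hr : HasDerivAt r r' t)
    (hk : ∀ t ∈ Icc (0 : ℝ) 1, G (x, r t) = k) : fderiv ℝ G (x, r t) (0, r') = 0 :=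
  (uniqueDiffOn_Icc zero_lt_one t ht).eq_deriv _
    ((hG.hasFDerivAt.comp_hasDerivAt (f := fun t => (x, r t)) t
      ((hasDerivAt_const t x).prodMk hr)).hasDerivWithinAt)
    ((hasDerivWithinAt_const t _ k).congr (fun t ht => hk t ht) (hk t ht))

/-- Put `x = s 1`, `y = r 1` and `u = s 0 = r 0`. The value of `T` is the alternating sum of `Φ`
over the corners of the rectangle spanned by `s` and `r`. In the derivative, `∂_yΦ` at `(x, u)`
cancels against `(u, u)` along `s`, and `∂_xΦ` at `(u, y)` against `(u, u)` along `r`. -/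
theorem calabi_critical {Φ : X × X → ℝ} {O : Set (X × X)} (hO : IsOpen O)
    (hΦ : ContDiffOn ℝ ∞ Φ O) {s s' r r' : ℝ → X}
    (hs : ∀ t ∈ Icc (0 : ℝ) 1, HasDerivAt s (s' t) t)
    (hr : ∀ t ∈ Icc (0 : ℝ) 1, HasDerivAt r (r' t) t)
    (hO' : ∀ t ∈ Icc (0 : ℝ) 1, ∀ τ ∈ Icc (0 : ℝ) 1, (s t, r τ) ∈ O) (hsr : s 0 = r 0)
    (h₁ : ∀ t ∈ Icc (0 : ℝ) 1, ∀ τ ∈ Icc (0 : ℝ) 1, ∀ w,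
      fderiv ℝ (fderiv ℝ Φ) (s t, r τ) (s' t, 0) (0, w) = 0)
    (h₂ : ∀ t ∈ Icc (0 : ℝ) 1, ∀ τ ∈ Icc (0 : ℝ) 1, ∀ w,
      fderiv ℝ (fderiv ℝ Φ) (s t, r τ) (w, 0) (0, r' τ) = 0) :
    calabi Φ (s 1, r 0, r 1) = 0 ∧ fderiv ℝ (fun u => calabi Φ (s 1, u, r 1)) (r 0) = 0 := by
  have i0 : (0 : ℝ) ∈ Icc (0 : ℝ) 1 := by simp
  have i1 : (1 : ℝ) ∈ Icc (0 : ℝ) 1 := by simp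
  constructor
  · have h := rectangle_eq_zero_of_mixed_eq_zero hO hΦ hs hr hO' fun t ht τ hτ => h₁ t ht τ hτ _
    rw [hsr] at h
    simp only [calabi]
    linarith
  · have m1 := hO' 1 i1 0 i0
    have m2 := hO' 0 i0 0 i0
    have m3 := hO' 0 i0 1 i1
    rw [hsr] at m2 m3
    rw [(hasFDerivAt_calabi hO hΦ m1 m2 m3).fderiv]
    ext w
    have e1 := fderiv_snd_eq_of_mixed_eq_zero hO hΦ hs (fun t ht => hO' t ht 0 i0)
      fun t ht => h₁ t ht 0 i0 w
    have e2 := fderiv_fst_eq_of_mixed_eq_zero hO hΦ hr (fun t ht => hO' 0 i0 t ht)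
      fun t ht => h₂ 0 i0 t ht w
    rw [hsr] at e1 e2
    have e3 : fderiv ℝ Φ (r 0, r 0) (w, w) =
        fderiv ℝ Φ (r 0, r 0) (w, 0) + fderiv ℝ Φ (r 0, r 0) (0, w) := by
      rw [← map_add]; simp
    simp only [add_apply, sub_apply,
      ContinuousLinearMap.comp_apply, ContinuousLinearMap.inr_apply, ContinuousLinearMap.inl_apply,
      ContinuousLinearMap.prod_apply, ContinuousLinearMap.id_apply, zero_apply]
    linarith

theorem contDiffOn_calabi {Φ : X × X → ℝ} {B : Set X} (hΦ : ContDiffOn ℝ ∞ Φ (B ×ˢ B)) :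
    ContDiffOn ℝ ∞ (calabi Φ) (B ×ˢ B ×ˢ B) := by
  have h : ∀ {f g : X × X × X → X}, ContDiff ℝ ∞ f → ContDiff ℝ ∞ g →
      (∀ q ∈ B ×ˢ B ×ˢ B, f q ∈ B ∧ g q ∈ B) →
      ContDiffOn ℝ ∞ (fun q => Φ (f q, g q)) (B ×ˢ B ×ˢ B) :=
    fun hf hg hm => hΦ.comp (hf.prodMk hg).contDiffOn hm
  exact (((h (by fun_prop) (by fun_prop) fun q hq => ⟨hq.1, hq.2.1⟩).sub
    (h (by fun_prop) (by fun_prop) fun q hq => ⟨hq.2.1, hq.2.1⟩)).add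
    (h (by fun_prop) (by fun_prop) fun q hq => ⟨hq.2.1, hq.2.2⟩)).sub
    (h (by fun_prop) (by fun_prop) fun q hq => ⟨hq.1, hq.2.2⟩)

/-- Nondegeneracy of the second derivative in the middle variable is an open condition. -/
theorem eventually_nondegenerate [FiniteDimensional ℝ X] {F : X × X × X → ℝ} {O : Set (X × X × X)}
    (hO : IsOpen O) (hF : ContDiffOn ℝ ∞ F O) {q₀ : X × X × X} (hq₀ : q₀ ∈ O)
    (h : ∀ v, (∀ w, fderiv ℝ (fderiv ℝ fun u => F (q₀.1, u, q₀.2.2)) q₀.2.1 v w = 0) → v = 0) :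
    ∀ᶠ q in 𝓝 q₀, ∀ v,
      (∀ w, fderiv ℝ (fderiv ℝ fun u => F (q.1, u, q.2.2)) q.2.1 v w = 0) → v = 0 := by
  -- `J` is the inclusion of the middle variable, and `H` is the block of the full second derivative
  -- in that variable; `H` is continuous in all three variables, and injectivity of a linear map is
  -- an open condition.
  let J : X →L[ℝ] X × X × X := (ContinuousLinearMap.inr ℝ X (X × X)).comp (.inl ℝ X X)
  let H : X × X × X → X →L[ℝ] X →L[ℝ] ℝ := fun q =>
    (((fderiv ℝ (fderiv ℝ F) q).comp J).flip.comp J).flip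
  have hH : ∀ q ∈ O, fderiv ℝ (fderiv ℝ fun u => F (q.1, u, q.2.2)) q.2.1 = H q := by
    intro q hq
    refine (fderiv_fderiv_comp_affine hO hF (g := fun u => (q.1, u, q.2.2)) (L := J) (fun u => ?_)
      hq).fderiv
    exact (hasFDerivAt_prodMk_right q.1 (u, q.2.2)).comp u (hasFDerivAt_prodMk_left u q.2.2)
  have hcont : ContinuousAt H q₀ := by
    have h1 : ContinuousAt (fderiv ℝ (fderiv ℝ F)) q₀ :=
      (((hF.fderiv_of_isOpen (m := ∞) hO (by simp)).fderiv_of_isOpen (m := ∞) hO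
        (by simp)).continuousOn).continuousAt (hO.mem_nhds hq₀)
    have h2 := h1.clm_comp (continuousAt_const (y := J))
    have h3 := ((ContinuousLinearMap.flipₗᵢ ℝ X (X × X × X) ℝ).continuous.continuousAt.comp
      h2).clm_comp (continuousAt_const (y := J))
    exact (ContinuousLinearMap.flipₗᵢ ℝ X X ℝ).continuous.continuousAt.comp h3
  have hinj : ∀ L : X →L[ℝ] X →L[ℝ] ℝ,
      Function.Injective L ↔ ∀ v, (∀ w, L v w = 0) → v = 0 := fun L => by
    rw [injective_iff_map_eq_zero]
    exact forall_congr' fun v => by rw [ContinuousLinearMap.ext_iff]; rfl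
  rw [hH q₀ hq₀, ← hinj] at h
  filter_upwards [hO.mem_nhds hq₀,
    hcont.eventually (ContinuousLinearMap.isOpen_injective.mem_nhds h)] with q hq hq'
  rw [hH q hq, ← hinj]
  exact hq'

end Critical

/-! ### Hessians at critical points under change of chart. -/

section Hessian

variable {m : ℕ} {M : Type*} [TopologicalSpace M] [ChartedSpace (Model m) M]
  [IsManifold (𝓡 (2 * m)) ∞ M]

/-- The Hessian at a critical point read in the preferred chart at `x₀`. -/
theorem hessianAt_of_critical (x₀ : M) {p : M} (hp : p ∈ (extChartAt (𝓡 (2 * m)) x₀).source)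
    {f : M → ℝ} {k : Model m → ℝ} {B : Set (Model m)} (hB : IsOpen B) (hk : ContDiffOn ℝ ∞ k B)
    (hpB : extChartAt (𝓡 (2 * m)) x₀ p ∈ B)
    (hf : f =ᶠ[𝓝 p] k ∘ extChartAt (𝓡 (2 * m)) x₀)
    (hcrit : fderiv ℝ k (extChartAt (𝓡 (2 * m)) x₀ p) = 0) (v w : Model m) :
    hessianAt (m := m) f p v w = fderiv ℝ (fderiv ℝ k) (extChartAt (𝓡 (2 * m)) x₀ p)
      (mfderiv (𝓡 (2 * m)) 𝓘(ℝ, Model m) (extChartAt (𝓡 (2 * m)) x₀) p v)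
      (mfderiv (𝓡 (2 * m)) 𝓘(ℝ, Model m) (extChartAt (𝓡 (2 * m)) x₀) p w) := by
  let φ := extChartAt (𝓡 (2 * m)) x₀
  let ψ := extChartAt (𝓡 (2 * m)) p
  have hψ : ψ.symm (ψ p) = p := extChartAt_to_inv p
  have hψT : ψ p ∈ ψ.target := mem_extChartAt_target p
  let W : Set (Model m) := ψ.target ∩ ψ.symm ⁻¹' φ.source
  have hW : IsOpen W := (continuousOn_extChartAt_symm p).isOpen_inter_preimage (isOpen_target p)
    (isOpen_extChartAt_source x₀)
  have heW : ψ p ∈ W := ⟨hψT, by rw [mem_preimage, hψ]; exact hp⟩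
  let τ : Model m → Model m := φ ∘ ψ.symm
  have hτm : ∀ e ∈ W, ContMDiffAt 𝓘(ℝ, Model m) 𝓘(ℝ, Model m) ∞ τ e := fun e he =>
    (contMDiffAt_chart x₀ he.2).comp e (contMDiffAt_chart_symm p he.1)
  have hτ : ContDiffOn ℝ ∞ τ W := fun e he =>
    (contMDiffAt_iff_contDiffAt.1 (hτm e he)).contDiffWithinAt
  have hτp : τ (ψ p) = φ p := congrArg φ hψ
  have hc : ContinuousAt ψ.symm (ψ p) := (contMDiffAt_chart_symm p hψT).continuousAt
  have hev : f ∘ ψ.symm =ᶠ[𝓝 (ψ p)] k ∘ τ := by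
    have : Filter.Tendsto ψ.symm (𝓝 (ψ p)) (𝓝 p) := by
      have h := hc.tendsto
      rwa [hψ] at h
    exact this.eventually hf
  let J : Model m →L[ℝ] Model m := mfderiv (𝓡 (2 * m)) 𝓘(ℝ, Model m) φ p
  have hd : ∀ v : Model m, fderiv ℝ τ (ψ p) v = J v := by
    intro v
    have h1 : HasMFDerivAt (𝓡 (2 * m)) 𝓘(ℝ, Model m) φ (ψ.symm (ψ p)) J := by
      rw [hψ]
      exact ((contMDiffAt_chart x₀ hp).mdifferentiableAt (by simp)).hasMFDerivAt
    have h2 : HasFDerivAt τ (J.comp (chartDeriv p (ψ p))) (ψ p) :=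
      (h1.comp (ψ p) (hasMFDerivAt_chart_symm p hψT)).hasFDerivAt
    refine (congrArg (fun L : Model m →L[ℝ] Model m => L v) h2.fderiv).trans ?_
    exact congrArg J (chartDeriv_self p v)
  change fderiv ℝ (fderiv ℝ (f ∘ ψ.symm)) (ψ p) v w = fderiv ℝ (fderiv ℝ k) (φ p) (J v) (J w)
  rw [hev.fderiv.fderiv_eq, fderiv_fderiv_comp_of_critical hB hk hW hτ heW (hτp ▸ hpB)
    (hτp ▸ hcrit), hd, hd, hτp]

/-- The derivative `J` of the chart is invertible with inverse `chartDeriv`, and at a critical point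
the two Hessians correspond under `J`. -/
theorem isNondegenerateCriticalPoint_of_chart (x₀ : M) {p : M}
    (hp : p ∈ (extChartAt (𝓡 (2 * m)) x₀).source)
    {f : M → ℝ} {k : Model m → ℝ} {B : Set (Model m)} (hB : IsOpen B) (hk : ContDiffOn ℝ ∞ k B)
    (hpB : extChartAt (𝓡 (2 * m)) x₀ p ∈ B)
    (hf : f =ᶠ[𝓝 p] k ∘ extChartAt (𝓡 (2 * m)) x₀)
    (hcrit : fderiv ℝ k (extChartAt (𝓡 (2 * m)) x₀ p) = 0)
    (hnd : ∀ v, (∀ w, fderiv ℝ (fderiv ℝ k) (extChartAt (𝓡 (2 * m)) x₀ p) v w = 0) → v = 0) :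
    IsNondegenerateCriticalPoint (m := m) f p := by
  let φ := extChartAt (𝓡 (2 * m)) x₀
  have hφ := contMDiffAt_chart x₀ hp
  have hpT : φ p ∈ φ.target := φ.map_source hp
  let J : Model m →L[ℝ] Model m := mfderiv (𝓡 (2 * m)) 𝓘(ℝ, Model m) φ p
  have hJ : ∀ v, J (chartDeriv x₀ (φ p) v) = v := fun v => by
    have := chart_comp_chartDeriv x₀ hpT v
    rwa [φ.left_inv hp] at this
  have hJ' : ∀ v, chartDeriv x₀ (φ p) (J v) = v := fun v => by
    have := chartDeriv_comp_chart x₀ hpT v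
    rwa [φ.left_inv hp] at this
  refine ⟨?_, ?_, fun v hv => ?_⟩
  · exact ((hk.contDiffAt (hB.mem_nhds hpB)).contMDiffAt.comp p hφ).congr_of_eventuallyEq hf
  · have h1 := ((hasFDerivAt_of_contDiffOn hB hk hpB).hasMFDerivAt.comp p
      (hφ.mdifferentiableAt (by simp)).hasMFDerivAt).congr_of_eventuallyEq hf
    rw [h1.mfderiv, hcrit]
    exact ContinuousLinearMap.zero_comp J
  · have h1 : J v = 0 := hnd _ fun w => by
      have := (hessianAt_of_critical x₀ hp hB hk hpB hf hcrit v
        (chartDeriv x₀ (φ p) w)).symm.trans (hv (chartDeriv x₀ (φ p) w))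
      rwa [← hJ w]
    exact (hJ' v).symm.trans ((congrArg _ h1).trans (map_zero _))

end Hessian

/-! ### Coordinate form of a given Calabi function. -/

section LocalCalabi

variable {m : ℕ} {M : Type*} [TopologicalSpace M] [ChartedSpace (Model m) M]
  [IsManifold (𝓡 (2 * m)) ∞ M]
  {symp : ∀ x : M, TangentSpace (𝓡 (2 * m)) x [⋀^Fin 2]→L[ℝ] ℝ}
  {g : M × M → M} {V : Set (M × M)} {WT : Set (M × M × M)} {T : M × M × M → ℝ}

/-- A 3-point Calabi function is given by a potential in a chart ball around each point. -/
theorem IsCalabiFunction.exists_chart (hT : IsCalabiFunction (pullbackForm symp g) V WT T)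
    (hV : IsOpen V)
    (hg : ∀ p ∈ V, ContMDiffAt ((𝓡 (2 * m)).prod (𝓡 (2 * m))) (𝓡 (2 * m)) ∞ g p) {x₀ : M}
    (hx₀ : (x₀, x₀) ∈ V) (hgx : g (x₀, x₀) = x₀) :
    ∃ (B : Set (Model m)) (Φ : M × M → ℝ), IsOpen B ∧ extChartAt (𝓡 (2 * m)) x₀ x₀ ∈ B ∧
      B ⊆ (extChartAt (𝓡 (2 * m)) x₀).target ∧ x₀ ∈ chartSet x₀ B ∧
      chartSet x₀ B ×ˢ chartSet x₀ B ⊆ V ∧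
      chartSet x₀ B ×ˢ chartSet x₀ B ×ˢ chartSet x₀ B ⊆ WT ∧ ChartAdapted x₀ B g ∧
      IsPotential (pullbackForm symp g) (chartSet x₀ B ×ˢ chartSet x₀ B) Φ ∧
      ∀ x ∈ chartSet x₀ B, ∀ u ∈ chartSet x₀ B, ∀ y ∈ chartSet x₀ B,
        T (x, u, y) = calabi (Φ ∘ pairSymm x₀) (extChartAt (𝓡 (2 * m)) x₀ x,
          extChartAt (𝓡 (2 * m)) x₀ u, extChartAt (𝓡 (2 * m)) x₀ y) := by
  obtain ⟨U, hU, hxU, -, -, hUW, ⟨Φ, hΦ⟩, hTU⟩ := hT.eq_local x₀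
  obtain ⟨B, hB, -, hxB, hBT, hx, hBU, hBV, hBg⟩ :=
    exists_chartAdapted hV hg hx₀ hgx (hU.mem_nhds hxU)
  refine ⟨B, Φ, hB, hxB, hBT, hx, hBV, fun q hq => hUW ⟨hBU hq.1, hBU hq.2.1, hBU hq.2.2⟩, hBg,
    hΦ.mono (prod_mono hBU hBU), fun x hx u hu y hy => ?_⟩
  rw [hTU Φ hΦ x (hBU hx) u (hBU hu) y (hBU hy)]
  simp only [calabi, Function.comp_apply]
  rw [pairSymm_chart x₀ (q := (x, u)) ⟨hx, hu⟩, pairSymm_chart x₀ (q := (u, u)) ⟨hu, hu⟩,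
    pairSymm_chart x₀ (q := (u, y)) ⟨hu, hy⟩, pairSymm_chart x₀ (q := (x, y)) ⟨hx, hy⟩]

theorem mixed_eq_chartForm {x₀ : M} {B : Set (Model m)} (hB : IsOpen B)
    (hBT : B ⊆ (extChartAt (𝓡 (2 * m)) x₀).target) (hg : ChartAdapted x₀ B g) {Φ : M × M → ℝ}
    (hΦ : IsPotential (pullbackForm symp g) (chartSet x₀ B ×ˢ chartSet x₀ B) Φ)
    {p : Model m × Model m} (hp : p ∈ B ×ˢ B) (a b : Model m) :
    fderiv ℝ (fderiv ℝ (Φ ∘ pairSymm x₀)) p (a, 0) (0, b) =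
      chartForm symp x₀ g p ![(a, 0), (0, b)] := by
  have h := ((isPotential_iff hB hBT hg).1 hΦ).2 p hp a 0 0 b
  have h0 : ((0, 0) : Model m × Model m) = 0 := rfl
  rw [h, h0]
  simp

end LocalCalabi

/-! ### The projectors `A`, `B` and the Hessian on the diagonal. -/

section Projectors

variable {m : ℕ} {M : Type*} [TopologicalSpace M] [ChartedSpace (Model m) M]
  [IsManifold (𝓡 (2 * m)) ∞ M]
  {E : M → Type*} [TopologicalSpace (TotalSpace (Fib m) E)] [∀ x, AddCommGroup (E x)]
  [∀ x, Module ℝ (E x)] [∀ x, TopologicalSpace (E x)] [FiberBundle (Fib m) E]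
  [VectorBundle ℝ (Fib m) E] [ContMDiffVectorBundle ∞ (Fib m) E (𝓡 (2 * m))]
  {E' : M → Type*} [TopologicalSpace (TotalSpace (Fib m) E')] [∀ x, AddCommGroup (E' x)]
  [∀ x, Module ℝ (E' x)] [∀ x, TopologicalSpace (E' x)] [FiberBundle (Fib m) E']
  [VectorBundle ℝ (Fib m) E'] [ContMDiffVectorBundle ∞ (Fib m) E' (𝓡 (2 * m))]
  {symp : ∀ x : M, TangentSpace (𝓡 (2 * m)) x [⋀^Fin 2]→L[ℝ] ℝ}
  {lam : TotalSpace (Fib m) E → M} {lam' : TotalSpace (Fib m) E' → M}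

namespace IntersectionData

theorem mfderiv_gamma_diag_fst (D : IntersectionData lam lam')
    (hlam : IsLagrangianField E symp lam) (x : M) (a : Model m) :
    (mfderiv ((𝓡 (2 * m)).prod (𝓡 (2 * m))) (𝓡 (2 * m)) D.gamma (x, x)
      ((a, 0) : Model m × Model m) : Model m) = D.projA x a :=
  D.mfderiv_gamma_fst hlam (D.diag_mem x) a

theorem mfderiv_gamma_diag_snd (D : IntersectionData lam lam')
    (hlam : IsLagrangianField E symp lam) (x : M) (b : Model m) :
    (mfderiv ((𝓡 (2 * m)).prod (𝓡 (2 * m))) (𝓡 (2 * m)) D.gamma (x, x)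
      ((0, b) : Model m × Model m) : Model m) = D.projB x b :=
  D.mfderiv_gamma_snd hlam (D.diag_mem x) b

/-- This is the derivative of the identity `γ(t, t) = t`. -/
theorem projA_add_projB (D : IntersectionData lam lam') (hlam : IsLagrangianField E symp lam)
    (x : M) : D.projA x + D.projB x = ContinuousLinearMap.id ℝ (Model m) := by
  let G : Model m × Model m →L[ℝ] Model m :=
    mfderiv ((𝓡 (2 * m)).prod (𝓡 (2 * m))) (𝓡 (2 * m)) D.gamma (x, x)
  have h1 : HasMFDerivAt ((𝓡 (2 * m)).prod (𝓡 (2 * m))) (𝓡 (2 * m)) D.gamma (x, x) G :=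
    ((D.contMDiffAt_gamma hlam (D.diag_mem x)).mdifferentiableAt (by simp)).hasMFDerivAt
  have h2 : HasMFDerivAt (𝓡 (2 * m)) ((𝓡 (2 * m)).prod (𝓡 (2 * m))) (fun t : M => (t, t)) x
      ((ContinuousLinearMap.id ℝ (Model m)).prod (ContinuousLinearMap.id ℝ (Model m))) :=
    (hasMFDerivAt_id x).prodMk (hasMFDerivAt_id x)
  have h3 : HasMFDerivAt (𝓡 (2 * m)) (𝓡 (2 * m)) (fun t : M => t) x
      (G.comp ((ContinuousLinearMap.id ℝ (Model m)).prod (ContinuousLinearMap.id ℝ (Model m)))) :=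
    (HasMFDerivAt.comp (f := fun t : M => (t, t)) x h1 h2).congr_of_eventuallyEq
      (Filter.Eventually.of_forall fun t => (D.gamma_diag hlam t).symm)
  have h4 := hasMFDerivAt_unique h3 (hasMFDerivAt_id x)
  ext1 v
  have h5 : G (v, v) = v := congrArg (fun L : Model m →L[ℝ] Model m => L v) h4
  have h6 : G (v, v) = G (v, 0) + G (0, v) := by rw [← map_add]; simp
  rw [add_apply, ContinuousLinearMap.id_apply, ← D.mfderiv_gamma_diag_fst hlam,
    ← D.mfderiv_gamma_diag_snd hlam]
  exact h6.symm.trans h5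

/-- Near `x` the map `f = γ(·, x)` is idempotent. If `u = f t` and `z'` is the second component of
`inv (t, x)`, then `(0_u, z')` lies in `Γ` and is close to the zero pair. So it belongs to `W`,
whence `γ(u, x) = u`. -/
theorem projA_comp_projA (D : IntersectionData lam lam') (hlam : IsLagrangianField E symp lam)
    (x : M) : (D.projA x).comp (D.projA x) = D.projA x := by
  let f : M → M := fun t => D.gamma (t, x)
  have hfx : f x = x := D.gamma_diag hlam x
  have hc : ContMDiffAt (𝓡 (2 * m)) ((𝓡 (2 * m)).prod (𝓡 (2 * m))) ∞
      (fun t => (t, x)) x := contMDiffAt_id.prodMk contMDiffAt_const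
  have hf : ContMDiffAt (𝓡 (2 * m)) (𝓡 (2 * m)) ∞ f x :=
    ContMDiffAt.comp (f := fun t => (t, x)) x (D.contMDiffAt_gamma hlam (D.diag_mem x)) hc
  have h1 : HasMFDerivAt (𝓡 (2 * m)) (𝓡 (2 * m)) f x (D.projA x) :=
    (hf.mdifferentiableAt (by simp)).hasMFDerivAt
  have h2 : HasMFDerivAt (𝓡 (2 * m)) (𝓡 (2 * m)) f (f x) (D.projA x) := by
    rw [hfx]; exact h1
  have hz : Continuous fun t : M => (⟨t, 0⟩ : TotalSpace (Fib m) E) :=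
    (contMDiff_zeroSection (n := ∞) (IB := 𝓡 (2 * m)) ℝ E).continuous
  have hi : ContinuousAt (fun t => D.inv (t, x)) x :=
    ContinuousAt.comp (f := fun t => (t, x)) (D.contMDiffAt_inv (D.diag_mem x)).continuousAt
      hc.continuousAt
  have hq : Filter.Tendsto (fun t => ((⟨f t, 0⟩, (D.inv (t, x)).2) :
      TotalSpace (Fib m) E × TotalSpace (Fib m) E')) (𝓝 x) (𝓝 (⟨x, 0⟩, ⟨x, 0⟩)) := by
    have h := (hz.continuousAt.comp hf.continuousAt).prodMk hi.snd
    have h' := h.tendsto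
    have h0 : (⟨f x, 0⟩ : TotalSpace (Fib m) E) = ⟨x, 0⟩ :=
      congrArg (fun t : M => (⟨t, 0⟩ : TotalSpace (Fib m) E)) hfx
    simpa only [Function.comp_apply, h0, D.inv_diag] using h'
  have hev : f =ᶠ[𝓝 x] f ∘ f := by
    filter_upwards [hq.eventually (D.mem_W x),
      hc.continuousAt.eventually (D.isOpen_V.mem_nhds (D.diag_mem x))] with t ht htV
    have e1 := D.gamma_of_mem (ht ((hlam.zero_section _).trans (D.gamma_eq htV).symm))
    have e2 : (D.inv (t, x)).2.proj = x := congrArg Prod.snd (D.proj_inv (t, x) htV)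
    simp only [e2, hlam.zero_section] at e1
    exact e1.symm
  exact hasMFDerivAt_unique ((h2.comp x h1).congr_of_eventuallyEq hev) h1

theorem projB_comp_projB (D : IntersectionData lam lam') (hlam : IsLagrangianField E symp lam)
    (x : M) : (D.projB x).comp (D.projB x) = D.projB x := by
  have h1 : D.projB x = ContinuousLinearMap.id ℝ (Model m) - D.projA x :=
    eq_sub_of_add_eq' (D.projA_add_projB hlam x)
  have h2 : ∀ v, D.projA x (D.projA x v) = D.projA x v := fun v =>
    congrArg (fun L : Model m →L[ℝ] Model m => L v) (D.projA_comp_projA hlam x)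
  ext1 v
  simp [h1, h2]

theorem form_projA_projA (D : IntersectionData lam lam') (hlam : IsLagrangianField E symp lam)
    (hlam' : IsLagrangianField E' symp lam') (x : M) (v w : Model m) :
    formAt symp x ![D.projA x v, D.projA x w] = 0 := by
  have h := D.pullback_fst_eq_zero hlam hlam' (D.diag_mem x) v w
  rwa [pullbackForm_apply, D.mfderiv_gamma_diag_fst hlam, D.mfderiv_gamma_diag_fst hlam,
    D.gamma_diag hlam] at h

theorem form_projB_projB (D : IntersectionData lam lam') (hlam : IsLagrangianField E symp lam)
    (x : M) (v w : Model m) : formAt symp x ![D.projB x v, D.projB x w] = 0 := by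
  have h := D.pullback_snd_eq_zero hlam (D.diag_mem x) v w
  rwa [pullbackForm_apply, D.mfderiv_gamma_diag_snd hlam, D.mfderiv_gamma_diag_snd hlam,
    D.gamma_diag hlam] at h

theorem chartForm_diag (D : IntersectionData lam lam') (hlam : IsLagrangianField E symp lam)
    (x : M) (a b : Model m) :
    chartForm symp x D.gamma (extChartAt (𝓡 (2 * m)) x x, extChartAt (𝓡 (2 * m)) x x)
      ![(a, 0), (0, b)] = formAt symp x ![D.projA x a, D.projB x b] := by
  have hp : pairSymm x (extChartAt (𝓡 (2 * m)) x x, extChartAt (𝓡 (2 * m)) x x) = (x, x) := by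
    simp only [pairSymm, extChartAt_to_inv]
  have hT := mem_extChartAt_target (I := 𝓡 (2 * m)) x
  have h := pullbackForm_pairSymm symp x (g := D.gamma)
    (p := (extChartAt (𝓡 (2 * m)) x x, extChartAt (𝓡 (2 * m)) x x)) hT hT
    (by rw [hp]; exact D.contMDiffAt_gamma hlam (D.diag_mem x))
    (by rw [hp, D.gamma_diag hlam]; exact mem_extChartAt_source x) (a, 0) (0, b)
  simp only [map_zero, chartDeriv_self] at h
  rw [← h, hp, pullbackForm_apply, D.mfderiv_gamma_diag_fst hlam, D.mfderiv_gamma_diag_snd hlam,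
    D.gamma_diag hlam]

/-- The second derivative of the Calabi function at a point of the diagonal. -/
theorem fderiv_fderiv_calabi_diag (D : IntersectionData lam lam')
    (hlam : IsLagrangianField E symp lam) (hlam' : IsLagrangianField E' symp lam') (x : M)
    {B : Set (Model m)} (hB : IsOpen B) (hxB : extChartAt (𝓡 (2 * m)) x x ∈ B)
    (hBT : B ⊆ (extChartAt (𝓡 (2 * m)) x).target) (hg : ChartAdapted x B D.gamma) {Φ : M × M → ℝ}
    (hΦ : IsPotential (pullbackForm symp D.gamma) (chartSet x B ×ˢ chartSet x B) Φ)
    (v w : Model m) :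
    fderiv ℝ (fderiv ℝ fun u => calabi (Φ ∘ pairSymm x) (extChartAt (𝓡 (2 * m)) x x, u,
      extChartAt (𝓡 (2 * m)) x x)) (extChartAt (𝓡 (2 * m)) x x) v w =
      formAt symp x ![v, (D.projA x - D.projB x) w] := by
  have hm : (extChartAt (𝓡 (2 * m)) x x, extChartAt (𝓡 (2 * m)) x x) ∈ B ×ˢ B := ⟨hxB, hxB⟩
  have hΦs := ((isPotential_iff hB hBT hg).1 hΦ).1
  have hmix : ∀ a b, fderiv ℝ (fderiv ℝ (Φ ∘ pairSymm x))
      (extChartAt (𝓡 (2 * m)) x x, extChartAt (𝓡 (2 * m)) x x) (a, 0) (0, b) =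
      formAt symp x ![D.projA x a, D.projB x b] := fun a b => by
    rw [mixed_eq_chartForm hB hBT hg hΦ hm, D.chartForm_diag hlam]
  have hsplit : ∀ u : Model m, (u, u) = (u, 0) + ((0, u) : Model m × Model m) := fun u => by simp
  rw [fderiv_fderiv_calabi (hB.prod hB) hΦs hm hm hm, hsplit v, hsplit w]
  simp only [map_add, add_apply]
  -- After expansion the pure second derivatives of `Φ` cancel and minus the symmetrized mixed
  -- derivative remains. Isotropy of the images of `projA` and `projB` identifies it with the right
  -- side once `v` is split into its two components.
  rw [fderiv_fderiv_symm (hB.prod hB) hΦs hm (0, v) (w, 0), hmix, hmix]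
  have hv : v = D.projA x v + D.projB x v :=
    (congrArg (fun L : Model m →L[ℝ] Model m => L v) (D.projA_add_projB hlam x)).symm
  let ω₀ := toBilin (formAt symp x)
  have hω : ∀ a b, formAt symp x ![a, b] = ω₀ a b := fun a b => (toBilin_apply _ a b).symm
  have e1 := D.form_projA_projA hlam hlam' x v w
  have e2 := D.form_projB_projB hlam x v w
  have e3 : ω₀ (D.projA x w) (D.projB x v) = - ω₀ (D.projB x v) (D.projA x w) :=
    toBilin_swap _ _ _
  rw [hω] at e1 e2
  conv_rhs => rw [hv]
  simp only [hω, map_add, map_sub, sub_apply, add_apply, e1, e2, e3]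
  ring

end IntersectionData

end Projectors

/-! ### Critical points of the Calabi function near the diagonal. -/

section CriticalPoints

variable {m : ℕ} {M : Type*} [TopologicalSpace M] [ChartedSpace (Model m) M]
  [IsManifold (𝓡 (2 * m)) ∞ M]
  {E : M → Type*} [TopologicalSpace (TotalSpace (Fib m) E)] [∀ x, AddCommGroup (E x)]
  [∀ x, Module ℝ (E x)] [∀ x, TopologicalSpace (E x)] [FiberBundle (Fib m) E]
  [VectorBundle ℝ (Fib m) E] [ContMDiffVectorBundle ∞ (Fib m) E (𝓡 (2 * m))]
  {E' : M → Type*} [TopologicalSpace (TotalSpace (Fib m) E')] [∀ x, AddCommGroup (E' x)]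
  [∀ x, Module ℝ (E' x)] [∀ x, TopologicalSpace (E' x)] [FiberBundle (Fib m) E']
  [VectorBundle ℝ (Fib m) E'] [ContMDiffVectorBundle ∞ (Fib m) E' (𝓡 (2 * m))]
  {symp : ∀ x : M, TangentSpace (𝓡 (2 * m)) x [⋀^Fin 2]→L[ℝ] ℝ}
  {lam : TotalSpace (Fib m) E → M} {lam' : TotalSpace (Fib m) E' → M}
  {WT : Set (M × M × M)} {T : M × M × M → ℝ}

namespace IntersectionData

/-- Nearby points `x, y` are joined to `γ(x, y)` by curves along which `γ` is constant. -/
theorem eventually_exists_paths (D : IntersectionData lam lam')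
    (hlam : IsLagrangianField E symp lam) (hlam' : IsLagrangianField E' symp lam') (x₀ : M)
    {N : Set M} (hN : N ∈ 𝓝 x₀) : ∀ᶠ p in 𝓝 (x₀, x₀), ∃ s r : ℝ → M,
      s 0 = D.gamma p ∧ s 1 = p.1 ∧ r 0 = D.gamma p ∧ r 1 = p.2 ∧
      (∀ t ∈ Icc (0 : ℝ) 1, s t ∈ N ∧ MDifferentiableAt 𝓘(ℝ, ℝ) (𝓡 (2 * m)) s t) ∧
      (∀ τ ∈ Icc (0 : ℝ) 1, r τ ∈ N ∧ MDifferentiableAt 𝓘(ℝ, ℝ) (𝓡 (2 * m)) r τ) ∧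
      ∀ t ∈ Icc (0 : ℝ) 1, ∀ τ ∈ Icc (0 : ℝ) 1, D.gamma (s t, r τ) = D.gamma p := by
  have hW := D.mem_W x₀
  rw [nhds_prod_eq] at hW
  obtain ⟨O, hO, O', hO', hOW⟩ := Filter.mem_prod_iff.1 hW
  have hπ : ∀ᶠ z in 𝓝 (⟨x₀, 0⟩ : TotalSpace (Fib m) E), z.proj ∈ N :=
    (FiberBundle.continuous_proj (Fib m) E).continuousAt.eventually hN
  have hπ' : ∀ᶠ z in 𝓝 (⟨x₀, 0⟩ : TotalSpace (Fib m) E'), z.proj ∈ N :=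
    (FiberBundle.continuous_proj (Fib m) E').continuousAt.eventually hN
  obtain ⟨Z, hZ, hZc⟩ := hlam.exists_path x₀ (Filter.inter_mem hO hπ)
  obtain ⟨Z', hZ', hZc'⟩ := hlam'.exists_path x₀ (Filter.inter_mem hO' hπ')
  have hinv : Filter.Tendsto D.inv (𝓝 (x₀, x₀)) (𝓝 (⟨x₀, 0⟩, ⟨x₀, 0⟩)) := by
    have h := (D.contMDiffAt_inv (D.diag_mem x₀)).continuousAt.tendsto
    rwa [D.inv_diag] at h
  filter_upwards [hinv.eventually (prod_mem_nhds hZ hZ'), D.isOpen_V.mem_nhds (D.diag_mem x₀)]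
    with p hp hpV
  obtain ⟨c, hc0, hc1, hc⟩ := hZc _ hp.1
  obtain ⟨c', hc0', hc1', hc'⟩ := hZc' _ hp.2
  have hpr : ((D.inv p).1.proj, (D.inv p).2.proj) = p := D.proj_inv p hpV
  refine ⟨fun t => (c t).proj, fun t => (c' t).proj, ?_, ?_, ?_, ?_, fun t ht => ⟨(hc t ht).1.2, ?_⟩,
    fun t ht => ⟨(hc' t ht).1.2, ?_⟩, fun t ht τ hτ => ?_⟩
  · simp only [hc0]; rfl
  · simp only [hc1]; exact congrArg Prod.fst hpr
  · simp only [hc0']; exact D.gamma_eq hpV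
  · simp only [hc1']; exact congrArg Prod.snd hpr
  · exact ((Bundle.contMDiff_proj (n := ∞) E (c t)).mdifferentiableAt (by simp)).comp t
      (hc t ht).2.2
  · exact ((Bundle.contMDiff_proj (n := ∞) E' (c' t)).mdifferentiableAt (by simp)).comp t
      (hc' t ht).2.2
  -- Since `lam` is constant along `c` and `lam'` along `c'`, with the same value `γ(p)`, every pair
  -- `(c t, c' τ)` lies in `Γ`. It stays close to the zero pair over `x₀`, hence in `W`, so `γ` of
  -- its projections is this value.
  · refine (D.gamma_of_mem (hOW (show (c t, c' τ) ∈ O ×ˢ O' from ⟨(hc t ht).1.1, (hc' τ hτ).1.1⟩)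
      ?_)).trans (hc t ht).2.1
    exact (hc t ht).2.1.trans ((D.gamma_eq hpV).symm.trans (hc' τ hτ).2.1.symm)

end IntersectionData

/-- As `g` is constant on the products of the two curves, its derivative kills their velocities. So
the mixed derivative of the potential, which is the pulled back form, vanishes on them, and
`calabi_critical` applies. -/
theorem critical_of_paths {x₀ : M} {B : Set (Model m)} {g : M × M → M} (hB : IsOpen B)
    (hBT : B ⊆ (extChartAt (𝓡 (2 * m)) x₀).target) (hg : ChartAdapted x₀ B g) {Φ : M × M → ℝ}
    (hΦ : IsPotential (pullbackForm symp g) (chartSet x₀ B ×ˢ chartSet x₀ B) Φ)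
    {s r : ℝ → M} {u : M} (hs0 : s 0 = u) (hr0 : r 0 = u)
    (hs : ∀ t ∈ Icc (0 : ℝ) 1, s t ∈ chartSet x₀ B ∧ MDifferentiableAt 𝓘(ℝ, ℝ) (𝓡 (2 * m)) s t)
    (hr : ∀ t ∈ Icc (0 : ℝ) 1, r t ∈ chartSet x₀ B ∧ MDifferentiableAt 𝓘(ℝ, ℝ) (𝓡 (2 * m)) r t)
    (hu : ∀ t ∈ Icc (0 : ℝ) 1, ∀ τ ∈ Icc (0 : ℝ) 1, g (s t, r τ) = u) :
    calabi (Φ ∘ pairSymm x₀) (extChartAt (𝓡 (2 * m)) x₀ (s 1), extChartAt (𝓡 (2 * m)) x₀ u,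
        extChartAt (𝓡 (2 * m)) x₀ (r 1)) = 0 ∧
      fderiv ℝ (fun e => calabi (Φ ∘ pairSymm x₀) (extChartAt (𝓡 (2 * m)) x₀ (s 1), e,
        extChartAt (𝓡 (2 * m)) x₀ (r 1))) (extChartAt (𝓡 (2 * m)) x₀ u) = 0 := by
  let φ := extChartAt (𝓡 (2 * m)) x₀
  have hd : ∀ {c : ℝ → M}, (∀ t ∈ Icc (0 : ℝ) 1, c t ∈ chartSet x₀ B ∧
      MDifferentiableAt 𝓘(ℝ, ℝ) (𝓡 (2 * m)) c t) →
      ∀ t ∈ Icc (0 : ℝ) 1, HasDerivAt (φ ∘ c) (deriv (φ ∘ c) t) t := fun hc t ht =>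
    (((contMDiffAt_chart x₀ (hc t ht).1.1).mdifferentiableAt (by simp)).comp t
      (hc t ht).2).differentiableAt.hasDerivAt
  have hm : ∀ t ∈ Icc (0 : ℝ) 1, ∀ τ ∈ Icc (0 : ℝ) 1, (φ (s t), φ (r τ)) ∈ B ×ˢ B :=
    fun t ht τ hτ => ⟨(hs t ht).1.2, (hr τ hτ).1.2⟩
  have hG : ∀ p ∈ B ×ˢ B, DifferentiableAt ℝ (chartMap x₀ g) p := fun p hp =>
    (hasFDerivAt_of_contDiffOn (hB.prod hB) (hg.contDiffOn hBT) hp).differentiableAt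
  have hk : ∀ t ∈ Icc (0 : ℝ) 1, ∀ τ ∈ Icc (0 : ℝ) 1, chartMap x₀ g (φ (s t), φ (r τ)) = φ u := by
    intro t ht τ hτ
    rw [chartMap, pairSymm_chart x₀ (q := (s t, r τ)) ⟨(hs t ht).1, (hr τ hτ).1⟩, hu t ht τ hτ]
  have hz : ∀ p v w, toBilin (inChart symp x₀ (chartMap x₀ g p)) v w =
      inChart symp x₀ (chartMap x₀ g p) ![v, w] := fun p v w => toBilin_apply _ v w
  have h := calabi_critical (hB.prod hB) ((isPotential_iff hB hBT hg).1 hΦ).1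
    (s := φ ∘ s) (r := φ ∘ r) (hd hs) (hd hr) hm (by simp only [Function.comp_apply, hs0, hr0])
    (fun t ht τ hτ w => ?_) (fun t ht τ hτ w => ?_)
  · simpa only [Function.comp_apply, hr0] using h
  · refine (mixed_eq_chartForm hB hBT hg hΦ (hm t ht τ hτ) _ _).trans ?_
    rw [chartForm_apply, ← hz]
    have h0 : fderiv ℝ (chartMap x₀ g) (φ (s t), φ (r τ)) (deriv (φ ∘ s) t, 0) = 0 :=
      fderiv_fst_eq_zero_of_const (s := φ ∘ s) ht (hG _ (hm t ht τ hτ)) (hd hs t ht)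
        fun t ht => hk t ht τ hτ
    rw [h0, map_zero, zero_apply]
  · refine (mixed_eq_chartForm hB hBT hg hΦ (hm t ht τ hτ) _ _).trans ?_
    rw [chartForm_apply, ← hz]
    have h0 : fderiv ℝ (chartMap x₀ g) (φ (s t), φ (r τ)) (0, deriv (φ ∘ r) τ) = 0 :=
      fderiv_snd_eq_zero_of_const (r := φ ∘ r) hτ (hG _ (hm t ht τ hτ)) (hd hr τ hτ)
        fun τ hτ => hk t ht τ hτ
    rw [h0, map_zero]

namespace IntersectionData

/-- For complementary projectors `A - B` is its own inverse, so its values exhaust the tangent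
space. -/
theorem nondegenerate_diag (D : IntersectionData lam lam') (hsymp : IsSymplecticForm symp)
    (hlam : IsLagrangianField E symp lam) (x : M) (v : Model m)
    (h : ∀ w, formAt symp x ![v, (D.projA x - D.projB x) w] = 0) : v = 0 := by
  have hA : ∀ w, D.projA x (D.projA x w) = D.projA x w := fun w =>
    congrArg (fun L : Model m →L[ℝ] Model m => L w) (D.projA_comp_projA hlam x)
  have h1 : D.projB x = ContinuousLinearMap.id ℝ (Model m) - D.projA x :=
    eq_sub_of_add_eq' (D.projA_add_projB hlam x)
  have hinv : ∀ w, (D.projA x - D.projB x) ((D.projA x - D.projB x) w) = w := fun w => by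
    simp [h1, hA]
  have h2 : ∀ w, formAt symp x ![v, w] = 0 := fun w => by
    have := h ((D.projA x - D.projB x) w)
    rwa [hinv] at this
  exact hsymp.nondegenerate x v h2

theorem hessianAt_calabi (D : IntersectionData lam lam')
    (hlam : IsLagrangianField E symp lam) (hlam' : IsLagrangianField E' symp lam')
    (hT : IsCalabiFunction (pullbackForm symp D.gamma) D.V WT T) (x : M) (v w : Model m) :
    hessianAt (m := m) (fun u : M => T (x, u, x)) x v w =
      formAt symp x ![v, (D.projA x - D.projB x) w] := by
  obtain ⟨B, Φ, hB, hxB, hBT, hx, -, -, hBg, hΦ, hTΦ⟩ := hT.exists_chart D.isOpen_V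
    (fun p hp => D.contMDiffAt_gamma hlam hp) (D.diag_mem x) (D.gamma_diag hlam x)
  rw [← D.fderiv_fderiv_calabi_diag hlam hlam' x hB hxB hBT hBg hΦ]
  refine congrArg (fun L : Model m →L[ℝ] Model m →L[ℝ] ℝ => L v w)
    (Filter.EventuallyEq.fderiv_eq (Filter.EventuallyEq.fderiv ?_))
  filter_upwards [hB.mem_nhds hxB] with e he
  simp only [Function.comp_apply]
  rw [hTΦ x hx _ (chart_symm_mem_chartSet (m := m) x hBT he) x hx,
    (extChartAt (𝓡 (2 * m)) x).right_inv (hBT he)]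

/-- The paths from `γ(x, y)` to `x` and `y` give the critical point and the critical value.
Nondegeneracy spreads from `(x₀, x₀, x₀)` by openness, as `(x, γ(x, y), y)` tends to this point. -/
theorem eventually_critical (D : IntersectionData lam lam') (hsymp : IsSymplecticForm symp)
    (hlam : IsLagrangianField E symp lam) (hlam' : IsLagrangianField E' symp lam')
    (hT : IsCalabiFunction (pullbackForm symp D.gamma) D.V WT T) (x₀ : M) :
    ∀ᶠ p in 𝓝 (x₀, x₀), (p.1, D.gamma p, p.2) ∈ WT ∧
      IsNondegenerateCriticalPoint (m := m) (fun u : M => T (p.1, u, p.2)) (D.gamma p) ∧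
      T (p.1, D.gamma p, p.2) = 0 := by
  obtain ⟨B, Φ, hB, hxB, hBT, hx, -, hBW, hBg, hΦ, hTΦ⟩ := hT.exists_chart D.isOpen_V
    (fun p hp => D.contMDiffAt_gamma hlam hp) (D.diag_mem x₀) (D.gamma_diag hlam x₀)
  let φ := extChartAt (𝓡 (2 * m)) x₀
  let F : Model m × Model m × Model m → ℝ := calabi (Φ ∘ pairSymm x₀)
  have hF : ContDiffOn ℝ ∞ F (B ×ˢ B ×ˢ B) :=
    contDiffOn_calabi ((isPotential_iff hB hBT hBg).1 hΦ).1
  have hBo : IsOpen (chartSet x₀ B) := isOpen_chartSet x₀ hB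
  have hnd := eventually_nondegenerate (hB.prod (hB.prod hB)) hF (q₀ := (φ x₀, φ x₀, φ x₀))
    ⟨hxB, hxB, hxB⟩ fun v hv => D.nondegenerate_diag hsymp hlam x₀ v fun w =>
      (D.fderiv_fderiv_calabi_diag hlam hlam' x₀ hB hxB hBT hBg hΦ v w).symm.trans (hv w)
  have hγ : Filter.Tendsto D.gamma (𝓝 (x₀, x₀)) (𝓝 x₀) := by
    have h := (D.contMDiffAt_gamma hlam (D.diag_mem x₀)).continuousAt.tendsto
    rwa [D.gamma_diag hlam] at h
  have hφ : Filter.Tendsto φ (𝓝 x₀) (𝓝 (φ x₀)) := (continuousAt_extChartAt x₀).tendsto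
  have h1 : Filter.Tendsto (Prod.fst : M × M → M) (𝓝 (x₀, x₀)) (𝓝 x₀) :=
    continuous_fst.continuousAt
  have h2 : Filter.Tendsto (Prod.snd : M × M → M) (𝓝 (x₀, x₀)) (𝓝 x₀) :=
    continuous_snd.continuousAt
  have hq : Filter.Tendsto (fun p : M × M => (φ p.1, φ (D.gamma p), φ p.2)) (𝓝 (x₀, x₀))
      (𝓝 (φ x₀, φ x₀, φ x₀)) :=
    (hφ.comp h1).prodMk_nhds ((hφ.comp hγ).prodMk_nhds (hφ.comp h2))
  filter_upwards [D.eventually_exists_paths hlam hlam' x₀ (hBo.mem_nhds hx), hq.eventually hnd]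
    with p hp hpn
  obtain ⟨s, r, hs0, hs1, hr0, hr1, hs, hr, hsr⟩ := hp
  have hpu : D.gamma p ∈ chartSet x₀ B := hs0 ▸ (hs 0 (by simp)).1
  have hp1 : p.1 ∈ chartSet x₀ B := hs1 ▸ (hs 1 (by simp)).1
  have hp2 : p.2 ∈ chartSet x₀ B := hr1 ▸ (hr 1 (by simp)).1
  have hcr := critical_of_paths hB hBT hBg hΦ hs0 hr0 hs hr hsr
  rw [hs1, hr1] at hcr
  refine ⟨hBW ⟨hp1, hpu, hp2⟩, ?_, (hTΦ _ hp1 _ hpu _ hp2).trans hcr.1⟩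
  refine isNondegenerateCriticalPoint_of_chart x₀ hpu.1 hB (k := fun e => F (φ p.1, e, φ p.2))
    ?_ hpu.2 ?_ hcr.2 hpn
  · exact hF.comp (by fun_prop : ContDiff ℝ ∞ fun e => (φ p.1, e, φ p.2)).contDiffOn
      fun e he => ⟨hp1.2, he, hp2.2⟩
  · filter_upwards [hBo.mem_nhds hpu] with u hu
    exact hTΦ _ hp1 _ hu _ hp2

end IntersectionData

end CriticalPoints

end LagrangianFields

end

theorem mainTheorem3 (m : ℕ) {M : Type*} [TopologicalSpace M] [T2Space M]
    [SecondCountableTopology M] [ChartedSpace (LagrangianFields.Model m) M]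
    [IsManifold (𝓡 (2 * m)) ∞ M]
    (symp : ∀ x : M, TangentSpace (𝓡 (2 * m)) x [⋀^Fin 2]→L[ℝ] ℝ)
    (hsymp : LagrangianFields.IsSymplecticForm symp)
    (E : M → Type*) [TopologicalSpace (TotalSpace (LagrangianFields.Fib m) E)]
    [∀ x, AddCommGroup (E x)] [∀ x, Module ℝ (E x)] [∀ x, TopologicalSpace (E x)]
    [FiberBundle (LagrangianFields.Fib m) E] [VectorBundle ℝ (LagrangianFields.Fib m) E]
    [ContMDiffVectorBundle ∞ (LagrangianFields.Fib m) E (𝓡 (2 * m))]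
    (E' : M → Type*) [TopologicalSpace (TotalSpace (LagrangianFields.Fib m) E')]
    [∀ x, AddCommGroup (E' x)] [∀ x, Module ℝ (E' x)] [∀ x, TopologicalSpace (E' x)]
    [FiberBundle (LagrangianFields.Fib m) E'] [VectorBundle ℝ (LagrangianFields.Fib m) E']
    [ContMDiffVectorBundle ∞ (LagrangianFields.Fib m) E' (𝓡 (2 * m))]
    (lam : TotalSpace (LagrangianFields.Fib m) E → M)
    (lam' : TotalSpace (LagrangianFields.Fib m) E' → M)
    (hlam : LagrangianFields.IsLagrangianField E symp lam)
    (hlam' : LagrangianFields.IsLagrangianField E' symp lam')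
    (htrans : LagrangianFields.Transversal lam lam') :
    Nonempty (LagrangianFields.IntersectionData lam lam') ∧
    ∀ D : LagrangianFields.IntersectionData lam lam',
      (∃ (WT : Set (M × M × M)) (T : M × M × M → ℝ),
        LagrangianFields.IsCalabiFunction
          (LagrangianFields.pullbackForm symp D.gamma) D.V WT T) ∧
      ∀ (WT : Set (M × M × M)) (T : M × M × M → ℝ),
        LagrangianFields.IsCalabiFunction
          (LagrangianFields.pullbackForm symp D.gamma) D.V WT T →
        (∃ VT : Set (M × M), IsOpen VT ∧ (∀ x : M, (x, x) ∈ VT) ∧ VT ⊆ D.V ∧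
          ∀ x y : M, (x, y) ∈ VT →
            (x, D.gamma (x, y), y) ∈ WT ∧
            LagrangianFields.IsNondegenerateCriticalPoint (m := m) (fun u : M => T (x, u, y))
              (D.gamma (x, y)) ∧
            T (x, D.gamma (x, y), y) = 0) ∧
        ∀ x : M,
          D.projA x + D.projB x = ContinuousLinearMap.id ℝ (LagrangianFields.Model m) ∧
          (D.projA x).comp (D.projA x) = D.projA x ∧
          (D.projB x).comp (D.projB x) = D.projB x ∧
          ∀ v w : TangentSpace (𝓡 (2 * m)) x,
            LagrangianFields.hessianAt (m := m) (fun u : M => T (x, u, x)) x v w =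
              symp x ![v, (D.projA x - D.projB x) w] := by
  refine ⟨LagrangianFields.nonempty_intersectionData hlam hlam' htrans, fun D => ⟨?_, ?_⟩⟩
  · exact LagrangianFields.exists_isCalabiFunction hsymp D.isOpen_V
      (fun p hp => D.contMDiffAt_gamma hlam hp) D.diag_mem (D.gamma_diag hlam)
      (fun q hq => D.pullback_fst_eq_zero hlam hlam' hq)
      (fun q hq => D.pullback_snd_eq_zero hlam hq)
  · intro WT T hT
    refine ⟨?_, fun x => ⟨D.projA_add_projB hlam x, D.projA_comp_projA hlam x,
      D.projB_comp_projB hlam x, D.hessianAt_calabi hlam hlam' hT x⟩⟩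
    have hcr := fun x => (D.eventually_critical hsymp hlam hlam' hT x).and
      (D.isOpen_V.mem_nhds (D.diag_mem x))
    exact ⟨interior {p | _}, isOpen_interior, fun x => mem_interior_iff_mem_nhds.2 (hcr x),
      fun p hp => (interior_subset hp).2, fun x y hxy => (interior_subset hxy).1⟩
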